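/- **Setting.** Let $X$ be a locally compact Hausdorff space with countable base. For a family $\mathcal V$ of open sets and an open set $U$ let $\mathcal V(U)=\{W\in\mathcal V:\overline W\subset U\}$. A *boundary kernel* for an open set $U$ is a Borel kernel $T$ on $X$ with $T(x,X\setminus\partial U)=0$ for $x\in U$ and $T(x,\cdot)=\varepsilon_x$ (Dirac measure) for $x\notin U$. Let $\mathcal V$ be a base of relatively compact open sets and, for $V\in\mathcal V$, let $H_V$ be a boundary kernel for $V$; write $H_Vf(x)=\int f\,dH_V(x,\cdot)$. A *local choice* $\mathcal W$ from $\mathcal V$ in an open set $U$ assigns to each $x\in U$ a fundamental system $\mathcal W(x)\subset\mathcal V(U)$ of neighborhoods of $x$. A lower semicontinuous $u\colon U\to[0,\infty]$ is *positive $\mathcal W$-hyperharmonic* on $U$ if $H_Wu(x)\le u(x)$ for all $x\in U$, $W\in\mathcal W(x)$, and *positive hyperharmonic* on $U$ if this holds for all $W\in\mathcal V(U)$ and all $x\in W$. $(H_V)_{V\in\mathcal V}$ is a *normal Bauer family* (of harmonic boundary kernels on $X$) if, for every $V\in\mathcal V$: $(H_1)$ $H_WH_V=H_V$ for $W\in\mathcal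 V$, $W\subset V$, where $H_WH_V(x,\cdot)=\int H_V(y,\cdot)\,H_W(x,dy)$; $(H_2)$ $H_Vf\in C(X)$ for $f\in C(X)$, and $H_V1=1$; $(H_3)$ there is a local choice $\mathcal W$ from $\mathcal V$ in $V$ such that the positive $\mathcal W$-hyperharmonic functions on $V$ separate the points of $V$; $(H_4)$ $H_Vf$ is continuous on $V$ for every bounded Borel function $f$. Given such a family, $h\in C(U)$ is *harmonic* on the open set $U$ if $H_Vh=h$ on $U$ for all $V\in\mathcal V(U)$. An open set $U$ is a *$\mathcal P$-set* if the positive hyperharmonic functions on $U$ separate its points. A relatively compact open set $U$ is *regular* if every $f\in C(\partial U)$ has a unique extension in $C(\overline U)$ that is harmonic on $U$, and this extension is $\ge0$ if $f\ge0$; then $H_U$ denotes the boundary kernel for $U$ for which $H_Uf$ is this extension on $\overline U$. A compact $K\neq\emptyset$ is *strongly stable* if it is contained in a $\mathcal P$-set $W$ such that there is a harmonic function $h>0$ on $W\setminus K$ with $\lim_{x\to z}h(x)=0$ for every $z\in\partial K$. **Data.** Let $(H_V)_{V\in\mathcal V}$ be a normal Bauer family on $X$ and $K$ a strongly stable compact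 set. Let $X_0=\{x_0\}\cup(X\setminus K)$ be the quotient space obtained by collapsing $K$ to a point $x_0$. Let $W_0\supset K$ be a regular $\mathcal P$-set such that $W_0\setminus K$ is regular and $g:=H_{W_0\setminus K}1_{\partial W_0}>0$ on $W_0\setminus K$. For $0<r<1$ let $A_r=\{x\in W_0\setminus K: g(x)<r\}$ (these sets are regular), $S_r=\{x\in W_0\setminus K:g(x)=r\}$, $U_r=\{x_0\}\cup A_r\subset X_0$. Let $\mathcal V_0=\{U_r:0<r<1\}\cup\{V\in\mathcal V:\overline V\cap K=\emptyset\}$, where for $V$ of the second kind $H_V$ is regarded as a kernel on $X_0$ (with $H_V(x_0,\cdot)=\varepsilon_{x_0}$). For $0<r<1$ let $\sigma_r$ be a probability measure on $S_r$. **Theorem.** (1) The following are equivalent. (a) There exist boundary kernels $H_{U_r}$, $0<r<1$, on $X_0$ such that $(H_V)_{V\in\mathcal V_0}$ is a normal Bauer family on $X_0$ and $H_{U_t}(x_0,\cdot)=\sigma_t$ for every $0<t<1$. (b) The measures $\sigma_r$ are compatible: for all $0<r<t<1$, $\int H_{A_t}(y,\cdot)\,d\sigma_r(y)=(r/t)\,\sigma_t$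 on $S_t$. (2) Let $H_{U_r}$, $0<r<1$, be any kernels as in (a). Then, for all $0<t<1$, all Borel sets $B$ in $X_0$ and all $y\in A_t$, $$H_{U_t}(y,B)=H_{A_t}(y,B\cap S_t)+\bigl(1-g(y)/t\bigr)\sigma_t(B).$$ With respect to the family $(H_V)_{V\in\mathcal V_0}$ on $X_0$, the singleton $\{x_0\}$ is strongly stable and $\{x_0\}\cup(W_0\setminus K)$ is a $\mathcal P$-set. Moreover, for every open neighborhood $W$ of $x_0$ in $X_0$ and every $h\in C(W)$ that is harmonic on $W\setminus\{x_0\}$ with respect to $(H_V)_{V\in\mathcal V}$, the following are equivalent: (a) $h$ is harmonic on $W$ with respect to $(H_V)_{V\in\mathcal V_0}$; (b) $\int h\,d\sigma_r=h(x_0)$ for every $0<r<1$ with $\overline{U_r}\subset W$; (c) $\int h\,d\sigma_r=h(x_0)$ for some $0<r<1$ with $\overline{U_r}\subset W$. -/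

import Mathlib

open MeasureTheory ProbabilityTheory Set Filter Topology
open scoped ENNReal

namespace Bauer

section Families

variable {X : Type*} [TopologicalSpace X] [MeasurableSpace X]

/-- `T` is a boundary kernel for `U`: `T(x, X ∖ ∂U) = 0` for `x ∈ U`, and `T(x, ·)` is the Dirac
measure at `x` for `x ∉ U`. -/
def IsBoundaryKernel (U : Set X) (T : Kernel X X) : Prop :=
  (∀ x ∈ U, T x (frontier U)ᶜ = 0) ∧ ∀ x ∉ U, T x = Measure.dirac x

/-- All `W ∈ 𝒱` with `x ∈ W` and `closure W ⊆ U`. -/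
def fullChoice (𝒱 : Set (Set X)) (U : Set X) (x : X) : Set (Set X) :=
  {W | W ∈ 𝒱 ∧ closure W ⊆ U ∧ x ∈ W}

/-- A local choice from `𝒱` in `U`: every `𝒲 x`, `x ∈ U`, is a fundamental system of
neighborhoods `W` of `x` with `W ∈ 𝒱` and `closure W ⊆ U`. -/
def IsLocalChoice (𝒱 : Set (Set X)) (U : Set X) (𝒲 : X → Set (Set X)) : Prop :=
  ∀ x ∈ U, 𝒲 x ⊆ fullChoice 𝒱 U x ∧ ∀ N ∈ 𝓝 x, ∃ W ∈ 𝒲 x, W ⊆ N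

/-- `u` is a positive (that is, `[0, ∞]`-valued) `𝒲`-hyperharmonic function on `U`. Only the values
of `u` on `U` matter. -/
def IsPosHyperharmonic (H : Set X → Kernel X X) (𝒲 : X → Set (Set X)) (U : Set X)
    (u : X → ℝ≥0∞) : Prop :=
  LowerSemicontinuousOn u U ∧ ∀ x ∈ U, ∀ W ∈ 𝒲 x, ∫⁻ y, u y ∂(H W x) ≤ u x

/-- The positive `𝒲`-hyperharmonic functions on `U` separate the points of `U`. -/
def PosHyperharmonicSeparates (H : Set X → Kernel X X) (𝒲 : X → Set (Set X))
    (U : Set X) : Prop :=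
  ∀ x ∈ U, ∀ y ∈ U, x ≠ y → ∃ u : X → ℝ≥0∞, IsPosHyperharmonic H 𝒲 U u ∧ u x ≠ u y

/-- `(H V)`, `V ∈ 𝒱`, is a normal Bauer family of harmonic boundary kernels. The values `H V` for
`V ∉ 𝒱` play no role. The product `H_W H_V`, that is `x ↦ ∫ H_V(y, ·) H_W(x, dy)`, is
`H V ∘ₖ H W` in Mathlib's notation. -/
structure IsNormalBauerFamily (𝒱 : Set (Set X)) (H : Set X → Kernel X X) : Prop where
  isBasis : TopologicalSpace.IsTopologicalBasis 𝒱
  isCompact_closure : ∀ V ∈ 𝒱, IsCompact (closure V)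
  isBoundaryKernel : ∀ V ∈ 𝒱, IsBoundaryKernel V (H V)
  comp_eq : ∀ V ∈ 𝒱, ∀ W ∈ 𝒱, W ⊆ V → H V ∘ₖ H W = H V
  continuous_integral : ∀ V ∈ 𝒱, ∀ f : X → ℝ, Continuous f → Continuous fun x => ∫ y, f y ∂(H V x)
  normal : ∀ V ∈ 𝒱, ∀ x, H V x univ = 1
  separates : ∀ V ∈ 𝒱, ∃ 𝒲 : X → Set (Set X),
    IsLocalChoice 𝒱 V 𝒲 ∧ PosHyperharmonicSeparates H 𝒲 V
  continuousOn_integral : ∀ V ∈ 𝒱, ∀ f : X → ℝ, Measurable f → (∃ C, ∀ x, |f x| ≤ C) →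
    ContinuousOn (fun x => ∫ y, f y ∂(H V x)) V

/-- `h` is harmonic on the open set `U`. Only the values of `h` on `U` matter. -/
def IsHarmonic (𝒱 : Set (Set X)) (H : Set X → Kernel X X) (U : Set X) (h : X → ℝ) : Prop :=
  ContinuousOn h U ∧ ∀ V ∈ 𝒱, closure V ⊆ U → ∀ x ∈ U, ∫ y, h y ∂(H V x) = h x

/-- `U` is a `𝒫`-set: an open set whose points are separated by the positive hyperharmonic
functions on `U`. -/
def IsPSet (𝒱 : Set (Set X)) (H : Set X → Kernel X X) (U : Set X) : Prop :=
  IsOpen U ∧ PosHyperharmonicSeparates H (fullChoice 𝒱 U) U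

/-- On `closure U`, `h` is a continuous extension of `f|∂U` that is harmonic on `U`. -/
def SolvesDirichlet (𝒱 : Set (Set X)) (H : Set X → Kernel X X) (U : Set X) (f h : X → ℝ) : Prop :=
  ContinuousOn h (closure U) ∧ EqOn h f (frontier U) ∧ IsHarmonic 𝒱 H U h

/-- `U` is a regular set: it is open and relatively compact, and every `f ∈ C(∂U)` has a unique
continuous extension to `closure U` that is harmonic on `U`, which is positive if `f` is. -/
def IsRegular (𝒱 : Set (Set X)) (H : Set X → Kernel X X) (U : Set X) : Prop :=
  IsOpen U ∧ IsCompact (closure U) ∧ ∀ f : X → ℝ, ContinuousOn f (frontier U) →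
    (∃ h, SolvesDirichlet 𝒱 H U f h) ∧
    (∀ h h', SolvesDirichlet 𝒱 H U f h → SolvesDirichlet 𝒱 H U f h' → EqOn h h' (closure U)) ∧
    ((∀ z ∈ frontier U, 0 ≤ f z) → ∀ h, SolvesDirichlet 𝒱 H U f h → ∀ x ∈ closure U, 0 ≤ h x)

/-- `T` is a boundary kernel for `U` which solves the Dirichlet problem on `U`. -/
def IsDirichletKernel (𝒱 : Set (Set X)) (H : Set X → Kernel X X) (U : Set X)
    (T : Kernel X X) : Prop :=
  IsBoundaryKernel U T ∧ ∀ f : X → ℝ, ContinuousOn f (frontier U) →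
    SolvesDirichlet 𝒱 H U f fun x => ∫ y, f y ∂(T x)

open Classical in
/-- The harmonic kernel `H_U` of a regular set `U`: the boundary kernel that solves the Dirichlet
problem on `U` (which determines it uniquely). If `U` is not regular, this is the junk value `0`. -/
noncomputable def harmonicKernel (𝒱 : Set (Set X)) (H : Set X → Kernel X X) (U : Set X) :
    Kernel X X :=
  if h : IsRegular 𝒱 H U ∧ ∃ T, IsDirichletKernel 𝒱 H U T then h.2.choose else 0

/-- `K` is a strongly stable compact set. -/
def IsStronglyStable (𝒱 : Set (Set X)) (H : Set X → Kernel X X) (K : Set X) : Prop :=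
  IsCompact K ∧ K.Nonempty ∧ ∃ W, IsPSet 𝒱 H W ∧ K ⊆ W ∧ ∃ h : X → ℝ,
    IsHarmonic 𝒱 H (W \ K) h ∧ (∀ x ∈ W \ K, 0 < h x) ∧
    ∀ z ∈ frontier K, Tendsto h (𝓝[W \ K] z) (𝓝 0)

end Families

section Collapse

variable {X : Type*}

/-- The space `X₀` obtained from `X` by collapsing `K` to a point. -/
def Collapse (K : Set X) : Type _ := Option ↥(Kᶜ)

/-- The point `x₀` of `X₀` to which `K` is collapsed. -/
def point (K : Set X) : Collapse K := (none : Option ↥(Kᶜ))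

open Classical in
/-- The canonical map from `X` to `X₀`: it sends `K` to `x₀` and is injective off `K`. -/
noncomputable def proj (K : Set X) (x : X) : Collapse K :=
  if h : x ∈ K then point K else (some ⟨x, h⟩ : Option ↥(Kᶜ))

/-- The quotient topology. If `K` is closed and non-empty, this means that `X₀ ∖ {x₀}` is open and
carries the topology of `X ∖ K`, and that the neighborhoods of `x₀` are the sets `{x₀} ∪ (N ∖ K)`
with `N` a neighborhood of `K`. -/
noncomputable instance (K : Set X) [TopologicalSpace X] : TopologicalSpace (Collapse K) :=
  TopologicalSpace.coinduced (proj K) inferInstance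

noncomputable instance (K : Set X) [TopologicalSpace X] : MeasurableSpace (Collapse K) := borel (Collapse K)

instance (K : Set X) [TopologicalSpace X] : BorelSpace (Collapse K) := ⟨rfl⟩

end Collapse

section Darning

variable {X : Type*} [TopologicalSpace X] [MeasurableSpace X]

/-- `g = H_{W₀ ∖ K} 1_{∂W₀}`. -/
noncomputable def gFun (𝒱 : Set (Set X)) (H : Set X → Kernel X X) (K W₀ : Set X) (x : X) : ℝ :=
  (harmonicKernel 𝒱 H (W₀ \ K) x).real (frontier W₀)

/-- `A_r = {x ∈ W₀ ∖ K : g(x) < r}`. -/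
def ASet (𝒱 : Set (Set X)) (H : Set X → Kernel X X) (K W₀ : Set X) (r : ℝ) : Set X :=
  {x ∈ W₀ \ K | gFun 𝒱 H K W₀ x < r}

/-- `S_r = {x ∈ W₀ ∖ K : g(x) = r}`. -/
def SSet (𝒱 : Set (Set X)) (H : Set X → Kernel X X) (K W₀ : Set X) (r : ℝ) : Set X :=
  {x ∈ W₀ \ K | gFun 𝒱 H K W₀ x = r}

/-- `U_r = {x₀} ∪ A_r`, a subset of `X₀`. -/
def USet (𝒱 : Set (Set X)) (H : Set X → Kernel X X) (K W₀ : Set X) (r : ℝ) : Set (Collapse K) :=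
  insert (point K) (proj K '' ASet 𝒱 H K W₀ r)

/-- `𝒱₀ = {U_r : 0 < r < 1} ∪ {V ∈ 𝒱 : closure V ∩ K = ∅}`, a family of subsets of `X₀`. -/
def VZero (𝒱 : Set (Set X)) (H : Set X → Kernel X X) (K W₀ : Set X) : Set (Set (Collapse K)) :=
  {U | ∃ r ∈ Ioo (0 : ℝ) 1, U = USet 𝒱 H K W₀ r} ∪
    {U | ∃ V ∈ 𝒱, closure V ∩ K = ∅ ∧ U = proj K '' V}

/-- The probability measures `σ_r` on `S_r` are compatible: `σ_r H_{A_t} = (r/t) σ_t` on `S_t`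
for all `0 < r < t < 1`. -/
def IsCompatible (𝒱 : Set (Set X)) (H : Set X → Kernel X X) (K W₀ : Set X)
    (σ : ℝ → Measure X) : Prop :=
  ∀ r t : ℝ, 0 < r → r < t → t < 1 →
    ((σ r).bind (harmonicKernel 𝒱 H (ASet 𝒱 H K W₀ t))).restrict (SSet 𝒱 H K W₀ t) =
      ENNReal.ofReal (r / t) • (σ t).restrict (SSet 𝒱 H K W₀ t)

/-- `(H₀ V)`, `V ∈ 𝒱₀`, is a normal Bauer family on `X₀` which consists of the given kernels `H V`
for `V ∈ 𝒱` with `closure V ∩ K = ∅` (transported to `X₀`) and of kernels for the sets `U_t`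
with `H₀(U_t)(x₀, ·) = σ_t`. -/
structure IsDarning (𝒱 : Set (Set X)) (H : Set X → Kernel X X) (K W₀ : Set X)
    (σ : ℝ → Measure X) (H₀ : Set (Collapse K) → Kernel (Collapse K) (Collapse K)) : Prop where
  agree : ∀ V ∈ 𝒱, closure V ∩ K = ∅ → ∀ x,
    H₀ (proj K '' V) (proj K x) = (H V x).map (proj K)
  isNormalBauerFamily : IsNormalBauerFamily (VZero 𝒱 H K W₀) H₀
  apply_point : ∀ t ∈ Ioo (0 : ℝ) 1, H₀ (USet 𝒱 H K W₀ t) (point K) = (σ t).map (proj K)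

end Darning

end Bauer

/-!
Everything rests on a minimum principle: a lower semicontinuous superharmonic function which is
nonnegative at the boundary is nonnegative. Indeed, a nonempty compact set in a `𝒫`-set cannot be
absorbing, since on a minimal absorbing set all superharmonic functions would be constant. With
Perron's method and barriers the minimum principle shows that the sets `A_t` are regular.

If `h` is continuous on the closure of `U_t`, harmonic on `A_t` and equal to `c` at `x₀`, then
`h = H_{A_t}(1_{S_t} h) + (1 - g/t) c` on `A_t`, since both sides are harmonic with the same
boundary values. For `h = H_{U_t} f` and `c = ∫ f dσ_t` this is the formula for `H_{U_t}`, and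
`H_{U_r} H_{U_t} = H_{U_t}` at `x₀` is the compatibility of `σ_r` and `σ_t`. Conversely, the formula
defines kernels, for which compatibility yields `(H₁)` and continuity at `x₀`. Adding a multiple of
`1 - g` to a superharmonic function on `W₀` and cutting off at a suitable height gives superharmonic
functions on `{x₀} ∪ (W₀ ∖ K)` that have their maximum at `x₀` and separate points. Finally, for `h`
harmonic off `x₀`, the deviation `∫ h dσ_r - h(x₀)` is proportional to `r`, so it vanishes for one
`r` if and only if it vanishes for all.
-/

namespace Bauer

section BoundedMeasurable

variable {X Y : Type*} [MeasurableSpace X] [MeasurableSpace Y] {f g : X → ℝ}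

/-- `f` is a bounded measurable real function, the class of functions on which all kernels below
act. -/
structure IsBddMeasurable (f : X → ℝ) : Prop where
  measurable : Measurable f
  bdd : ∃ C, ∀ x, |f x| ≤ C

namespace IsBddMeasurable

lemma const (c : ℝ) : IsBddMeasurable (fun _ : X => c) :=
  ⟨measurable_const, |c|, fun _ => le_rfl⟩

lemma neg (hf : IsBddMeasurable f) : IsBddMeasurable (fun x => -f x) := by
  obtain ⟨C, hC⟩ := hf.bdd
  exact ⟨hf.measurable.neg, C, fun x => (abs_neg _).trans_le (hC x)⟩

lemma add (hf : IsBddMeasurable f) (hg : IsBddMeasurable g) :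
    IsBddMeasurable (fun x => f x + g x) := by
  obtain ⟨C, hC⟩ := hf.bdd
  obtain ⟨C', hC'⟩ := hg.bdd
  exact ⟨hf.measurable.add hg.measurable, C + C',
    fun x => (abs_add_le _ _).trans (add_le_add (hC x) (hC' x))⟩

lemma sub (hf : IsBddMeasurable f) (hg : IsBddMeasurable g) :
    IsBddMeasurable (fun x => f x - g x) := by
  simpa only [sub_eq_add_neg] using hf.add hg.neg

lemma mul (hf : IsBddMeasurable f) (hg : IsBddMeasurable g) :
    IsBddMeasurable (fun x => f x * g x) := by
  obtain ⟨C, hC⟩ := hf.bdd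
  obtain ⟨C', hC'⟩ := hg.bdd
  refine ⟨hf.measurable.mul hg.measurable, C * C', fun x => ?_⟩
  rw [abs_mul]
  exact mul_le_mul (hC x) (hC' x) (abs_nonneg _) ((abs_nonneg _).trans (hC x))

lemma min (hf : IsBddMeasurable f) (hg : IsBddMeasurable g) :
    IsBddMeasurable (fun x => min (f x) (g x)) := by
  obtain ⟨C, hC⟩ := hf.bdd
  obtain ⟨C', hC'⟩ := hg.bdd
  exact ⟨hf.measurable.min hg.measurable, max C C',
    fun x => abs_min_le_max_abs_abs.trans (max_le_max (hC x) (hC' x))⟩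

lemma indicator (hf : IsBddMeasurable f) {s : Set X} (hs : MeasurableSet s) :
    IsBddMeasurable (s.indicator f) := by
  obtain ⟨C, hC⟩ := hf.bdd
  refine ⟨hf.measurable.indicator hs, C, fun x => ?_⟩
  have hle : ‖s.indicator f x‖ ≤ ‖f x‖ := norm_indicator_le_norm_self f x
  exact hle.trans (hC x)

lemma integrable (hf : IsBddMeasurable f) (μ : Measure X) [IsFiniteMeasure μ] :
    Integrable f μ := by
  obtain ⟨C, hC⟩ := hf.bdd
  exact Integrable.of_bound hf.measurable.aestronglyMeasurable C (ae_of_all _ hC)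

lemma integral_kernel (hf : IsBddMeasurable f) (T : Kernel Y X) [IsMarkovKernel T] :
    IsBddMeasurable (fun x => ∫ y, f y ∂(T x)) := by
  obtain ⟨C, hC⟩ := hf.bdd
  refine ⟨hf.measurable.stronglyMeasurable.integral_kernel.measurable, C, fun x => ?_⟩
  simpa using norm_integral_le_of_norm_le_const (μ := T x) (f := f) (ae_of_all _ hC)

lemma of_continuousOn [TopologicalSpace X] [T2Space X] [BorelSpace X] {s : Set X}
    (hs : IsCompact s) (hf : ContinuousOn f s) : IsBddMeasurable (s.indicator f) := by
  obtain ⟨C, hC⟩ := hs.exists_bound_of_continuousOn hf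
  refine ⟨?_, |C|, fun x => ?_⟩
  · classical
    rw [← piecewise_eq_indicator]
    exact hf.measurable_piecewise continuousOn_const hs.measurableSet
  · by_cases hx : x ∈ s
    · simpa [hx] using (hC x hx).trans (le_abs_self C)
    · simp [hx]

end IsBddMeasurable

lemma ae_eq_const_of_integral_le {μ : Measure X} [IsProbabilityMeasure μ] (hf : Integrable f μ)
    {m : ℝ} (hm : ∀ᵐ x ∂μ, m ≤ f x) (h : ∫ x, f x ∂μ ≤ m) : ∀ᵐ x ∂μ, f x = m := by
  have h_int : ∫ _, m ∂μ = ∫ x, f x ∂μ :=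
    le_antisymm (integral_mono_ae (integrable_const m) hf hm) (by simpa using h)
  filter_upwards [(integral_eq_iff_of_ae_le (integrable_const m) hf hm).1 h_int] with x hx
    using hx.symm

end BoundedMeasurable

section Topology

variable {X : Type*} [TopologicalSpace X] {𝒱 : Set (Set X)}

lemma eventually_smallSets_closure_subset [RegularSpace X] {x : X} {O : Set X} (hO : O ∈ 𝓝 x) :
    ∀ᶠ W in (𝓝 x).smallSets, closure W ⊆ O := by
  obtain ⟨C, hC, hCc, hCO⟩ := exists_mem_nhds_isClosed_subset hO
  exact eventually_smallSets.2 ⟨C, hC, fun W hW => (closure_minimal hW hCc).trans hCO⟩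

lemma IsLocalChoice.exists_mem {U : Set X} {𝒲 : X → Set (Set X)} (h𝒲 : IsLocalChoice 𝒱 U 𝒲)
    {x : X} (hx : x ∈ U) {P : Set X → Prop} (hP : ∀ᶠ W in (𝓝 x).smallSets, P W) :
    ∃ W ∈ 𝒲 x, P W := by
  obtain ⟨N, hN, hNP⟩ := eventually_smallSets.1 hP
  obtain ⟨W, hW, hWN⟩ := (h𝒲 x hx).2 N hN
  exact ⟨W, hW, hNP W hWN⟩

lemma isLocalChoice_fullChoice [RegularSpace X] (h𝒱 : TopologicalSpace.IsTopologicalBasis 𝒱)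
    {U : Set X} (hU : IsOpen U) : IsLocalChoice 𝒱 U (fullChoice 𝒱 U) := by
  refine fun x hx => ⟨subset_rfl, fun N hN => ?_⟩
  obtain ⟨C, hC, hCc, hCO⟩ := exists_mem_nhds_isClosed_subset (inter_mem hN (hU.mem_nhds hx))
  obtain ⟨W, hW, hxW, hWC⟩ := h𝒱.mem_nhds_iff.1 hC
  exact ⟨W, ⟨hW, (closure_minimal hWC hCc).trans (hCO.trans inter_subset_right), hxW⟩,
    hWC.trans (hCO.trans inter_subset_left)⟩

lemma exists_mem_basis [RegularSpace X] (h𝒱 : TopologicalSpace.IsTopologicalBasis 𝒱)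
    {x : X} {P : Set X → Prop} (hP : ∀ᶠ W in (𝓝 x).smallSets, P W) :
    ∃ W ∈ 𝒱, x ∈ W ∧ P W := by
  obtain ⟨W, hW, hPW⟩ := (isLocalChoice_fullChoice h𝒱 isOpen_univ).exists_mem (mem_univ x) hP
  exact ⟨W, hW.1, hW.2.2, hPW⟩

lemma lowerSemicontinuous_indicator_of_isOpen {u : X → ℝ≥0∞} {U : Set X} (hU : IsOpen U)
    (hu : LowerSemicontinuousOn u U) : LowerSemicontinuous (U.indicator u) := by
  intro x a ha
  by_cases hx : x ∈ U
  · rw [indicator_of_mem hx] at ha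
    have hnear : ∀ᶠ y in 𝓝 x, a < u y := by
      simpa only [hU.nhdsWithin_eq hx] using hu x hx a ha
    filter_upwards [hnear, hU.mem_nhds hx] with y hy hyU
    rwa [indicator_of_mem hyU]
  · simp [hx] at ha

lemma lowerSemicontinuous_toReal_min {u : X → ℝ≥0∞} (hu : LowerSemicontinuous u) {c : ℝ≥0∞}
    (hc : c ≠ ∞) : LowerSemicontinuous fun x => (min (u x) c).toReal := by
  have hfin : ∀ x, min (u x) c ≠ ∞ := fun x => ne_top_of_le_ne_top hc (min_le_right _ _)
  have hmin : LowerSemicontinuous fun x => min (u x) c := hu.inf lowerSemicontinuous_const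
  intro x a ha
  rcases lt_or_ge a 0 with ha0 | ha0
  · exact Eventually.of_forall fun y => ha0.trans_le ENNReal.toReal_nonneg
  · filter_upwards [hmin x _ ((ENNReal.ofReal_lt_iff_lt_toReal ha0 (hfin x)).2 ha)] with y hy
    exact (ENNReal.ofReal_lt_iff_lt_toReal ha0 (hfin y)).1 hy

end Topology

section LipschitzEnvelope

variable {X : Type*} [PseudoMetricSpace X] {C : Set X} {u : X → ℝ} {M : ℝ}

/-- The Pasch–Hausdorff envelope of `u` on `C`, the largest `n`-Lipschitz minorant of `u|C`. -/
noncomputable def lipschitzEnvelope (C : Set X) (u : X → ℝ) (n : ℕ) (x : X) : ℝ :=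
  ⨅ y : C, (u y + n * dist x y)

lemma le_add_mul_dist (hu : ∀ x, M ≤ u x) (n : ℕ) (x y : X) : M ≤ u y + n * dist x y :=
  (hu y).trans (le_add_of_nonneg_right (by positivity))

lemma lipschitzEnvelope_le_add (hu : ∀ x, M ≤ u x) (n : ℕ) (x : X) (y : C) :
    lipschitzEnvelope C u n x ≤ u y + n * dist x y :=
  ciInf_le ⟨M, by rintro _ ⟨z, rfl⟩; exact le_add_mul_dist hu n x z⟩ y

lemma le_lipschitzEnvelope (hC : C.Nonempty) (hu : ∀ x, M ≤ u x) (n : ℕ) (x : X) :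
    M ≤ lipschitzEnvelope C u n x :=
  have := hC.to_subtype
  le_ciInf fun y : C => le_add_mul_dist hu n x y

lemma lipschitzEnvelope_le (hu : ∀ x, M ≤ u x) (n : ℕ) {x : X} (hx : x ∈ C) :
    lipschitzEnvelope C u n x ≤ u x := by
  simpa using lipschitzEnvelope_le_add hu n x ⟨x, hx⟩

lemma continuous_lipschitzEnvelope (hC : C.Nonempty) (hu : ∀ x, M ≤ u x) (n : ℕ) :
    Continuous (lipschitzEnvelope C u n) := by
  have := hC.to_subtype
  refine (LipschitzWith.of_le_add_mul (n : NNReal) fun x x' => ?_).continuous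
  rw [NNReal.coe_natCast, ← sub_le_iff_le_add]
  refine le_ciInf fun y => ?_
  have hle := lipschitzEnvelope_le_add hu n x y
  have htri : (n : ℝ) * dist x y ≤ n * (dist x x' + dist x' y) :=
    mul_le_mul_of_nonneg_left (dist_triangle _ _ _) (by positivity)
  linarith

lemma eventually_lt_lipschitzEnvelope (hC : C.Nonempty) (hu : ∀ x, M ≤ u x)
    (hul : LowerSemicontinuousOn u C) {x : X} (hx : x ∈ C) {a : ℝ} (ha : a < u x) :
    ∀ᶠ n in atTop, a < lipschitzEnvelope C u n x := by
  have := hC.to_subtype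
  obtain ⟨b, hab, hbu⟩ := exists_between ha
  obtain ⟨δ, hδ, hball⟩ := Metric.mem_nhdsWithin_iff.1 (hul x hx b hbu)
  obtain ⟨N, hN⟩ := exists_nat_gt ((b - M) / δ)
  filter_upwards [eventually_ge_atTop N] with n hn
  refine hab.trans_le (le_ciInf fun y => ?_)
  rcases lt_or_ge (dist (y : X) x) δ with hyx | hyx
  · have hbuy : b < u y := hball ⟨hyx, y.2⟩
    exact hbuy.le.trans (le_add_of_nonneg_right (by positivity))
  · have hbM : b - M < N * δ := (div_lt_iff₀ hδ).1 hN
    have hfar : (N : ℝ) * δ ≤ n * dist x y := by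
      rw [dist_comm]
      exact mul_le_mul (by exact_mod_cast hn) hyx hδ.le (by positivity)
    linarith [hu y]

end LipschitzEnvelope

lemma exists_seq_continuous_tendsto {X : Type*} [TopologicalSpace X]
    [TopologicalSpace.PseudoMetrizableSpace X] {C : Set X} {u : X → ℝ} {M : ℝ} (hC : C.Nonempty)
    (hu : LowerSemicontinuousOn u C) (hM : ∀ x, |u x| ≤ M) :
    ∃ φ : ℕ → X → ℝ, (∀ n, Continuous (φ n)) ∧ (∀ n x, |φ n x| ≤ M) ∧
      (∀ n, ∀ x ∈ C, φ n x ≤ u x) ∧ ∀ x ∈ C, Tendsto (fun n => φ n x) atTop (𝓝 (u x)) := by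
  let _ := TopologicalSpace.pseudoMetrizableSpacePseudoMetric X
  have hlow : ∀ x, -M ≤ u x := fun x => (abs_le.1 (hM x)).1
  have hle : ∀ n, ∀ x ∈ C, min M (lipschitzEnvelope C u n x) ≤ u x := fun n x hx =>
    (min_le_right _ _).trans (lipschitzEnvelope_le hlow n hx)
  refine ⟨fun n x => min M (lipschitzEnvelope C u n x),
    fun n => continuous_const.min (continuous_lipschitzEnvelope hC hlow n),
    fun n x => abs_le.2 ⟨le_min ?_ (le_lipschitzEnvelope hC hlow n x), min_le_left _ _⟩,
    hle, fun x hx => tendsto_order.2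
      ⟨fun a ha => ?_, fun a ha => Eventually.of_forall fun n => (hle n x hx).trans_lt ha⟩⟩
  · linarith [(abs_nonneg _).trans (hM x)]
  · filter_upwards [eventually_lt_lipschitzEnvelope hC hlow hu hx ha] with n hn
    exact lt_min (ha.trans_le (abs_le.1 (hM x)).2) hn

section Absorbing

variable {X : Type*} [MeasurableSpace X]

/-- `L` is absorbing for the random motion with transition laws `μ`: it is almost surely not left
in one step. -/
def IsAbsorbing (μ : X → Measure X) (L : Set X) : Prop := ∀ x ∈ L, μ x Lᶜ = 0

variable {μ : X → Measure X}

lemma IsAbsorbing.ae_mem {L : Set X} (hL : IsAbsorbing μ L) {x : X} (hx : x ∈ L) :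
    ∀ᵐ y ∂(μ x), y ∈ L :=
  mem_ae_iff.2 (hL x hx)

lemma IsAbsorbing.sInter [TopologicalSpace X] [SecondCountableTopology X] {c : Set (Set X)}
    (hclosed : ∀ L ∈ c, IsClosed L) (hc : ∀ L ∈ c, IsAbsorbing μ L) :
    IsAbsorbing μ (⋂₀ c) := by
  refine fun x hx => measure_null_of_locally_null _ fun y hy => ?_
  simp only [mem_compl_iff, mem_sInter, not_forall] at hy
  obtain ⟨L, hL, hyL⟩ := hy
  exact ⟨Lᶜ, mem_nhdsWithin_of_mem_nhds ((hclosed L hL).isOpen_compl.mem_nhds hyL),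
    hc L hL x (hx L hL)⟩

lemma exists_minimal_isAbsorbing [TopologicalSpace X] [T2Space X] [SecondCountableTopology X]
    {M : Set X} (hMc : IsCompact M) (hMne : M.Nonempty) (hM : IsAbsorbing μ M) :
    ∃ L, Minimal (fun L => L ⊆ M ∧ IsClosed L ∧ L.Nonempty ∧ IsAbsorbing μ L) L := by
  refine zorn_superset {L | L ⊆ M ∧ IsClosed L ∧ L.Nonempty ∧ IsAbsorbing μ L}
    fun c hc hchain => ?_
  rcases c.eq_empty_or_nonempty with rfl | hcne
  · exact ⟨M, ⟨subset_rfl, hMc.isClosed, hMne, hM⟩, by simp⟩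
  have hcM : ∀ L ∈ c, L ⊆ M := fun L hL => (hc hL).1
  have hclosed : ∀ L ∈ c, IsClosed L := fun L hL => (hc hL).2.1
  refine ⟨⋂₀ c, ⟨?_, isClosed_sInter hclosed, ?_,
    .sInter hclosed fun L hL => (hc hL).2.2.2⟩, fun s hs => sInter_subset_of_mem hs⟩
  · obtain ⟨L, hL⟩ := hcne
    exact (sInter_subset_of_mem hL).trans (hcM L hL)
  · have := hcne.to_subtype
    exact IsCompact.nonempty_sInter_of_directed_nonempty_isCompact_isClosed
      (fun a ha b hb => (hchain.total ha hb).elim (fun h => ⟨a, ha, subset_rfl, h⟩)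
        fun h => ⟨b, hb, h, subset_rfl⟩) (fun L hL => (hc hL).2.2.1)
      (fun L hL => hMc.of_isClosed_subset (hclosed L hL) (hcM L hL)) hclosed

lemma IsAbsorbing.inter_preimage_Iic {μ : X → Measure X} {L : Set X} (hL : IsAbsorbing μ L)
    {v : X → ℝ} {m : ℝ} (hμ : ∀ x ∈ L, IsProbabilityMeasure (μ x)) (hv : IsBddMeasurable v)
    (hm : ∀ x ∈ L, m ≤ v x) (hle : ∀ x ∈ L, ∫ y, v y ∂(μ x) ≤ v x) :
    IsAbsorbing μ (L ∩ v ⁻¹' Iic m) := by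
  rintro x ⟨hx, hxm⟩
  have := hμ x hx
  have hmin : ∀ᵐ y ∂(μ x), m ≤ v y := (hL.ae_mem hx).mono hm
  refine mem_ae_iff.1 ?_
  filter_upwards [hL.ae_mem hx,
    ae_eq_const_of_integral_le (hv.integrable _) hmin ((hle x hx).trans hxm)] with y hyL hym
  exact ⟨hyL, hym.le⟩

end Absorbing

section Truncation

variable {X : Type*} {U : Set X}

/-- The extension of `u|U` by zero, truncated at `n`. It turns hyperharmonic functions into bounded
real ones. -/
noncomputable def truncation (U : Set X) (u : X → ℝ≥0∞) (n : ℕ) (x : X) : ℝ :=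
  (min (U.indicator u x) n).toReal

lemma exists_truncation_ne {u : X → ℝ≥0∞} {x y : X} (hx : x ∈ U) (hy : y ∈ U) (h : u x ≠ u y) :
    ∃ n, truncation U u n x ≠ truncation U u n y := by
  wlog hlt : u x < u y generalizing x y
  · obtain ⟨n, hn⟩ := this hy hx h.symm (lt_of_le_of_ne (not_lt.1 hlt) h.symm)
    exact ⟨n, hn.symm⟩
  obtain ⟨n, hn⟩ := ENNReal.exists_nat_gt hlt.ne_top
  refine ⟨n, ne_of_lt ?_⟩
  simp only [truncation, indicator_of_mem hx, indicator_of_mem hy, min_eq_left hn.le]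
  exact ENNReal.toReal_strict_mono
    (ne_top_of_le_ne_top (ENNReal.natCast_ne_top n) (min_le_right _ _)) (lt_min hlt hn)

end Truncation

section MinimumPrinciple

variable {X : Type*} [TopologicalSpace X] [MeasurableSpace X]
  {𝒱 : Set (Set X)} {H : Set X → Kernel X X}

lemma IsNormalBauerFamily.isMarkovKernel (hH : IsNormalBauerFamily 𝒱 H) {V : Set X}
    (hV : V ∈ 𝒱) : IsMarkovKernel (H V) := ⟨fun x => ⟨hH.normal V hV x⟩⟩

lemma IsNormalBauerFamily.isOpen (hH : IsNormalBauerFamily 𝒱 H) {V : Set X} (hV : V ∈ 𝒱) :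
    IsOpen V :=
  hH.isBasis.isOpen hV

lemma IsBoundaryKernel.ae_mem_frontier {U : Set X} {T : Kernel X X} (hT : IsBoundaryKernel U T)
    {x : X} (hx : x ∈ U) : ∀ᵐ y ∂(T x), y ∈ frontier U :=
  mem_ae_iff.2 (hT.1 x hx)

lemma IsBoundaryKernel.ae_mem_closure {U : Set X} {T : Kernel X X} (hT : IsBoundaryKernel U T)
    {x : X} (hx : x ∈ U) : ∀ᵐ y ∂(T x), y ∈ closure U :=
  (hT.ae_mem_frontier hx).mono fun _ hy => frontier_subset_closure hy

/-- `v` is a bounded measurable function that is lower semicontinuous on `U` and superharmonic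
there with respect to the choice `𝒲`: the real-valued counterpart of `IsPosHyperharmonic`. -/
structure IsBddSuperharmonic (H : Set X → Kernel X X) (𝒲 : X → Set (Set X)) (U : Set X)
    (v : X → ℝ) : Prop where
  isBddMeasurable : IsBddMeasurable v
  lowerSemicontinuousOn : LowerSemicontinuousOn v U
  integral_le : ∀ x ∈ U, ∀ W ∈ 𝒲 x, ∫ y, v y ∂(H W x) ≤ v x

/-- `𝒲` assigns to the points of the open set `U` sets from `fullChoice 𝒱 U`, and the positive
`𝒲`-hyperharmonic functions separate the points of `U`. This is what the minimum principle needs. It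
covers both the local choices in `(H₃)` and, by taking the full choice, `𝒫`-sets. -/
structure IsSeparatingChoice (𝒱 : Set (Set X)) (H : Set X → Kernel X X) (U : Set X)
    (𝒲 : X → Set (Set X)) : Prop where
  isOpen : IsOpen U
  subset_fullChoice : ∀ x ∈ U, 𝒲 x ⊆ fullChoice 𝒱 U x
  separates : PosHyperharmonicSeparates H 𝒲 U

lemma IsPSet.isSeparatingChoice {U : Set X} (hU : IsPSet 𝒱 H U) :
    IsSeparatingChoice 𝒱 H U (fullChoice 𝒱 U) :=
  ⟨hU.1, fun _ _ => subset_rfl, hU.2⟩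

variable {U : Set X} {𝒲 : X → Set (Set X)}

lemma IsPosHyperharmonic.isBddSuperharmonic_truncation [BorelSpace X]
    (hH : IsNormalBauerFamily 𝒱 H) (hU : IsOpen U) (h𝒲 : ∀ x ∈ U, 𝒲 x ⊆ fullChoice 𝒱 U x)
    {u : X → ℝ≥0∞} (hu : IsPosHyperharmonic H 𝒲 U u) (n : ℕ) :
    IsBddSuperharmonic H 𝒲 U (truncation U u n) := by
  have hlsc := lowerSemicontinuous_indicator_of_isOpen hU hu.1
  have hmeas : Measurable fun x => min (U.indicator u x) (n : ℝ≥0∞) :=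
    hlsc.measurable.min measurable_const
  have hn : (n : ℝ≥0∞) ≠ ∞ := ENNReal.natCast_ne_top n
  have hfin : ∀ x, min (U.indicator u x) (n : ℝ≥0∞) ≠ ∞ := fun x =>
    ne_top_of_le_ne_top hn (min_le_right _ _)
  refine ⟨⟨hmeas.ennreal_toReal, n, fun x => ?_⟩,
    (lowerSemicontinuous_toReal_min hlsc hn).lowerSemicontinuousOn U, fun x hx W hW => ?_⟩
  · rw [truncation, abs_of_nonneg ENNReal.toReal_nonneg]
    simpa using ENNReal.toReal_mono hn (min_le_right (U.indicator u x) n)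
  · have := hH.isMarkovKernel (h𝒲 x hx hW).1
    simp only [truncation]
    rw [integral_toReal hmeas.aemeasurable (ae_of_all _ fun y => (hfin y).lt_top)]
    refine ENNReal.toReal_mono (hfin x) (le_min ?_ ?_)
    · calc ∫⁻ y, min (U.indicator u y) (n : ℝ≥0∞) ∂(H W x) ≤ ∫⁻ y, u y ∂(H W x) :=
            lintegral_mono fun y => (min_le_left _ _).trans (indicator_le_self _ _ _)
        _ ≤ u x := hu.2 x hx W hW
        _ = U.indicator u x := by rw [indicator_of_mem hx]
    · calc ∫⁻ y, min (U.indicator u y) (n : ℝ≥0∞) ∂(H W x) ≤ ∫⁻ _, n ∂(H W x) :=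
            lintegral_mono fun y => min_le_right _ _
        _ = n := by simp

lemma IsSeparatingChoice.exists_isBddSuperharmonic [BorelSpace X] (hH : IsNormalBauerFamily 𝒱 H)
    (h𝒲 : IsSeparatingChoice 𝒱 H U 𝒲) {x y : X} (hx : x ∈ U) (hy : y ∈ U) (hxy : x ≠ y) :
    ∃ v : X → ℝ, IsBddSuperharmonic H 𝒲 U v ∧ 0 ≤ v ∧ v x ≠ v y := by
  obtain ⟨u, hu, hne⟩ := h𝒲.separates x hx y hy hxy
  obtain ⟨n, hn⟩ := exists_truncation_ne hx hy hne
  exact ⟨_, hu.isBddSuperharmonic_truncation hH h𝒲.isOpen h𝒲.subset_fullChoice n,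
    fun _ => ENNReal.toReal_nonneg, hn⟩

lemma IsNormalBauerFamily.not_isAbsorbing_singleton (hH : IsNormalBauerFamily 𝒱 H)
    {w : X → Set X} {x : X} (hw : w x ∈ 𝒱) (hx : x ∈ w x) :
    ¬ IsAbsorbing (fun y => H (w y) y) {x} := by
  intro hsing
  have := hH.isMarkovKernel hw
  have hfalse : ∀ᵐ _ ∂(H (w x) x), False := by
    filter_upwards [(hH.isBoundaryKernel _ hw).ae_mem_frontier hx, hsing.ae_mem rfl] with y hy hyx
    rw [mem_singleton_iff.1 hyx, (hH.isOpen hw).frontier_eq] at hy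
    exact hy.2 hx
  exact IsProbabilityMeasure.ne_zero (H (w x) x) (by simpa using hfalse)

/-- On a minimal absorbing set every bounded superharmonic function is constant, since the set where
it attains its minimum is absorbing as well. By separation such a set is a singleton. -/
lemma IsSeparatingChoice.not_isAbsorbing [T2Space X] [SecondCountableTopology X] [BorelSpace X]
    (hH : IsNormalBauerFamily 𝒱 H) (h𝒲 : IsSeparatingChoice 𝒱 H U 𝒲) {M : Set X}
    (hMc : IsCompact M) (hMne : M.Nonempty) (hMU : M ⊆ U) {w : X → Set X}
    (hw : ∀ x ∈ M, w x ∈ 𝒲 x) : ¬ IsAbsorbing (fun x => H (w x) x) M := by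
  intro hM
  obtain ⟨L, hL⟩ := exists_minimal_isAbsorbing hMc hMne hM
  obtain ⟨hLM, hLclosed, ⟨x, hx⟩, hLabs⟩ := hL.prop
  have hLc : IsCompact L := hMc.of_isClosed_subset hLclosed hLM
  have hLU : L ⊆ U := hLM.trans hMU
  have hfull : ∀ z ∈ L, w z ∈ fullChoice 𝒱 U z := fun z hz =>
    h𝒲.subset_fullChoice z (hLU hz) (hw z (hLM hz))
  have hsub : L ⊆ {x} := by
    intro y hy
    by_contra hyx
    obtain ⟨v, hv, -, hne⟩ := h𝒲.exists_isBddSuperharmonic hH (hLU hx) (hLU hy) (Ne.symm hyx)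
    have hvl := hv.lowerSemicontinuousOn.mono hLU
    obtain ⟨p, hpL, hp⟩ := hvl.exists_isMinOn ⟨x, hx⟩ hLc
    have hmin : L ≤ L ∩ v ⁻¹' Iic (v p) := by
      refine hL.le_of_le ⟨inter_subset_left.trans hLM,
        (hvl.isCompact_inter_preimage_Iic hLc _).isClosed, ⟨p, hpL, le_refl (v p)⟩,
        hLabs.inter_preimage_Iic (fun z hz => ?_) hv.isBddMeasurable (fun z hz => hp hz)
          fun z hz => hv.integral_le z (hLU hz) _ (hw z (hLM hz))⟩ inter_subset_left
      exact (hH.isMarkovKernel (hfull z hz).1).isProbabilityMeasure z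
    exact hne (le_antisymm ((hmin hx).2.trans (hp hy)) ((hmin hy).2.trans (hp hx)))
  refine hH.not_isAbsorbing_singleton (hfull x hx).1 (hfull x hx).2.2 ?_
  rwa [← hsub.antisymm (singleton_subset_iff.2 hx)]

lemma IsSeparatingChoice.minimum_principle [T2Space X] [SecondCountableTopology X] [BorelSpace X]
    (hH : IsNormalBauerFamily 𝒱 H) (h𝒲 : IsSeparatingChoice 𝒱 H U 𝒲) {A : Set X}
    (hA : IsOpen A) (hAc : IsCompact (closure A)) (hAU : A ⊆ U) {v : X → ℝ}
    (hv : IsBddMeasurable v) (hvl : LowerSemicontinuousOn v (closure A))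
    (hv0 : ∀ z ∈ frontier A, 0 ≤ v z)
    (hvs : ∀ x ∈ A, ∃ W ∈ 𝒲 x, W ⊆ A ∧ ∫ y, v y ∂(H W x) ≤ v x) :
    ∀ x ∈ closure A, 0 ≤ v x := by
  intro x hx
  by_contra! hneg
  obtain ⟨p, hpA, hp⟩ := hvl.exists_isMinOn ⟨x, hx⟩ hAc
  have hMA : closure A ∩ v ⁻¹' Iic (v p) ⊆ A := by
    rintro y ⟨hy, hyp⟩
    by_contra hyA
    have hy0 : 0 ≤ v y := hv0 y (hA.frontier_eq ▸ ⟨hy, hyA⟩)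
    exact absurd (hy0.trans hyp) (not_le.2 ((hp hx).trans_lt hneg))
  choose! w hw hwA hwint using hvs
  refine h𝒲.not_isAbsorbing hH (hvl.isCompact_inter_preimage_Iic hAc (v p))
    ⟨p, hpA, le_refl (v p)⟩ (hMA.trans hAU) (fun z hz => hw z (hMA hz)) fun z hz => ?_
  have hzA := hMA hz
  have hfull := h𝒲.subset_fullChoice z (hAU hzA) (hw z hzA)
  have := hH.isMarkovKernel hfull.1
  have hae : ∀ᵐ q ∂(H (w z) z), q ∈ closure A :=
    ((hH.isBoundaryKernel _ hfull.1).ae_mem_closure hfull.2.2).mono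
      fun _ hq => closure_mono (hwA z hzA) hq
  refine mem_ae_iff.1 ?_
  filter_upwards [hae, ae_eq_const_of_integral_le (hv.integrable _) (hae.mono fun q hq => hp hq)
    ((hwint z hzA).trans hz.2)] with q hq hq'
  exact ⟨hq, hq'.le⟩

end MinimumPrinciple

section Superharmonic

variable {X : Type*} [TopologicalSpace X] [MeasurableSpace X]
  {𝒱 : Set (Set X)} {H : Set X → Kernel X X}

/-- `u` is superharmonic at `x`: its mean over every sufficiently small set of `𝒱` around `x` is at
most `u x`. -/
def IsSuperharmonicAt (𝒱 : Set (Set X)) (H : Set X → Kernel X X) (u : X → ℝ) (x : X) : Prop :=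
  ∀ᶠ W in (𝓝 x).smallSets, W ∈ 𝒱 → x ∈ W → ∫ y, u y ∂(H W x) ≤ u x

/-- `h` is harmonic at `x`: its mean over every sufficiently small set of `𝒱` around `x` is
`h x`. -/
def IsHarmonicAt (𝒱 : Set (Set X)) (H : Set X → Kernel X X) (h : X → ℝ) (x : X) : Prop :=
  ∀ᶠ W in (𝓝 x).smallSets, W ∈ 𝒱 → x ∈ W → ∫ y, h y ∂(H W x) = h x

lemma IsHarmonicAt.isSuperharmonicAt {h : X → ℝ} {x : X} (hh : IsHarmonicAt 𝒱 H h x) :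
    IsSuperharmonicAt 𝒱 H h x := by
  filter_upwards [hh] with W hW hW𝒱 hxW using (hW hW𝒱 hxW).le

lemma IsHarmonicAt.neg {h : X → ℝ} {x : X} (hh : IsHarmonicAt 𝒱 H h x) :
    IsHarmonicAt 𝒱 H (fun y => -h y) x := by
  filter_upwards [hh] with W hW hW𝒱 hxW
  rw [integral_neg, hW hW𝒱 hxW]

lemma IsNormalBauerFamily.integral_congr (hH : IsNormalBauerFamily 𝒱 H) {V : Set X}
    (hV : V ∈ 𝒱) {f g : X → ℝ} (hfg : EqOn f g (closure V)) {x : X} (hx : x ∈ V) :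
    ∫ y, f y ∂(H V x) = ∫ y, g y ∂(H V x) :=
  integral_congr_ae (((hH.isBoundaryKernel V hV).ae_mem_closure hx).mono fun _ hy => hfg hy)

lemma IsHarmonicAt.congr [RegularSpace X] (hH : IsNormalBauerFamily 𝒱 H) {f h : X → ℝ} {x : X}
    (hh : IsHarmonicAt 𝒱 H h x) (hfh : f =ᶠ[𝓝 x] h) : IsHarmonicAt 𝒱 H f x := by
  filter_upwards [hh, eventually_smallSets_closure_subset hfh] with W hW hsub hW𝒱 hxW
  rw [hH.integral_congr hW𝒱 (g := h) (fun y hy => hsub hy) hxW, hW hW𝒱 hxW]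
  exact (hsub (subset_closure hxW)).symm

lemma IsHarmonic.isHarmonicAt [RegularSpace X] {U : Set X} {h : X → ℝ} (hU : IsOpen U)
    (hh : IsHarmonic 𝒱 H U h) {x : X} (hx : x ∈ U) : IsHarmonicAt 𝒱 H h x := by
  filter_upwards [eventually_smallSets_closure_subset (hU.mem_nhds hx)] with W hW hW𝒱 _
  exact hh.2 W hW𝒱 hW x hx

lemma IsHarmonic.mono {U U' : Set X} {h : X → ℝ} (hh : IsHarmonic 𝒱 H U h) (hU : U' ⊆ U) :
    IsHarmonic 𝒱 H U' h :=
  ⟨hh.1.mono hU, fun V hV hVU x hx => hh.2 V hV (hVU.trans hU) x (hU hx)⟩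

lemma IsPSet.exists_fullChoice [RegularSpace X] (hH : IsNormalBauerFamily 𝒱 H) {U A : Set X}
    (hU : IsPSet 𝒱 H U) (hA : IsOpen A) (hAU : A ⊆ U) {x : X} (hx : x ∈ A) {P : Set X → Prop}
    (hP : ∀ᶠ W in (𝓝 x).smallSets, W ∈ 𝒱 → x ∈ W → P W) :
    ∃ W ∈ fullChoice 𝒱 U x, closure W ⊆ A ∧ P W := by
  obtain ⟨W, hW, hsub, hPW⟩ := (isLocalChoice_fullChoice hH.isBasis hU.1).exists_mem (hAU hx)
    ((eventually_smallSets_closure_subset (hA.mem_nhds hx)).and hP)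
  exact ⟨W, hW, hsub, hPW hW.1 hW.2.2⟩

lemma IsNormalBauerFamily.integral_integral (hH : IsNormalBauerFamily 𝒱 H) {V W : Set X}
    (hV : V ∈ 𝒱) (hW : W ∈ 𝒱) (hWV : W ⊆ V) {f : X → ℝ} (hf : IsBddMeasurable f) (x : X) :
    ∫ z, ∫ y, f y ∂(H V z) ∂(H W x) = ∫ y, f y ∂(H V x) := by
  have := hH.isMarkovKernel hV
  have := hH.isMarkovKernel hW
  rw [← Kernel.integral_comp (hf.integrable _), hH.comp_eq V hV W hW hWV]

lemma IsBddSuperharmonic.isPosHyperharmonic (hH : IsNormalBauerFamily 𝒱 H) {U : Set X}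
    {𝒲 : X → Set (Set X)} (h𝒲 : ∀ x ∈ U, 𝒲 x ⊆ 𝒱) {v : X → ℝ}
    (hv : IsBddSuperharmonic H 𝒲 U v) (hv0 : 0 ≤ v) :
    IsPosHyperharmonic H 𝒲 U (fun x => ENNReal.ofReal (v x)) := by
  refine ⟨ENNReal.continuous_ofReal.comp_lowerSemicontinuousOn hv.lowerSemicontinuousOn
    (fun _ _ h => ENNReal.ofReal_le_ofReal h), fun x hx W hW => ?_⟩
  have := hH.isMarkovKernel (h𝒲 x hx hW)
  rw [← ofReal_integral_eq_lintegral_ofReal (hv.isBddMeasurable.integrable _) (ae_of_all _ hv0)]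
  exact ENNReal.ofReal_le_ofReal (hv.integral_le x hx W hW)

/-- `T` is a boundary kernel for `A` whose integrals of continuous functions are continuous on
`closure A` and harmonic on `A` with respect to the choice `𝒲`. -/
structure IsHarmonicBoundaryKernel (H : Set X → Kernel X X) (𝒲 : X → Set (Set X)) (A : Set X)
    (T : Kernel X X) : Prop where
  isBoundaryKernel : IsBoundaryKernel A T
  continuousOn_integral : ∀ φ : X → ℝ, Continuous φ →
    ContinuousOn (fun x => ∫ y, φ y ∂(T x)) (closure A)
  integral_integral : ∀ φ : X → ℝ, Continuous φ → IsBddMeasurable φ →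
    ∀ x ∈ A, ∀ W ∈ 𝒲 x, closure W ⊆ A → ∫ z, ∫ y, φ y ∂(T z) ∂(H W x) = ∫ y, φ y ∂(T x)

lemma IsNormalBauerFamily.isHarmonicBoundaryKernel (hH : IsNormalBauerFamily 𝒱 H) {V : Set X}
    (hV : V ∈ 𝒱) {𝒲 : X → Set (Set X)} (h𝒲 : ∀ x ∈ V, 𝒲 x ⊆ 𝒱) :
    IsHarmonicBoundaryKernel H 𝒲 V (H V) where
  isBoundaryKernel := hH.isBoundaryKernel V hV
  continuousOn_integral φ hφ := (hH.continuous_integral V hV φ hφ).continuousOn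
  integral_integral _ _ hφ x hx _ hW hWV :=
    hH.integral_integral hV (h𝒲 x hx hW) (subset_closure.trans hWV) hφ x

end Superharmonic

section Domination

variable {X : Type*} [TopologicalSpace X] [T3Space X] [SecondCountableTopology X]
  [MeasurableSpace X] [BorelSpace X] {𝒱 : Set (Set X)} {H : Set X → Kernel X X} {U A : Set X}
  {𝒲 : X → Set (Set X)} {T : Kernel X X} [IsMarkovKernel T]

lemma IsSeparatingChoice.integral_le_of_continuous (hH : IsNormalBauerFamily 𝒱 H)
    (h𝒲 : IsSeparatingChoice 𝒱 H U 𝒲) (hA : IsOpen A) (hAc : IsCompact (closure A)) (hAU : A ⊆ U)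
    (hT : IsHarmonicBoundaryKernel H 𝒲 A T) {u φ : X → ℝ} (hu : IsBddMeasurable u)
    (hul : LowerSemicontinuousOn u (closure A))
    (hus : ∀ x ∈ A, ∃ W ∈ 𝒲 x, closure W ⊆ A ∧ ∫ y, u y ∂(H W x) ≤ u x)
    (hφ : Continuous φ) (hφb : IsBddMeasurable φ) (hφu : ∀ x ∈ closure A, φ x ≤ u x) {x : X}
    (hx : x ∈ A) : ∫ y, φ y ∂(T x) ≤ u x := by
  have h_int := hφb.integral_kernel T
  refine sub_nonneg.1 (h𝒲.minimum_principle hH hA hAc hAU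
    (v := fun x => u x - ∫ y, φ y ∂(T x)) (hu.sub h_int) ?_ (fun z hz => ?_) (fun z hz => ?_) x
    (subset_closure hx))
  · simp only [sub_eq_add_neg]
    exact hul.add (hT.continuousOn_integral _ hφ).neg.lowerSemicontinuousOn
  · rw [hA.frontier_eq] at hz
    simp only [hT.isBoundaryKernel.2 z hz.2, integral_dirac, sub_nonneg]
    exact hφu z hz.1
  · obtain ⟨W, hW, hWA, hle⟩ := hus z hz
    have := hH.isMarkovKernel (h𝒲.subset_fullChoice z (hAU hz) hW).1
    refine ⟨W, hW, subset_closure.trans hWA, ?_⟩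
    rw [integral_sub (hu.integrable _) (h_int.integrable _),
      hT.integral_integral _ hφ hφb z hz W hW hWA]
    exact sub_le_sub_right hle _

lemma IsSeparatingChoice.integral_le (hH : IsNormalBauerFamily 𝒱 H)
    (h𝒲 : IsSeparatingChoice 𝒱 H U 𝒲) (hA : IsOpen A) (hAc : IsCompact (closure A)) (hAU : A ⊆ U)
    (hT : IsHarmonicBoundaryKernel H 𝒲 A T) {u : X → ℝ} (hu : IsBddMeasurable u)
    (hul : LowerSemicontinuousOn u (closure A))
    (hus : ∀ x ∈ A, ∃ W ∈ 𝒲 x, closure W ⊆ A ∧ ∫ y, u y ∂(H W x) ≤ u x) {x : X}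
    (hx : x ∈ A) : ∫ y, u y ∂(T x) ≤ u x := by
  obtain ⟨C, hC⟩ := hu.bdd
  obtain ⟨φ, hφ, hφC, hφu, hφlim⟩ :=
    exists_seq_continuous_tendsto ⟨x, subset_closure hx⟩ hul hC
  have hlim : Tendsto (fun n => ∫ y, φ n y ∂(T x)) atTop (𝓝 (∫ y, u y ∂(T x))) :=
    tendsto_integral_of_dominated_convergence (fun _ => C)
      (fun n => (hφ n).measurable.aestronglyMeasurable) (integrable_const _)
      (fun n => ae_of_all _ (hφC n))
      ((hT.isBoundaryKernel.ae_mem_closure hx).mono hφlim)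
  exact le_of_tendsto' hlim fun n => h𝒲.integral_le_of_continuous hH hA hAc hAU hT hu hul hus
    (hφ n) ⟨(hφ n).measurable, C, hφC n⟩ (hφu n) hx

lemma IsNormalBauerFamily.isPSet (hH : IsNormalBauerFamily 𝒱 H) {V : Set X} (hV : V ∈ 𝒱) :
    IsPSet 𝒱 H V := by
  obtain ⟨𝒲, hloc, hsep⟩ := hH.separates V hV
  have h𝒲 : IsSeparatingChoice 𝒱 H V 𝒲 := ⟨hH.isOpen hV, fun x hx => (hloc x hx).1, hsep⟩
  refine ⟨hH.isOpen hV, fun x hx y hy hxy => ?_⟩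
  obtain ⟨v, hv, hv0, hne⟩ := h𝒲.exists_isBddSuperharmonic hH hx hy hxy
  have hfull : IsBddSuperharmonic H (fullChoice 𝒱 V) V v := by
    refine ⟨hv.isBddMeasurable, hv.lowerSemicontinuousOn, fun z _ W ⟨hW, hWV, hzW⟩ => ?_⟩
    have := hH.isMarkovKernel hW
    have hWV' : W ⊆ V := subset_closure.trans hWV
    refine h𝒲.integral_le hH (hH.isOpen hW) (hH.isCompact_closure W hW) hWV'
      (hH.isHarmonicBoundaryKernel hW fun p hp W' hW' =>
        (h𝒲.subset_fullChoice p (hWV' hp) hW').1)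
      hv.isBddMeasurable (hv.lowerSemicontinuousOn.mono hWV) (fun p hp => ?_) hzW
    obtain ⟨W', hW', hsub⟩ := hloc.exists_mem (hWV' hp)
      (eventually_smallSets_closure_subset ((hH.isOpen hW).mem_nhds hp))
    exact ⟨W', hW', hsub, hv.integral_le p (hWV' hp) W' hW'⟩
  exact ⟨_, hfull.isPosHyperharmonic hH (fun _ _ _ hW => hW.1) hv0,
    fun h => hne ((ENNReal.ofReal_eq_ofReal_iff (hv0 x) (hv0 y)).1 h)⟩

lemma IsPSet.minimum_principle (hH : IsNormalBauerFamily 𝒱 H) (hU : IsPSet 𝒱 H U)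
    (hA : IsOpen A) (hAc : IsCompact (closure A)) (hAU : A ⊆ U) {v : X → ℝ}
    (hv : IsBddMeasurable v) (hvl : LowerSemicontinuousOn v (closure A))
    (hv0 : ∀ z ∈ frontier A, 0 ≤ v z) (hvs : ∀ x ∈ A, IsSuperharmonicAt 𝒱 H v x) :
    ∀ x ∈ closure A, 0 ≤ v x := by
  refine hU.isSeparatingChoice.minimum_principle hH hA hAc hAU hv hvl hv0 fun x hx => ?_
  obtain ⟨W, hW, hsub, hle⟩ := hU.exists_fullChoice hH hA hAU hx (hvs x hx)
  exact ⟨W, hW, subset_closure.trans hsub, hle⟩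

variable {V : Set X}

lemma IsNormalBauerFamily.integral_le (hH : IsNormalBauerFamily 𝒱 H) (hV : V ∈ 𝒱)
    {u : X → ℝ} (hu : IsBddMeasurable u) (hul : LowerSemicontinuousOn u (closure V))
    (hus : ∀ x ∈ V, IsSuperharmonicAt 𝒱 H u x) (x : X) : ∫ y, u y ∂(H V x) ≤ u x := by
  by_cases hx : x ∈ V
  · have := hH.isMarkovKernel hV
    have hP := hH.isPSet hV
    exact hP.isSeparatingChoice.integral_le hH (hH.isOpen hV) (hH.isCompact_closure V hV)
      subset_rfl (hH.isHarmonicBoundaryKernel hV fun _ _ _ hW => hW.1) hu hul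
      (fun p hp => hP.exists_fullChoice hH (hH.isOpen hV) subset_rfl hp (hus p hp)) hx
  · rw [(hH.isBoundaryKernel V hV).2 x hx, integral_dirac]

lemma IsNormalBauerFamily.integral_eq_of_isHarmonicAt (hH : IsNormalBauerFamily 𝒱 H)
    (hV : V ∈ 𝒱) {h : X → ℝ} (hc : ContinuousOn h (closure V))
    (hl : ∀ x ∈ V, IsHarmonicAt 𝒱 H h x) (x : X) : ∫ y, h y ∂(H V x) = h x := by
  by_cases hx : x ∈ V
  · let f := (closure V).indicator h
    have hfh : EqOn f h (closure V) := fun y hy => indicator_of_mem hy h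
    have hf : IsBddMeasurable f := .of_continuousOn (hH.isCompact_closure V hV) hc
    have hfc : ContinuousOn f (closure V) := hc.congr hfh
    have hfl : ∀ x ∈ V, IsHarmonicAt 𝒱 H f x := fun x hx => (hl x hx).congr hH <| by
      filter_upwards [(hH.isOpen hV).mem_nhds hx] with y hy using hfh (subset_closure hy)
    rw [← hH.integral_congr hV hfh hx, ← hfh (subset_closure hx)]
    refine le_antisymm (hH.integral_le hV hf hfc.lowerSemicontinuousOn
      (fun x hx => (hfl x hx).isSuperharmonicAt) x) ?_
    have hneg := hH.integral_le hV hf.neg hfc.neg.lowerSemicontinuousOn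
      (fun x hx => (hfl x hx).neg.isSuperharmonicAt) x
    rwa [integral_neg, neg_le_neg_iff] at hneg
  · rw [(hH.isBoundaryKernel V hV).2 x hx, integral_dirac]

lemma IsNormalBauerFamily.isHarmonic_of_isHarmonicAt (hH : IsNormalBauerFamily 𝒱 H)
    {h : X → ℝ} (hc : ContinuousOn h U) (hl : ∀ x ∈ U, IsHarmonicAt 𝒱 H h x) :
    IsHarmonic 𝒱 H U h :=
  ⟨hc, fun _ hV hVU x _ => hH.integral_eq_of_isHarmonicAt hV (hc.mono hVU)
    (fun y hy => hl y (hVU (subset_closure hy))) x⟩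

end Domination

section Dirichlet

variable {X : Type*} [TopologicalSpace X] [MeasurableSpace X]
  {𝒱 : Set (Set X)} {H : Set X → Kernel X X} {U A V : Set X} {f f' h h' : X → ℝ}

lemma IsNormalBauerFamily.integrable [T2Space X] [BorelSpace X] (hH : IsNormalBauerFamily 𝒱 H)
    (hV : V ∈ 𝒱) (hc : ContinuousOn h (closure V)) (x : X) : Integrable h (H V x) := by
  have := hH.isMarkovKernel hV
  by_cases hx : x ∈ V
  · refine ((IsBddMeasurable.of_continuousOn (hH.isCompact_closure V hV) hc).integrable
      (H V x)).congr ?_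
    filter_upwards [(hH.isBoundaryKernel V hV).ae_mem_closure hx] with y hy
      using indicator_of_mem hy h
  · rw [(hH.isBoundaryKernel V hV).2 x hx]
    exact integrable_dirac (by simp)

lemma IsHarmonic.add [T2Space X] [BorelSpace X] (hH : IsNormalBauerFamily 𝒱 H)
    (hh : IsHarmonic 𝒱 H U h) (hh' : IsHarmonic 𝒱 H U h') :
    IsHarmonic 𝒱 H U (fun x => h x + h' x) := by
  refine ⟨hh.1.add hh'.1, fun V hV hVU x hx => ?_⟩
  rw [integral_add (hH.integrable hV (hh.1.mono hVU) x) (hH.integrable hV (hh'.1.mono hVU) x),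
    hh.2 V hV hVU x hx, hh'.2 V hV hVU x hx]

lemma IsHarmonic.const_mul (hh : IsHarmonic 𝒱 H U h) (c : ℝ) :
    IsHarmonic 𝒱 H U (fun x => c * h x) :=
  ⟨continuousOn_const.mul hh.1, fun V hV hVU x hx => by
    rw [integral_const_mul, hh.2 V hV hVU x hx]⟩

lemma IsHarmonic.const (hH : IsNormalBauerFamily 𝒱 H) (U : Set X) (c : ℝ) :
    IsHarmonic 𝒱 H U (fun _ => c) := by
  refine ⟨continuousOn_const, fun V hV _ x _ => ?_⟩
  have := hH.isMarkovKernel hV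
  simp

lemma IsHarmonic.congr [T2Space X] [BorelSpace X] (hH : IsNormalBauerFamily 𝒱 H)
    (hh : IsHarmonic 𝒱 H U h) (he : EqOn h' h U) : IsHarmonic 𝒱 H U h' := by
  refine ⟨hh.1.congr he, fun V hV hVU x hx => ?_⟩
  rw [he hx, ← hh.2 V hV hVU x hx]
  by_cases hxV : x ∈ V
  · exact hH.integral_congr hV (he.mono hVU) hxV
  · rw [(hH.isBoundaryKernel V hV).2 x hxV, integral_dirac, integral_dirac, he hx]

lemma SolvesDirichlet.add [T2Space X] [BorelSpace X] (hH : IsNormalBauerFamily 𝒱 H)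
    (hh : SolvesDirichlet 𝒱 H U f h) (hh' : SolvesDirichlet 𝒱 H U f' h') :
    SolvesDirichlet 𝒱 H U (fun x => f x + f' x) (fun x => h x + h' x) :=
  ⟨hh.1.add hh'.1, fun x hx => by simp only [hh.2.1 hx, hh'.2.1 hx], hh.2.2.add hH hh'.2.2⟩

lemma SolvesDirichlet.const_mul (hh : SolvesDirichlet 𝒱 H U f h) (c : ℝ) :
    SolvesDirichlet 𝒱 H U (fun x => c * f x) (fun x => c * h x) :=
  ⟨continuousOn_const.mul hh.1, fun x hx => by simp only [hh.2.1 hx], hh.2.2.const_mul c⟩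

lemma SolvesDirichlet.congr [T2Space X] [BorelSpace X] (hH : IsNormalBauerFamily 𝒱 H)
    (hh : SolvesDirichlet 𝒱 H U f h) (he : EqOn h' h (closure U)) :
    SolvesDirichlet 𝒱 H U f h' :=
  ⟨hh.1.congr he, fun _ hx => (he (frontier_subset_closure hx)).trans (hh.2.1 hx),
    hh.2.2.congr hH (he.mono subset_closure)⟩

lemma IsPSet.nonneg_of_isHarmonic [T3Space X] [SecondCountableTopology X] [BorelSpace X]
    (hH : IsNormalBauerFamily 𝒱 H) (hU : IsPSet 𝒱 H U) (hA : IsOpen A)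
    (hAc : IsCompact (closure A)) (hAU : A ⊆ U) (hc : ContinuousOn h (closure A))
    (hh : IsHarmonic 𝒱 H A h) (h0 : ∀ z ∈ frontier A, 0 ≤ h z) : ∀ x ∈ closure A, 0 ≤ h x := by
  have he : EqOn ((closure A).indicator h) h (closure A) := fun y hy => indicator_of_mem hy h
  intro x hx
  rw [← he hx]
  refine hU.minimum_principle hH hA hAc hAU (.of_continuousOn hAc hc)
    (hc.congr he).lowerSemicontinuousOn
    (fun z hz => by rw [he (frontier_subset_closure hz)]; exact h0 z hz) (fun y hy => ?_) x hx
  exact ((hh.congr hH (he.mono subset_closure)).isHarmonicAt hA hy).isSuperharmonicAt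

end Dirichlet

section SuperharmonicAt

variable {X : Type*} [TopologicalSpace X] [MeasurableSpace X]
  {𝒱 : Set (Set X)} {H : Set X → Kernel X X} {u v : X → ℝ} {x : X}

lemma IsSuperharmonicAt.add (hH : IsNormalBauerFamily 𝒱 H) (hu : IsBddMeasurable u)
    (hv : IsBddMeasurable v) (hus : IsSuperharmonicAt 𝒱 H u x)
    (hvs : IsSuperharmonicAt 𝒱 H v x) : IsSuperharmonicAt 𝒱 H (fun y => u y + v y) x := by
  filter_upwards [hus, hvs] with W hWu hWv hW hxW
  have := hH.isMarkovKernel hW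
  rw [integral_add (hu.integrable _) (hv.integrable _)]
  exact add_le_add (hWu hW hxW) (hWv hW hxW)

lemma IsSuperharmonicAt.min (hH : IsNormalBauerFamily 𝒱 H) (hu : IsBddMeasurable u)
    (hv : IsBddMeasurable v) (hus : IsSuperharmonicAt 𝒱 H u x)
    (hvs : IsSuperharmonicAt 𝒱 H v x) : IsSuperharmonicAt 𝒱 H (fun y => min (u y) (v y)) x := by
  filter_upwards [hus, hvs] with W hWu hWv hW hxW
  have := hH.isMarkovKernel hW
  have h_int := (hu.min hv).integrable (H W x)
  exact le_min
    ((integral_mono h_int (hu.integrable _) fun y => min_le_left _ _).trans (hWu hW hxW))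
    ((integral_mono h_int (hv.integrable _) fun y => min_le_right _ _).trans (hWv hW hxW))

lemma IsSuperharmonicAt.const_add_mul (hH : IsNormalBauerFamily 𝒱 H) (hu : IsBddMeasurable u)
    (hus : IsSuperharmonicAt 𝒱 H u x) (a : ℝ) {b : ℝ} (hb : 0 ≤ b) :
    IsSuperharmonicAt 𝒱 H (fun y => a + b * u y) x := by
  filter_upwards [hus] with W hWu hW hxW
  have := hH.isMarkovKernel hW
  rw [integral_add (integrable_const _) ((hu.integrable _).const_mul b), integral_const_mul]
  simpa using mul_le_mul_of_nonneg_left (hWu hW hxW) hb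

lemma isSuperharmonicAt_const (hH : IsNormalBauerFamily 𝒱 H) (c : ℝ) (x : X) :
    IsSuperharmonicAt 𝒱 H (fun _ => c) x := by
  refine Eventually.of_forall fun W hW _ => ?_
  have := hH.isMarkovKernel hW
  simp

end SuperharmonicAt

section Perron

variable {X : Type*} [TopologicalSpace X] [MeasurableSpace X]
  {𝒱 : Set (Set X)} {H : Set X → Kernel X X} {A : Set X} {f u v : X → ℝ} {M : ℝ}

/-- `u` is an upper function for the boundary data `f` on `∂A`: it is superharmonic on `A`, lower
semicontinuous on `closure A`, and dominates `f` on `∂A`. The common bound `M` for all upper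
functions keeps the infimum in `perron` away from the junk value of unbounded infima. -/
structure IsUpperFunction (𝒱 : Set (Set X)) (H : Set X → Kernel X X) (A : Set X) (f : X → ℝ)
    (M : ℝ) (u : X → ℝ) : Prop where
  measurable : Measurable u
  abs_le : ∀ x, |u x| ≤ M
  lowerSemicontinuousOn : LowerSemicontinuousOn u (closure A)
  le_of_mem_frontier : ∀ z ∈ frontier A, f z ≤ u z
  isSuperharmonicAt : ∀ x ∈ A, IsSuperharmonicAt 𝒱 H u x

/-- The upper Perron solution of the Dirichlet problem, among the upper functions bounded
by `M`. -/
noncomputable def perron (𝒱 : Set (Set X)) (H : Set X → Kernel X X) (A : Set X) (f : X → ℝ) (M : ℝ)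
    (x : X) : ℝ := ⨅ u : {u : X → ℝ // IsUpperFunction 𝒱 H A f M u}, u.1 x

lemma perron_le (hu : IsUpperFunction 𝒱 H A f M u) (x : X) : perron 𝒱 H A f M x ≤ u x := by
  refine ciInf_le (f := fun u : {u : X → ℝ // IsUpperFunction 𝒱 H A f M u} => u.1 x)
    ⟨-M, ?_⟩ ⟨u, hu⟩
  rintro _ ⟨v, rfl⟩
  exact (abs_le.1 (v.2.abs_le x)).1

namespace IsUpperFunction

lemma isBddMeasurable (hu : IsUpperFunction 𝒱 H A f M u) : IsBddMeasurable u :=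
  ⟨hu.measurable, M, hu.abs_le⟩

lemma min (hH : IsNormalBauerFamily 𝒱 H) (hu : IsUpperFunction 𝒱 H A f M u)
    (hv : IsUpperFunction 𝒱 H A f M v) :
    IsUpperFunction 𝒱 H A f M (fun x => min (u x) (v x)) where
  measurable := hu.measurable.min hv.measurable
  abs_le x := abs_min_le_max_abs_abs.trans (max_le (hu.abs_le x) (hv.abs_le x))
  lowerSemicontinuousOn := hu.lowerSemicontinuousOn.inf hv.lowerSemicontinuousOn
  le_of_mem_frontier z hz := le_min (hu.le_of_mem_frontier z hz) (hv.le_of_mem_frontier z hz)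
  isSuperharmonicAt x hx :=
    (hu.isSuperharmonicAt x hx).min hH hu.isBddMeasurable hv.isBddMeasurable
      (hv.isSuperharmonicAt x hx)

lemma exists_antitone_le (hH : IsNormalBauerFamily 𝒱 H) {a : ℕ → X → ℝ}
    (ha : ∀ n, IsUpperFunction 𝒱 H A f M (a n)) :
    ∃ b : ℕ → X → ℝ, (∀ n, IsUpperFunction 𝒱 H A f M (b n)) ∧ Antitone b ∧ ∀ n, b n ≤ a n := by
  let b : ℕ → X → ℝ := fun n => Nat.rec (a 0) (fun n v x => Min.min (v x) (a (n + 1) x)) n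
  refine ⟨b, fun n => ?_, antitone_nat_of_succ_le fun n x => min_le_left _ _, fun n => ?_⟩
  · induction n with
    | zero => exact ha 0
    | succ n ih => exact ih.min hH (ha (n + 1))
  · cases n with
    | zero => exact le_rfl
    | succ n => exact fun x => min_le_right _ _

lemma exists_antitone_tendsto_perron (hH : IsNormalBauerFamily 𝒱 H)
    (hne : ∃ u, IsUpperFunction 𝒱 H A f M u) (d : ℕ → X) :
    ∃ b : ℕ → X → ℝ, (∀ n, IsUpperFunction 𝒱 H A f M (b n)) ∧ Antitone b ∧
      ∀ j, Tendsto (fun n => b n (d j)) atTop (𝓝 (perron 𝒱 H A f M (d j))) := by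
  have : Nonempty {u : X → ℝ // IsUpperFunction 𝒱 H A f M u} := let ⟨u, hu⟩ := hne; ⟨⟨u, hu⟩⟩
  have hclose : ∀ k : ℕ, ∃ u, IsUpperFunction 𝒱 H A f M u ∧
      u (d k.unpair.1) < perron 𝒱 H A f M (d k.unpair.1) + 1 / ((k.unpair.2 : ℝ) + 1) :=
    fun k => by
      obtain ⟨u, hu⟩ := exists_lt_of_ciInf_lt (lt_add_of_pos_right
        (perron 𝒱 H A f M (d k.unpair.1)) (Nat.one_div_pos_of_nat (n := k.unpair.2) (α := ℝ)))
      exact ⟨u.1, u.2, hu⟩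
  choose a ha hlt using hclose
  obtain ⟨b, hb, hanti, hba⟩ := exists_antitone_le hH ha
  refine ⟨b, hb, hanti, fun j => tendsto_order.2
    ⟨fun c hc => Eventually.of_forall fun n => hc.trans_le (perron_le (hb n) _), fun c hc => ?_⟩⟩
  obtain ⟨n, hn⟩ := exists_nat_one_div_lt (sub_pos.2 hc)
  have hn' := hlt (Nat.pair j n)
  simp only [Nat.unpair_pair] at hn'
  filter_upwards [eventually_ge_atTop (Nat.pair j n)] with m hm
  linarith [hanti hm (d j), hba (Nat.pair j n) (d j)]

end IsUpperFunction

end Perron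

section PerronHarmonic

variable {X : Type*} [TopologicalSpace X] [T3Space X] [SecondCountableTopology X]
  [MeasurableSpace X] [BorelSpace X] {𝒱 : Set (Set X)} {H : Set X → Kernel X X}
  {U A V : Set X} {f u : X → ℝ} {M : ℝ}

lemma IsNormalBauerFamily.lowerSemicontinuousOn_integral (hH : IsNormalBauerFamily 𝒱 H)
    (hV : V ∈ 𝒱) {C : Set X} (hVC : closure V ⊆ C) (hu : IsBddMeasurable u)
    (hul : LowerSemicontinuousOn u C) :
    LowerSemicontinuousOn (fun x => ∫ y, u y ∂(H V x)) C := by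
  have := hH.isMarkovKernel hV
  obtain ⟨M, hM⟩ := hu.bdd
  have hae : ∀ x ∈ C, ∀ᵐ y ∂(H V x), y ∈ C := fun x hx => by
    by_cases hxV : x ∈ V
    · exact ((hH.isBoundaryKernel V hV).ae_mem_closure hxV).mono fun _ hy => hVC hy
    · rw [(hH.isBoundaryKernel V hV).2 x hxV, ae_dirac_eq]
      exact hx
  intro x hx a ha
  obtain ⟨φ, hφ, hφM, hφu, hφlim⟩ := exists_seq_continuous_tendsto ⟨x, hx⟩ hul hM
  have hφb : ∀ n, IsBddMeasurable (φ n) := fun n => ⟨(hφ n).measurable, M, hφM n⟩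
  have hlim : Tendsto (fun n => ∫ y, φ n y ∂(H V x)) atTop (𝓝 (∫ y, u y ∂(H V x))) :=
    tendsto_integral_of_dominated_convergence (fun _ => M)
      (fun n => (hφb n).measurable.aestronglyMeasurable) (integrable_const _)
      (fun n => ae_of_all _ (hφM n)) ((hae x hx).mono hφlim)
  obtain ⟨n, hn⟩ := (hlim.eventually (lt_mem_nhds ha)).exists
  have hnear := (hH.continuous_integral V hV _ (hφ n)).continuousAt.eventually (lt_mem_nhds hn)
  filter_upwards [mem_nhdsWithin_of_mem_nhds hnear, self_mem_nhdsWithin] with y hy hyC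
  exact hy.trans_le (integral_mono_ae ((hφb n).integrable _) (hu.integrable _)
    ((hae y hyC).mono (hφu n)))

namespace IsUpperFunction

lemma integral_le (hH : IsNormalBauerFamily 𝒱 H) (hu : IsUpperFunction 𝒱 H A f M u) (hV : V ∈ 𝒱)
    (hVA : closure V ⊆ A) (x : X) : ∫ y, u y ∂(H V x) ≤ u x :=
  hH.integral_le hV hu.isBddMeasurable
    (hu.lowerSemicontinuousOn.mono (hVA.trans subset_closure))
    (fun y hy => hu.isSuperharmonicAt y (hVA (subset_closure hy))) x

lemma integral (hH : IsNormalBauerFamily 𝒱 H) (hA : IsOpen A)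
    (hu : IsUpperFunction 𝒱 H A f M u) (hV : V ∈ 𝒱) (hVA : closure V ⊆ A) :
    IsUpperFunction 𝒱 H A f M (fun x => ∫ y, u y ∂(H V x)) := by
  have := hH.isMarkovKernel hV
  have h_int := hu.isBddMeasurable.integral_kernel (H V)
  have hoff : ∀ x ∉ V, ∫ y, u y ∂(H V x) = u x := fun x hx => by
    rw [(hH.isBoundaryKernel V hV).2 x hx, integral_dirac]
  refine ⟨h_int.measurable, fun x => ?_, hH.lowerSemicontinuousOn_integral hV
    (hVA.trans subset_closure) hu.isBddMeasurable hu.lowerSemicontinuousOn,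
    fun z hz => ?_, fun x hx => ?_⟩
  · simpa using norm_integral_le_of_norm_le_const (μ := H V x) (f := u) (C := M)
      (ae_of_all _ hu.abs_le)
  · have hzV : z ∉ V := fun hzV => (hA.frontier_eq ▸ hz).2 (hVA (subset_closure hzV))
    rw [hoff z hzV]
    exact hu.le_of_mem_frontier z hz
  · by_cases hxV : x ∈ V
    · filter_upwards [eventually_smallSets_closure_subset ((hH.isOpen hV).mem_nhds hxV)]
        with W hWV hW _
      exact (hH.integral_integral hV hW (subset_closure.trans hWV) hu.isBddMeasurable x).le
    · filter_upwards [hu.isSuperharmonicAt x hx] with W hWu hW hxW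
      have := hH.isMarkovKernel hW
      rw [hoff x hxV]
      exact (integral_mono (h_int.integrable _) (hu.isBddMeasurable.integrable _)
        fun y => hu.integral_le hH hV hVA y).trans (hWu hW hxW)

lemma neg_le (hH : IsNormalBauerFamily 𝒱 H) (hU : IsPSet 𝒱 H U) (hA : IsOpen A)
    (hAc : IsCompact (closure A)) (hAU : A ⊆ U) (hu : IsUpperFunction 𝒱 H A f M u) {s : X → ℝ}
    (hs : IsUpperFunction 𝒱 H A (fun x => -f x) M s) {x : X} (hx : x ∈ closure A) :
    -s x ≤ u x := by
  have hsum := hU.minimum_principle hH hA hAc hAU (v := fun x => u x + s x)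
    (hu.isBddMeasurable.add hs.isBddMeasurable)
    (hu.lowerSemicontinuousOn.add hs.lowerSemicontinuousOn)
    (fun z hz => by linarith [hu.le_of_mem_frontier z hz, hs.le_of_mem_frontier z hz])
    (fun y hy => (hu.isSuperharmonicAt y hy).add hH hu.isBddMeasurable hs.isBddMeasurable
      (hs.isSuperharmonicAt y hy)) x hx
  linarith

end IsUpperFunction

lemma perron_le_integral_min (hH : IsNormalBauerFamily 𝒱 H) (hA : IsOpen A) (hV : V ∈ 𝒱)
    (hVA : closure V ⊆ A) (hu : IsUpperFunction 𝒱 H A f M u) {b : ℕ → X → ℝ}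
    (hb : ∀ n, IsUpperFunction 𝒱 H A f M (b n)) {w : X → ℝ}
    (hbw : ∀ x, Tendsto (fun n => b n x) atTop (𝓝 (w x))) (x : X) :
    perron 𝒱 H A f M x ≤ ∫ y, min (u y) (w y) ∂(H V x) := by
  have := hH.isMarkovKernel hV
  have hlim : Tendsto (fun n => ∫ y, min (u y) (b n y) ∂(H V x)) atTop
      (𝓝 (∫ y, min (u y) (w y) ∂(H V x))) :=
    tendsto_integral_of_dominated_convergence (fun _ => M)
      (fun n => (hu.min hH (hb n)).measurable.aestronglyMeasurable) (integrable_const _)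
      (fun n => ae_of_all _ (hu.min hH (hb n)).abs_le)
      (ae_of_all _ fun y => tendsto_const_nhds.min (hbw y))
  exact ge_of_tendsto' hlim fun n => perron_le ((hu.min hH (hb n)).integral hH hA hV hVA) x

/-- For every upper function `u` the functions `H_V w` and `H_V (min u w)` agree on the dense
set, hence on `V` by `(H₄)`. -/
lemma perron_eq_integral_of_tendsto (hH : IsNormalBauerFamily 𝒱 H) (hA : IsOpen A) (hV : V ∈ 𝒱)
    (hVA : closure V ⊆ A) {b : ℕ → X → ℝ} (hb : ∀ n, IsUpperFunction 𝒱 H A f M (b n))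
    {w : X → ℝ} (hw : IsBddMeasurable w) (hwb : ∀ n, w ≤ b n)
    (hbw : ∀ x, Tendsto (fun n => b n x) atTop (𝓝 (w x))) {d : ℕ → V} (hd : DenseRange d)
    (hbd : ∀ j, Tendsto (fun n => b n (d j)) atTop (𝓝 (perron 𝒱 H A f M (d j)))) {x : X}
    (hx : x ∈ V) : perron 𝒱 H A f M x = ∫ y, w y ∂(H V x) := by
  have := hH.isMarkovKernel hV
  have : Nonempty {u : X → ℝ // IsUpperFunction 𝒱 H A f M u} := ⟨⟨b 0, hb 0⟩⟩
  have hmin : ∀ u, IsUpperFunction 𝒱 H A f M u → IsBddMeasurable fun y => min (u y) (w y) :=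
    fun u hu => hu.isBddMeasurable.min hw
  have hlow := fun u (hu : IsUpperFunction 𝒱 H A f M u) =>
    perron_le_integral_min hH hA hV hVA hu hb hbw
  have hmin_le : ∀ u, IsUpperFunction 𝒱 H A f M u → ∀ x,
      ∫ y, min (u y) (w y) ∂(H V x) ≤ ∫ y, w y ∂(H V x) := fun u hu x =>
    integral_mono ((hmin u hu).integrable _) (hw.integrable _) fun y => min_le_right _ _
  have hdense : ∀ j, ∫ y, w y ∂(H V (d j)) ≤ perron 𝒱 H A f M (d j) := fun j =>
    ge_of_tendsto' (hbd j) fun n => (integral_mono (hw.integrable _)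
      ((hb n).isBddMeasurable.integrable _) (hwb n)).trans
      ((hb n).integral_le hH hV hVA (d j))
  have heq : ∀ u, IsUpperFunction 𝒱 H A f M u →
      ∫ y, w y ∂(H V x) = ∫ y, min (u y) (w y) ∂(H V x) := by
    intro u hu
    have hcw := hH.continuousOn_integral V hV w hw.measurable hw.bdd
    have hcm := hH.continuousOn_integral V hV _ (hmin u hu).measurable (hmin u hu).bdd
    exact congrFun (hd.equalizer
      (continuousOn_iff_continuous_domRestrict.1 hcw)
      (continuousOn_iff_continuous_domRestrict.1 hcm)
      (funext fun j => le_antisymm ((hdense j).trans (hlow u hu _)) (hmin_le u hu _))) ⟨x, hx⟩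
  refine le_antisymm ((hlow _ (hb 0) x).trans (hmin_le _ (hb 0) x)) (le_ciInf fun ⟨u, hu⟩ => ?_)
  exact (heq u hu).trans_le ((integral_mono ((hmin u hu).integrable _)
    (hu.isBddMeasurable.integrable _) fun y => min_le_left _ _).trans (hu.integral_le hH hV hVA x))

lemma exists_perron_eq_integral (hH : IsNormalBauerFamily 𝒱 H) (hA : IsOpen A)
    (hne : ∃ u, IsUpperFunction 𝒱 H A f M u) (hV : V ∈ 𝒱) (hVA : closure V ⊆ A) :
    ∃ w : X → ℝ, IsBddMeasurable w ∧
      ∀ x ∈ V, perron 𝒱 H A f M x = ∫ y, w y ∂(H V x) := by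
  rcases V.eq_empty_or_nonempty with rfl | hVne
  · exact ⟨fun _ => 0, .const 0, by simp⟩
  have : Nonempty V := hVne.to_subtype
  let d := TopologicalSpace.denseSeq V
  obtain ⟨b, hb, hanti, hbd⟩ :=
    IsUpperFunction.exists_antitone_tendsto_perron hH hne fun j => (d j : X)
  have hbelow : ∀ x, BddBelow (range fun n => b n x) := fun x =>
    ⟨-M, by rintro _ ⟨n, rfl⟩; exact (abs_le.1 ((hb n).abs_le x)).1⟩
  let w : X → ℝ := fun x => ⨅ n, b n x
  have hbw : ∀ x, Tendsto (fun n => b n x) atTop (𝓝 (w x)) := fun x =>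
    tendsto_atTop_ciInf (fun _ _ hmn => hanti hmn x) (hbelow x)
  have hw : IsBddMeasurable w := ⟨measurable_of_tendsto_metrizable (fun n => (hb n).measurable)
    (tendsto_pi_nhds.2 hbw), M, fun x => le_of_tendsto' (hbw x).abs fun n => (hb n).abs_le x⟩
  exact ⟨w, hw, fun x hx => perron_eq_integral_of_tendsto hH hA hV hVA hb hw
    (fun n y => ciInf_le (hbelow y) n) hbw (TopologicalSpace.denseRange_denseSeq V) hbd hx⟩

lemma isHarmonic_perron (hH : IsNormalBauerFamily 𝒱 H) (hA : IsOpen A)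
    (hne : ∃ u, IsUpperFunction 𝒱 H A f M u) : IsHarmonic 𝒱 H A (perron 𝒱 H A f M) := by
  have hloc : ∀ x ∈ A, ContinuousAt (perron 𝒱 H A f M) x ∧
      IsHarmonicAt 𝒱 H (perron 𝒱 H A f M) x := by
    intro x hx
    obtain ⟨V, hV, hxV, hVA⟩ := exists_mem_basis hH.isBasis
      (eventually_smallSets_closure_subset (hA.mem_nhds hx))
    have hVn := (hH.isOpen hV).mem_nhds hxV
    obtain ⟨w, hw, heq⟩ := exists_perron_eq_integral hH hA hne hV hVA
    have hnear : perron 𝒱 H A f M =ᶠ[𝓝 x] fun x => ∫ y, w y ∂(H V x) :=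
      eventually_of_mem hVn heq
    refine ⟨((hH.continuousOn_integral V hV w hw.measurable hw.bdd).continuousAt hVn).congr
      hnear.symm, IsHarmonicAt.congr hH ?_ hnear⟩
    filter_upwards [eventually_smallSets_closure_subset hVn] with W hWV hW _
    exact hH.integral_integral hV hW (subset_closure.trans hWV) hw x
  exact hH.isHarmonic_of_isHarmonicAt (fun x hx => (hloc x hx).1.continuousWithinAt)
    fun x hx => (hloc x hx).2

end PerronHarmonic

section Barrier

lemma lowerSemicontinuousOn_const_add_mul {X : Type*} [TopologicalSpace X]
    {u : X → ℝ} {s : Set X}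
    (hu : LowerSemicontinuousOn u s) (a : ℝ) {b : ℝ} (hb : 0 ≤ b) :
    LowerSemicontinuousOn (fun y => a + b * u y) s :=
  Continuous.comp_lowerSemicontinuousOn (g := fun t : ℝ => a + b * t) (by fun_prop) hu
    (fun _ _ h => by simpa using mul_le_mul_of_nonneg_left h hb)

variable {X : Type*} [TopologicalSpace X] [MeasurableSpace X] {𝒱 : Set (Set X)}
  {H : Set X → Kernel X X} {A V L : Set X} {b : X → ℝ} {z : X}

/-- `b` is a barrier for `A` at `z`: a strictly positive harmonic function on `A` that tends to `0`
at `z`. It may tend to `0` at other boundary points as well. -/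
structure IsBarrier (𝒱 : Set (Set X)) (H : Set X → Kernel X X) (A : Set X) (z : X)
    (b : X → ℝ) : Prop where
  isBddMeasurable : IsBddMeasurable b
  pos : ∀ x ∈ A, 0 < b x
  isHarmonic : IsHarmonic 𝒱 H A b
  tendsto : Tendsto b (𝓝[A] z) (𝓝 0)

lemma IsBarrier.const_mul (hb : IsBarrier 𝒱 H A z b) {c : ℝ} (hc : 0 < c) :
    IsBarrier 𝒱 H A z (fun x => c * b x) where
  isBddMeasurable := (IsBddMeasurable.const c).mul hb.isBddMeasurable
  pos x hx := mul_pos hc (hb.pos x hx)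
  isHarmonic := hb.isHarmonic.const_mul c
  tendsto := by simpa using hb.tendsto.const_mul c

lemma IsNormalBauerFamily.isBddMeasurable_real (hH : IsNormalBauerFamily 𝒱 H) (hV : V ∈ 𝒱)
    {s : Set X} (hs : MeasurableSet s) : IsBddMeasurable fun x => (H V x).real s := by
  have := hH.isMarkovKernel hV
  simpa [integral_indicator hs] using ((IsBddMeasurable.const 1).indicator hs).integral_kernel (H V)

lemma IsNormalBauerFamily.continuousOn_real (hH : IsNormalBauerFamily 𝒱 H) (hV : V ∈ 𝒱)
    {s : Set X} (hs : MeasurableSet s) : ContinuousOn (fun x => (H V x).real s) V := by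
  have h1 := (IsBddMeasurable.const (X := X) 1).indicator hs
  simpa [integral_indicator hs] using hH.continuousOn_integral V hV _ h1.measurable h1.bdd

lemma IsNormalBauerFamily.eventually_lt_real [NormalSpace X] [T1Space X] [BorelSpace X]
    (hH : IsNormalBauerFamily 𝒱 H) (hV : V ∈ 𝒱) {O : Set X} (hO : IsOpen O) {x : X} (hxO : x ∈ O)
    (hxV : x ∉ V) {a : ℝ} (ha : a < 1) : ∀ᶠ y in 𝓝 x, a < (H V y).real O := by
  have := hH.isMarkovKernel hV
  obtain ⟨φ, hφ0, hφ1, hφI⟩ := exists_continuous_zero_one_of_isClosed hO.isClosed_compl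
    (isClosed_singleton (x := x)) (by simpa using hxO)
  have hφx : a < ∫ y, φ y ∂(H V x) := by
    rw [(hH.isBoundaryKernel V hV).2 x hxV, integral_dirac, hφ1 rfl]
    exact ha
  have hφb : IsBddMeasurable φ :=
    ⟨φ.continuous.measurable, 1, fun y => abs_le.2 ⟨by linarith [(hφI y).1], (hφI y).2⟩⟩
  have hφO : (φ : X → ℝ) ≤ O.indicator 1 := fun y => by
    by_cases hy : y ∈ O
    · rw [indicator_of_mem hy]
      exact (hφI y).2
    · rw [indicator_of_notMem hy, hφ0 hy]
      exact le_rfl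
  filter_upwards [(hH.continuous_integral V hV φ φ.continuous).continuousAt.eventually
    (lt_mem_nhds hφx)] with y hy
  rw [← integral_indicator_one hO.measurableSet]
  exact hy.trans_le (integral_mono (hφb.integrable _)
    (((IsBddMeasurable.const 1).indicator hO.measurableSet).integrable _) hφO)

/-- `p` is a peak function for `A` inside `V`: a superharmonic function on `A` with values in
`[0, 1]` that equals `1` away from `V`. It is of interest if it is small at a point of `V`. -/
structure IsPeakFunction (𝒱 : Set (Set X)) (H : Set X → Kernel X X) (A V : Set X)
    (p : X → ℝ) : Prop where
  measurable : Measurable p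
  nonneg : ∀ x, 0 ≤ p x
  le_one : ∀ x, p x ≤ 1
  lowerSemicontinuousOn : LowerSemicontinuousOn p (closure A)
  isSuperharmonicAt : ∀ x ∈ A, IsSuperharmonicAt 𝒱 H p x
  eq_one : ∀ x ∉ closure V, p x = 1

lemma IsPeakFunction.isBddMeasurable {p : X → ℝ} (hp : IsPeakFunction 𝒱 H A V p) :
    IsBddMeasurable p :=
  ⟨hp.measurable, 1, fun x => abs_le.2 ⟨by linarith [hp.nonneg x], hp.le_one x⟩⟩

lemma IsPeakFunction.isUpperFunction (hH : IsNormalBauerFamily 𝒱 H) {p : X → ℝ}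
    (hp : IsPeakFunction 𝒱 H A V p) {f : X → ℝ} {M a : ℝ} (hM : 0 ≤ M) (ha : |a| ≤ M + 1)
    (hf : ∀ x ∈ frontier A, f x ≤ a + 2 * M)
    (hfV : ∀ x ∈ frontier A ∩ closure V, f x ≤ a) :
    IsUpperFunction 𝒱 H A f (3 * M + 1) fun x => a + 2 * M * p x where
  measurable := by have := hp.measurable; fun_prop
  abs_le x := by
    have h0 : 0 ≤ 2 * M * p x := mul_nonneg (by linarith) (hp.nonneg x)
    have h1 : 2 * M * p x ≤ 2 * M := mul_le_of_le_one_right (by linarith) (hp.le_one x)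
    exact abs_le.2 ⟨by linarith [(abs_le.1 ha).1], by linarith [(abs_le.1 ha).2]⟩
  lowerSemicontinuousOn :=
    lowerSemicontinuousOn_const_add_mul hp.lowerSemicontinuousOn _ (by linarith)
  le_of_mem_frontier x hx := by
    by_cases hxV : x ∈ closure V
    · have h0 : 0 ≤ 2 * M * p x := mul_nonneg (by linarith) (hp.nonneg x)
      linarith [hfV x ⟨hx, hxV⟩]
    · simpa [hp.eq_one x hxV] using hf x hx
  isSuperharmonicAt x hx :=
    (hp.isSuperharmonicAt x hx).const_add_mul hH hp.isBddMeasurable _ (by linarith)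

open Classical in
/-- The peak function which is obtained from a barrier `b` with `b ≥ 1` on `L`. The harmonic measure
of `A ∖ L` compensates for the boundary points of `V` in `A` at which `b` may be small. -/
noncomputable def peak (H : Set X → Kernel X X) (A V L : Set X) (b : X → ℝ) (x : X) : ℝ :=
  if x ∈ A then min 1 (b x + (H V x).real (A \ L)) else if x ∈ closure V then 0 else 1

lemma peak_of_mem {x : X} (hx : x ∈ A) :
    peak H A V L b x = min 1 (b x + (H V x).real (A \ L)) :=
  if_pos hx

lemma peak_nonneg (hb : ∀ x ∈ A, 0 < b x) (x : X) : 0 ≤ peak H A V L b x := by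
  unfold peak
  split_ifs with hxA
  exacts [le_min zero_le_one (add_nonneg (hb x hxA).le measureReal_nonneg), le_rfl, zero_le_one]

lemma peak_le_one (x : X) : peak H A V L b x ≤ 1 := by
  unfold peak
  split_ifs
  exacts [min_le_left _ _, zero_le_one, le_rfl]

lemma peak_of_notMem_closure (hH : IsNormalBauerFamily 𝒱 H) (hV : V ∈ 𝒱) (hbp : ∀ x ∈ A, 0 < b x)
    (hbL : ∀ x ∈ L, 1 ≤ b x) (hAL : MeasurableSet (A \ L)) {x : X} (hxV : x ∉ V)
    (hx : x ∈ A ∨ x ∉ closure V) : peak H A V L b x = 1 := by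
  unfold peak
  split_ifs with hxA hxc
  · refine min_eq_left ?_
    by_cases hxL : x ∈ L
    · exact (hbL x hxL).trans (le_add_of_nonneg_right measureReal_nonneg)
    · rw [(hH.isBoundaryKernel V hV).2 x hxV, measureReal_def, Measure.dirac_apply' x hAL,
        indicator_of_mem (show x ∈ A \ L from ⟨hxA, hxL⟩)]
      simpa using (hbp x hxA).le
  · exact absurd hxc (hx.resolve_left hxA)
  · rfl

variable [T3Space X] [SecondCountableTopology X] [BorelSpace X]

lemma lowerSemicontinuousOn_peak (hH : IsNormalBauerFamily 𝒱 H) (hV : V ∈ 𝒱) (hA : IsOpen A)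
    (hb : ContinuousOn b A) (hbp : ∀ x ∈ A, 0 < b x) (hL : IsClosed L) (hbL : ∀ x ∈ L, 1 ≤ b x) :
    LowerSemicontinuousOn (peak H A V L b) (closure A) := by
  have hAL : IsOpen (A \ L) := hA.sdiff hL
  intro x _ a ha
  by_cases hxA : x ∈ A
  · have hbx : ContinuousAt b x := hb.continuousAt (hA.mem_nhds hxA)
    have hnear : ∀ᶠ y in 𝓝 x, a < min 1 (b y + (H V y).real (A \ L)) := by
      rw [peak_of_mem hxA] at ha
      by_cases hxV : x ∈ V
      · have hq := (hH.continuousOn_real hV hAL.measurableSet).continuousAt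
          ((hH.isOpen hV).mem_nhds hxV)
        exact (continuousAt_const.min (hbx.add hq)).eventually (lt_mem_nhds ha)
      have ha1 : a < 1 := ha.trans_le (min_le_left _ _)
      by_cases hxL : x ∈ L
      · filter_upwards [hbx.eventually (lt_mem_nhds (ha1.trans_le (hbL x hxL)))] with y hy
        exact lt_min ha1 (hy.trans_le (le_add_of_nonneg_right measureReal_nonneg))
      · filter_upwards [hH.eventually_lt_real hV hAL ⟨hxA, hxL⟩ hxV ha1, hA.mem_nhds hxA]
          with y hy hyA
        exact lt_min ha1 (hy.trans_le (le_add_of_nonneg_left (hbp y hyA).le))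
    refine mem_nhdsWithin_of_mem_nhds ?_
    filter_upwards [hnear, hA.mem_nhds hxA] with y hy hyA
    exact hy.trans_eq (peak_of_mem hyA).symm
  · by_cases hxc : x ∈ closure V
    · have hx0 : peak H A V L b x = 0 := by rw [peak, if_neg hxA, if_pos hxc]
      exact Eventually.of_forall fun y => (hx0 ▸ ha).trans_le (peak_nonneg hbp y)
    · refine mem_nhdsWithin_of_mem_nhds ?_
      filter_upwards [isClosed_closure.isOpen_compl.mem_nhds hxc] with y hy
      rw [peak_of_notMem_closure hH hV hbp hbL hAL.measurableSet
        (fun h => hy (subset_closure h)) (.inr hy)]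
      exact ha.trans_le (peak_le_one x)

lemma isPeakFunction_peak (hH : IsNormalBauerFamily 𝒱 H) (hV : V ∈ 𝒱) (hA : IsOpen A)
    (hb : IsBarrier 𝒱 H A z b) (hL : IsClosed L) (hbL : ∀ x ∈ L, 1 ≤ b x) :
    IsPeakFunction 𝒱 H A V (peak H A V L b) := by
  have hAL : MeasurableSet (A \ L) := (hA.sdiff hL).measurableSet
  have hqm := hH.isBddMeasurable_real hV hAL
  have hsum := hb.isBddMeasurable.add hqm
  have hr := (IsBddMeasurable.const 1).min hsum
  have hmeas : Measurable (peak H A V L b) := Measurable.ite hA.measurableSet hr.measurable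
    (Measurable.ite isClosed_closure.measurableSet measurable_const measurable_const)
  have hpm : IsBddMeasurable (peak H A V L b) := ⟨hmeas, 1, fun x =>
    abs_le.2 ⟨by linarith [peak_nonneg (H := H) (V := V) (L := L) hb.pos x], peak_le_one x⟩⟩
  refine ⟨hmeas, peak_nonneg hb.pos, peak_le_one,
    lowerSemicontinuousOn_peak hH hV hA hb.isHarmonic.1 hb.pos hL hbL, fun x hxA => ?_,
    fun x hx => peak_of_notMem_closure hH hV hb.pos hbL hAL
      (fun h => hx (subset_closure h)) (.inr hx)⟩
  have hle : ∀ W ∈ 𝒱, ∫ y, peak H A V L b y ∂(H W x) ≤ 1 := fun W hW => by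
    have := hH.isMarkovKernel hW
    simpa using integral_mono (hpm.integrable (H W x)) (integrable_const 1)
      (fun y => peak_le_one y)
  by_cases hxV : x ∈ V
  · filter_upwards [eventually_smallSets_closure_subset
      ((hA.inter (hH.isOpen hV)).mem_nhds ⟨hxA, hxV⟩), hb.isHarmonic.isHarmonicAt hA hxA]
      with W hWs hbW hW hxW
    have := hH.isMarkovKernel hW
    rw [peak_of_mem hxA]
    refine le_min (hle W hW) ?_
    calc ∫ y, peak H A V L b y ∂(H W x)
        = ∫ y, min 1 (b y + (H V y).real (A \ L)) ∂(H W x) :=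
          hH.integral_congr hW (fun y hy => peak_of_mem (hWs hy).1) hxW
      _ ≤ ∫ y, (b y + (H V y).real (A \ L)) ∂(H W x) :=
          integral_mono (hr.integrable _) (hsum.integrable _) fun y => min_le_right _ _
      _ = b x + (H V x).real (A \ L) := by
          have hq := hH.integral_integral hV hW (subset_closure.trans (hWs.trans
            inter_subset_right)) ((IsBddMeasurable.const 1).indicator hAL) x
          simp only [integral_indicator hAL, integral_const, smul_eq_mul, mul_one,
            measureReal_restrict_apply_univ] at hq
          rw [integral_add (hb.isBddMeasurable.integrable _) (hqm.integrable _), hbW hW hxW, hq]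
  · rw [IsSuperharmonicAt, peak_of_notMem_closure hH hV hb.pos hbL hAL hxV (.inl hxA)]
    exact Eventually.of_forall fun W hW _ => hle W hW

/-- The set `L` is chosen such that `H_V(z, A ∖ L)` is small; `b` is bounded away from `0` on `L`
since `L` is a compact subset of `A`. -/
lemma IsBarrier.exists_isPeakFunction (hH : IsNormalBauerFamily 𝒱 H) (hA : IsOpen A)
    (hb : IsBarrier 𝒱 H A z b) (hV : V ∈ 𝒱) (hzV : z ∈ V) {η : ℝ} (hη : 0 < η) :
    ∃ p, IsPeakFunction 𝒱 H A V p ∧ ∀ᶠ x in 𝓝[closure A] z, p x < η := by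
  have hVz := (hH.isOpen hV).mem_nhds hzV
  have := hH.isMarkovKernel hV
  obtain ⟨L, hLA, hL, hLlt⟩ : ∃ L ⊆ A, IsCompact L ∧ (H V z).real (A \ L) < η / 2 := by
    obtain ⟨F, hFA, hF, hlt⟩ := hA.measurableSet.exists_isClosed_sdiff_lt (μ := H V z)
      (measure_ne_top _ _) (ε := ENNReal.ofReal (η / 2)) (by simpa using hη)
    refine ⟨F ∩ frontier V, inter_subset_left.trans hFA,
      (hH.isCompact_closure V hV).of_isClosed_subset (hF.inter isClosed_frontier)
        (inter_subset_right.trans frontier_subset_closure),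
      ENNReal.toReal_lt_of_lt_ofReal ((measure_mono_ae ?_).trans_lt hlt)⟩
    filter_upwards [(hH.isBoundaryKernel V hV).ae_mem_frontier hzV] with y hy hyA
    exact ⟨hyA.1, fun hyF => hyA.2 ⟨hyF, hy⟩⟩
  obtain ⟨c, hc, hcL⟩ := hL.exists_forall_le' (hb.isHarmonic.1.mono hLA)
    (fun x hx => hb.pos x (hLA hx))
  have hbc := hb.const_mul (inv_pos.2 hc)
  refine ⟨_, isPeakFunction_peak hH hV hA hbc hL.isClosed fun x hx => ?_, ?_⟩
  · rw [inv_mul_eq_div]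
    exact (one_le_div hc).2 (hcL x hx)
  have hbz := eventually_nhdsWithin_iff.1 (hbc.tendsto.eventually (gt_mem_nhds (half_pos hη)))
  have hqz := ((hH.continuousOn_real hV (hA.sdiff hL.isClosed).measurableSet).continuousAt
    hVz).eventually (gt_mem_nhds hLlt)
  refine mem_nhdsWithin_of_mem_nhds ?_
  filter_upwards [hbz, hqz, hVz] with x hxb hxq hxV
  by_cases hxA : x ∈ A
  · rw [peak_of_mem hxA]
    exact (min_le_right _ _).trans_lt (by linarith [hxb hxA])
  · rwa [peak, if_neg hxA, if_pos (subset_closure hxV)]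

lemma IsBarrier.exists_isUpperFunction (hH : IsNormalBauerFamily 𝒱 H) (hA : IsOpen A)
    (hz : z ∈ frontier A) (hb : IsBarrier 𝒱 H A z b) {f : X → ℝ} (hf : ContinuousOn f (frontier A))
    {M : ℝ} (hM : ∀ x ∈ frontier A, |f x| ≤ M) {ε : ℝ} (hε : 0 < ε) (hε1 : ε ≤ 1) :
    ∃ s, IsUpperFunction 𝒱 H A f (3 * M + 1) s ∧ ∀ᶠ x in 𝓝[closure A] z, s x ≤ f z + ε := by
  have hM0 : 0 ≤ M := (abs_nonneg _).trans (hM z hz)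
  have hfz := abs_le.1 (hM z hz)
  have hlt := eventually_nhdsWithin_iff.1 ((hf z hz).eventually
    (gt_mem_nhds (show f z < f z + ε / 2 by linarith)))
  obtain ⟨V, hV, hzV, hVs⟩ := exists_mem_basis hH.isBasis (eventually_smallSets_closure_subset hlt)
  obtain ⟨p, hp, hpz⟩ := hb.exists_isPeakFunction hH hA hV hzV
    (η := ε / (4 * (M + 1))) (by positivity)
  refine ⟨fun x => (f z + ε / 2) + 2 * M * p x, hp.isUpperFunction hH hM0
    (abs_le.2 ⟨by linarith, by linarith⟩)
    (fun x hx => by linarith [(abs_le.1 (hM x hx)).2]) (fun x hx => (hVs hx.2 hx.1).le), ?_⟩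
  filter_upwards [hpz] with x hx
  have hpx : 2 * M * p x ≤ 2 * M * (ε / (4 * (M + 1))) :=
    mul_le_mul_of_nonneg_left hx.le (by linarith)
  have hsmall : 2 * M * (ε / (4 * (M + 1))) ≤ ε / 2 := by
    rw [← mul_div_assoc, div_le_div_iff₀ (by positivity) (by positivity)]
    nlinarith
  linarith

lemma IsBarrier.eventually_abs_perron_sub_le (hH : IsNormalBauerFamily 𝒱 H) {U : Set X}
    (hU : IsPSet 𝒱 H U) (hA : IsOpen A) (hAc : IsCompact (closure A)) (hAU : A ⊆ U)
    (hz : z ∈ frontier A) (hb : IsBarrier 𝒱 H A z b) {f : X → ℝ} (hf : ContinuousOn f (frontier A))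
    {M : ℝ} (hM : ∀ x ∈ frontier A, |f x| ≤ M) {ε : ℝ} (hε : 0 < ε) :
    ∀ᶠ x in 𝓝[closure A] z, |perron 𝒱 H A f (3 * M + 1) x - f z| ≤ ε := by
  have hε' : 0 < min ε 1 := lt_min hε one_pos
  obtain ⟨s, hs, hsz⟩ := hb.exists_isUpperFunction hH hA hz hf hM hε' (min_le_right _ _)
  obtain ⟨s', hs', hsz'⟩ := hb.exists_isUpperFunction hH hA hz (f := fun x => -f x) hf.neg
    (fun x hx => (abs_neg (f x)).trans_le (hM x hx)) hε' (min_le_right _ _)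
  have : Nonempty {u : X → ℝ // IsUpperFunction 𝒱 H A f (3 * M + 1) u} := ⟨⟨s, hs⟩⟩
  filter_upwards [hsz, hsz', self_mem_nhdsWithin] with x hx hx' hxA
  have hupper : perron 𝒱 H A f (3 * M + 1) x ≤ s x := perron_le hs x
  have hlower : -s' x ≤ perron 𝒱 H A f (3 * M + 1) x :=
    le_ciInf fun u => u.2.neg_le hH hU hA hAc hAU hs' hxA
  exact abs_le.2 ⟨by linarith [min_le_left ε 1], by linarith [min_le_left ε 1]⟩

lemma solvesDirichlet_perron (hH : IsNormalBauerFamily 𝒱 H) {U : Set X} (hU : IsPSet 𝒱 H U)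
    (hA : IsOpen A) (hAc : IsCompact (closure A)) (hAU : A ⊆ U)
    (hb : ∀ z ∈ frontier A, ∃ b, IsBarrier 𝒱 H A z b) {f : X → ℝ} (hf : ContinuousOn f (frontier A))
    {M : ℝ} (hM0 : 0 ≤ M) (hM : ∀ x ∈ frontier A, |f x| ≤ M) :
    SolvesDirichlet 𝒱 H A f (perron 𝒱 H A f (3 * M + 1)) := by
  have hharm : IsHarmonic 𝒱 H A (perron 𝒱 H A f (3 * M + 1)) := isHarmonic_perron hH hA
    ⟨fun _ => M, measurable_const, fun _ => by rw [abs_of_nonneg hM0]; linarith,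
      lowerSemicontinuousOn_const, fun z hz => (abs_le.1 (hM z hz)).2,
      fun x _ => isSuperharmonicAt_const hH M x⟩
  have hlim : ∀ z ∈ frontier A,
      Tendsto (perron 𝒱 H A f (3 * M + 1)) (𝓝[closure A] z) (𝓝 (f z)) := by
    intro z hz
    obtain ⟨b, hbz⟩ := hb z hz
    refine Metric.tendsto_nhds.2 fun ε hε => ?_
    filter_upwards [hbz.eventually_abs_perron_sub_le hH hU hA hAc hAU hz hf hM (half_pos hε)]
      with x hx
    exact hx.trans_lt (half_lt_self hε)
  have heq : EqOn (perron 𝒱 H A f (3 * M + 1)) f (frontier A) := fun z hz =>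
    tendsto_nhds_unique (tendsto_pure_nhds _ z) ((hlim z hz).mono_left
      (pure_le_nhdsWithin (frontier_subset_closure hz)))
  refine ⟨fun x hx => ?_, heq, hharm⟩
  by_cases hxA : x ∈ A
  · exact (hharm.1.continuousAt (hA.mem_nhds hxA)).continuousWithinAt
  · have hz : x ∈ frontier A := hA.frontier_eq ▸ ⟨hx, hxA⟩
    rw [ContinuousWithinAt, heq hz]
    exact hlim x hz

lemma isRegular_of_isBarrier (hH : IsNormalBauerFamily 𝒱 H) {U : Set X} (hU : IsPSet 𝒱 H U)
    (hA : IsOpen A) (hAc : IsCompact (closure A)) (hAU : A ⊆ U)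
    (hb : ∀ z ∈ frontier A, ∃ b, IsBarrier 𝒱 H A z b) : IsRegular 𝒱 H A := by
  refine ⟨hA, hAc, fun f hf => ⟨?_, fun h h' hh hh' x hx => ?_, fun hf0 h hh => ?_⟩⟩
  · obtain ⟨M, hM⟩ := (hAc.of_isClosed_subset isClosed_frontier
      frontier_subset_closure).exists_bound_of_continuousOn hf
    exact ⟨_, solvesDirichlet_perron hH hU hA hAc hAU hb hf (abs_nonneg M)
      fun x hx => (hM x hx).trans (le_abs_self M)⟩
  · have hdiff := hh.add hH (hh'.const_mul (-1))
    have hdiff' := hh'.add hH (hh.const_mul (-1))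
    linarith [hU.nonneg_of_isHarmonic hH hA hAc hAU hdiff.1 hdiff.2.2
        (fun z hz => (hdiff.2.1 hz).ge.trans' (by linarith)) x hx,
      hU.nonneg_of_isHarmonic hH hA hAc hAU hdiff'.1 hdiff'.2.2
        (fun z hz => (hdiff'.2.1 hz).ge.trans' (by linarith)) x hx]
  · exact hU.nonneg_of_isHarmonic hH hA hAc hAU hh.1 hh.2.2
      (fun z hz => by rw [hh.2.1 hz]; exact hf0 z hz)

end Barrier

section RegularKernel

open scoped CompactlySupported BoundedContinuousFunction

lemma measurable_of_measurable_integral {X Y : Type*} [TopologicalSpace X] [MeasurableSpace X]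
    [BorelSpace X] [HasOuterApproxClosed X] [MeasurableSpace Y] {μ : Y → Measure X}
    (hμ : ∀ y, IsProbabilityMeasure (μ y))
    (h : ∀ f : X →ᵇ ℝ, Measurable fun y => ∫ x, f x ∂(μ y)) : Measurable μ := by
  refine Measurable.measure_of_isPiSystem_of_isProbabilityMeasure
    ((BorelSpace.measurable_eq (α := X)).trans borel_eq_generateFrom_isClosed)
    isPiSystem_isClosed fun F hF => ?_
  have hF' : IsClosed F := hF
  refine measurable_of_tendsto_metrizable (f := fun n y => ∫⁻ x, hF'.apprSeq n x ∂(μ y))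
    (fun n => ?_)
    (tendsto_pi_nhds.2 fun y => HasOuterApproxClosed.tendsto_lintegral_apprSeq hF' (μ y))
  have heq : ∀ y, ∫⁻ x, hF'.apprSeq n x ∂(μ y) =
      ENNReal.ofReal (∫ x, (hF'.apprSeq n x : ℝ) ∂(μ y)) := fun y => by
    rw [← BoundedContinuousFunction.toReal_lintegral_coe_eq_integral, ENNReal.ofReal_toReal]
    exact (BoundedContinuousFunction.lintegral_lt_top_of_nnreal (μ y) _).ne
  simp_rw [heq]
  exact (h ⟨⟨fun x => (hF'.apprSeq n x : ℝ), NNReal.continuous_coe.comp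
    (hF'.apprSeq n).continuous⟩, (hF'.apprSeq n).map_bounded'⟩).ennreal_ofReal

lemma extend_val_apply {X : Type*} {s : Set X} (F : s → ℝ) (y : s) :
    Function.extend Subtype.val F 0 (y : X) = F y :=
  Subtype.val_injective.extend_apply F 0 y

lemma continuousOn_extend_val {X : Type*} [TopologicalSpace X] {s : Set X} {F : s → ℝ}
    (hF : Continuous F) : ContinuousOn (Function.extend Subtype.val F 0) s :=
  continuousOn_iff_continuous_domRestrict.2 (hF.congr fun y => (extend_val_apply F y).symm)

variable {X : Type*} [TopologicalSpace X] [MeasurableSpace X]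
  {𝒱 : Set (Set X)} {H : Set X → Kernel X X} {A : Set X}

/-- The solution of the Dirichlet problem on the regular set `A` with boundary values `F`. -/
noncomputable def dirichletSolution (hA : IsRegular 𝒱 H A) (F : C_c(frontier A, ℝ)) : X → ℝ :=
  (hA.2.2 _ (continuousOn_extend_val F.continuous)).1.choose

lemma solvesDirichlet_dirichletSolution (hA : IsRegular 𝒱 H A) (F : C_c(frontier A, ℝ)) :
    SolvesDirichlet 𝒱 H A (Function.extend Subtype.val F 0) (dirichletSolution hA F) :=
  (hA.2.2 _ (continuousOn_extend_val F.continuous)).1.choose_spec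

lemma SolvesDirichlet.eq_dirichletSolution (hA : IsRegular 𝒱 H A) {F : C_c(frontier A, ℝ)}
    {f h : X → ℝ} (hh : SolvesDirichlet 𝒱 H A f h) (hfF : ∀ y : frontier A, f y = F y) :
    EqOn h (dirichletSolution hA F) (closure A) := by
  refine (hA.2.2 _ (continuousOn_extend_val F.continuous)).2.1 h _ ⟨hh.1, fun y hy => ?_, hh.2.2⟩
    (solvesDirichlet_dirichletSolution hA F)
  exact (hh.2.1 hy).trans ((hfF ⟨y, hy⟩).trans (extend_val_apply F ⟨y, hy⟩).symm)

/-- The positive linear functional which maps a boundary function on the regular set `A` to the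
value at `x` of the solution of the Dirichlet problem. -/
noncomputable def dirichletFunctional [T2Space X] [BorelSpace X] (hH : IsNormalBauerFamily 𝒱 H)
    (hA : IsRegular 𝒱 H A) {x : X} (hx : x ∈ closure A) : C_c(frontier A, ℝ) →ₚ[ℝ] ℝ :=
  PositiveLinearMap.mk₀
    { toFun := fun F => dirichletSolution hA F x
      map_add' := fun F G =>
        (((solvesDirichlet_dirichletSolution hA F).add hH
          (solvesDirichlet_dirichletSolution hA G)).eq_dirichletSolution hA
          (fun y => by simp only [extend_val_apply, CompactlySupportedContinuousMap.coe_add,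
            Pi.add_apply]) hx).symm
      map_smul' := fun c F =>
        (((solvesDirichlet_dirichletSolution hA F).const_mul c).eq_dirichletSolution hA
          (fun y => by simp only [extend_val_apply, CompactlySupportedContinuousMap.coe_smul,
            Pi.smul_apply, smul_eq_mul]) hx).symm }
    fun F hF => (hA.2.2 _ (continuousOn_extend_val F.continuous)).2.2
      (fun z hz => (hF ⟨z, hz⟩).trans_eq (extend_val_apply F ⟨z, hz⟩).symm) _
      (solvesDirichlet_dirichletSolution hA F) x hx

lemma IsRegular.exists_measure [T2Space X] [BorelSpace X] (hH : IsNormalBauerFamily 𝒱 H)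
    (hA : IsRegular 𝒱 H A) {x : X} (hx : x ∈ A) :
    ∃ μ : Measure X, IsProbabilityMeasure μ ∧ μ (frontier A)ᶜ = 0 ∧
      ∀ f h : X → ℝ, ContinuousOn f (frontier A) → SolvesDirichlet 𝒱 H A f h →
        ∫ y, f y ∂μ = h x := by
  have : CompactSpace (frontier A) := isCompact_iff_compactSpace.1
    (hA.2.1.of_isClosed_subset isClosed_frontier frontier_subset_closure)
  have hxc : x ∈ closure A := subset_closure hx
  let ν := RealRMK.rieszMeasure (dirichletFunctional hH hA hxc)
  have hme : MeasurableEmbedding (Subtype.val : frontier A → X) :=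
    MeasurableEmbedding.subtype_coe isClosed_frontier.measurableSet
  have h_int : ∀ f h : X → ℝ, ContinuousOn f (frontier A) → SolvesDirichlet 𝒱 H A f h →
      ∫ y, f y ∂(ν.map Subtype.val) = h x := by
    intro f h hf hh
    let F : C_c(frontier A, ℝ) := ⟨⟨fun y => f y, continuousOn_iff_continuous_domRestrict.1 hf⟩,
      HasCompactSupport.of_compactSpace _⟩
    calc ∫ y, f y ∂(ν.map Subtype.val) = ∫ y, F y ∂ν := hme.integral_map f
      _ = dirichletSolution hA F x := RealRMK.integral_rieszMeasure _ F
      _ = h x := (hh.eq_dirichletSolution hA (fun _ => rfl) hxc).symm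
  have hone := h_int (fun _ => 1) (fun _ => 1) continuousOn_const
    ⟨continuousOn_const, fun _ _ => rfl, IsHarmonic.const hH A 1⟩
  refine ⟨ν.map Subtype.val, ⟨?_⟩, ?_, h_int⟩
  · simp only [integral_const, smul_eq_mul, mul_one, Measure.real] at hone
    exact (ENNReal.toReal_eq_one_iff _).1 hone
  · rw [hme.map_apply]
    simp

end RegularKernel

section DirichletKernel

open scoped BoundedContinuousFunction

variable {X : Type*} [TopologicalSpace X] [MeasurableSpace X]
  {𝒱 : Set (Set X)} {H : Set X → Kernel X X} {A : Set X}

lemma IsRegular.exists_isDirichletKernel [T2Space X] [HasOuterApproxClosed X] [BorelSpace X]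
    (hH : IsNormalBauerFamily 𝒱 H) (hA : IsRegular 𝒱 H A) :
    ∃ T, IsDirichletKernel 𝒱 H A T := by
  classical
  have hex : ∀ x, ∃ μ : Measure X, IsProbabilityMeasure μ ∧ (x ∈ A → μ (frontier A)ᶜ = 0 ∧
      ∀ f h : X → ℝ, ContinuousOn f (frontier A) → SolvesDirichlet 𝒱 H A f h →
        ∫ y, f y ∂μ = h x) ∧ (x ∉ A → μ = Measure.dirac x) := fun x => by
    by_cases hx : x ∈ A
    · obtain ⟨μ, hμ, hμA, hμf⟩ := hA.exists_measure hH hx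
      exact ⟨μ, hμ, fun _ => ⟨hμA, hμf⟩, fun h => absurd hx h⟩
    · exact ⟨Measure.dirac x, inferInstance, fun h => absurd h hx, fun _ => rfl⟩
  choose μ hμp hμA hμ using hex
  have hm : Measurable μ := by
    refine measurable_of_measurable_integral hμp fun f => ?_
    have hfc : ContinuousOn (f : X → ℝ) (frontier A) := f.continuous.continuousOn
    obtain ⟨h, hh⟩ := (hA.2.2 f hfc).1
    have hpw : (fun y => ∫ x, f x ∂(μ y)) = A.piecewise h f := by
      ext y
      by_cases hy : y ∈ A
      · rw [piecewise_eq_of_mem _ _ _ hy]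
        exact (hμA y hy).2 f h hfc hh
      · rw [piecewise_eq_of_notMem _ _ _ hy, hμ y hy, integral_dirac]
    rw [hpw]
    exact (hh.1.mono subset_closure).measurable_piecewise f.continuous.continuousOn
      hA.1.measurableSet
  refine ⟨⟨μ, hm⟩, ⟨fun x hx => (hμA x hx).1, fun x hx => hμ x hx⟩, fun f hf => ?_⟩
  obtain ⟨h, hh⟩ := (hA.2.2 f hf).1
  refine hh.congr hH fun x hx => ?_
  by_cases hxA : x ∈ A
  · exact (hμA x hxA).2 f h hf hh
  · have hxf : x ∈ frontier A := hA.1.frontier_eq ▸ ⟨hx, hxA⟩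
    simp only [Kernel.coe_mk, hμ x hxA, integral_dirac]
    exact (hh.2.1 hxf).symm

lemma IsRegular.isDirichletKernel [T2Space X] [HasOuterApproxClosed X] [BorelSpace X]
    (hH : IsNormalBauerFamily 𝒱 H) (hA : IsRegular 𝒱 H A) :
    IsDirichletKernel 𝒱 H A (harmonicKernel 𝒱 H A) := by
  have h : IsRegular 𝒱 H A ∧ ∃ T, IsDirichletKernel 𝒱 H A T :=
    ⟨hA, hA.exists_isDirichletKernel hH⟩
  rw [harmonicKernel, dif_pos h]
  exact h.2.choose_spec

namespace IsDirichletKernel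

variable {T : Kernel X X} {f h : X → ℝ} {x : X}

lemma integral_eq (hA : IsRegular 𝒱 H A) (hT : IsDirichletKernel 𝒱 H A T)
    (hf : ContinuousOn f (frontier A)) (hh : SolvesDirichlet 𝒱 H A f h)
    (hx : x ∈ closure A) : ∫ y, f y ∂(T x) = h x :=
  (hA.2.2 f hf).2.1 _ _ (hT.2 f hf) hh hx

lemma integral_self (hA : IsRegular 𝒱 H A) (hT : IsDirichletKernel 𝒱 H A T)
    (hc : ContinuousOn h (closure A)) (hh : IsHarmonic 𝒱 H A h) (hx : x ∈ closure A) :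
    ∫ y, h y ∂(T x) = h x :=
  hT.integral_eq hA (hc.mono frontier_subset_closure) ⟨hc, fun _ _ => rfl, hh⟩ hx

lemma isMarkovKernel (hH : IsNormalBauerFamily 𝒱 H) (hA : IsRegular 𝒱 H A)
    (hT : IsDirichletKernel 𝒱 H A T) : IsMarkovKernel T := by
  refine ⟨fun x => ?_⟩
  by_cases hx : x ∈ A
  · have hone := hT.integral_self hA (h := fun _ => 1) continuousOn_const (IsHarmonic.const hH A 1)
      (subset_closure hx)
    simp only [integral_const, smul_eq_mul, mul_one, Measure.real] at hone
    exact ⟨(ENNReal.toReal_eq_one_iff _).1 hone⟩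
  · rw [hT.1.2 x hx]
    infer_instance

lemma integral_integral [HasOuterApproxClosed X] [BorelSpace X] (hH : IsNormalBauerFamily 𝒱 H)
    (hA : IsRegular 𝒱 H A) (hT : IsDirichletKernel 𝒱 H A T) {V : Set X} (hV : V ∈ 𝒱)
    (hVA : closure V ⊆ A) (hf : IsBddMeasurable f) (hx : x ∈ A) :
    ∫ z, ∫ y, f y ∂(T z) ∂(H V x) = ∫ y, f y ∂(T x) := by
  have := hH.isMarkovKernel hV
  have := hT.isMarkovKernel hH hA
  have heq : (T ∘ₖ H V) x = T x := by
    refine ext_of_forall_integral_eq_of_IsFiniteMeasure fun φ => ?_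
    rw [Kernel.integral_comp (φ.integrable _)]
    exact (hT.2 φ φ.continuous.continuousOn).2.2.2 V hV hVA x hx
  rw [← Kernel.integral_comp (hf.integrable _), heq]

lemma continuousOn_integral [RegularSpace X] [HasOuterApproxClosed X] [BorelSpace X]
    (hH : IsNormalBauerFamily 𝒱 H) (hA : IsRegular 𝒱 H A) (hT : IsDirichletKernel 𝒱 H A T)
    (hf : IsBddMeasurable f) : ContinuousOn (fun x => ∫ y, f y ∂(T x)) A := by
  intro x hx
  obtain ⟨V, hV, hxV, hVA⟩ := exists_mem_basis hH.isBasis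
    (eventually_smallSets_closure_subset (hA.1.mem_nhds hx))
  have hVn := (hH.isOpen hV).mem_nhds hxV
  have := hT.isMarkovKernel hH hA
  have hb := hf.integral_kernel T
  refine (((hH.continuousOn_integral V hV _ hb.measurable hb.bdd).continuousAt hVn).congr
    ?_).continuousWithinAt
  filter_upwards [hVn] with y hy
  exact hT.integral_integral hH hA hV hVA hf (hVA (subset_closure hy))

lemma isHarmonic_integral [RegularSpace X] [HasOuterApproxClosed X] [BorelSpace X]
    (hH : IsNormalBauerFamily 𝒱 H) (hA : IsRegular 𝒱 H A) (hT : IsDirichletKernel 𝒱 H A T)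
    (hf : IsBddMeasurable f) : IsHarmonic 𝒱 H A (fun x => ∫ y, f y ∂(T x)) :=
  ⟨hT.continuousOn_integral hH hA hf, fun _ hV hVA _ hx =>
    hT.integral_integral hH hA hV hVA hf hx⟩

lemma integral_le [T3Space X] [SecondCountableTopology X] [BorelSpace X]
    (hH : IsNormalBauerFamily 𝒱 H) {U : Set X} (hU : IsPSet 𝒱 H U) (hAU : A ⊆ U)
    (hA : IsRegular 𝒱 H A) (hT : IsDirichletKernel 𝒱 H A T) {u : X → ℝ} (hu : IsBddMeasurable u)
    (hul : LowerSemicontinuousOn u (closure A)) (hus : ∀ x ∈ A, IsSuperharmonicAt 𝒱 H u x)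
    (hx : x ∈ A) : ∫ y, u y ∂(T x) ≤ u x := by
  have := hT.isMarkovKernel hH hA
  exact hU.isSeparatingChoice.integral_le hH hA.1 hA.2.1 hAU
    ⟨hT.1, fun φ hφ => (hT.2 φ hφ.continuousOn).1, fun φ _ hφb p hp W hW hWA =>
      hT.integral_integral hH hA hW.1 hWA hφb hp⟩ hu hul
    (fun p hp => hU.exists_fullChoice hH hA.1 hAU hp (hus p hp)) hx

end IsDirichletKernel

end DirichletKernel

section Geometry

variable {X : Type*} [TopologicalSpace X]

lemma frontier_sdiff_subset_union {s t : Set X} (hs : IsOpen s) (ht : IsClosed t) :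
    frontier (s \ t) ⊆ frontier s ∪ t := by
  rw [(hs.sdiff ht).frontier_eq, hs.frontier_eq]
  rintro x ⟨hx, hx'⟩
  by_cases hxt : x ∈ t
  · exact Or.inr hxt
  · exact Or.inl ⟨closure_mono sdiff_subset hx, fun h => hx' ⟨h, hxt⟩⟩

lemma continuousOn_indicator_of_isClosed {s t r : Set X} (hs : IsClosed s) (ht : IsClosed t)
    (hsr : s ⊆ r) (htr : Disjoint t r) {f : X → ℝ} (hf : ContinuousOn f s) :
    ContinuousOn (r.indicator f) (s ∪ t) :=
  ContinuousOn.union_of_isClosed (hf.congr fun _ hx => indicator_of_mem (hsr hx) f)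
    ((continuousOn_const (c := (0 : ℝ))).congr fun _ hx =>
      indicator_of_notMem (fun h => htr.ne_of_mem hx h rfl) f) hs ht

variable [MeasurableSpace X]

/-- The standing assumptions on the set `K` to be collapsed and its neighborhood `W₀`. -/
structure DarningData (𝒱 : Set (Set X)) (H : Set X → Kernel X X) (K W₀ : Set X) : Prop where
  family : IsNormalBauerFamily 𝒱 H
  isCompact : IsCompact K
  nonempty : K.Nonempty
  regular : IsRegular 𝒱 H W₀
  isPSet : IsPSet 𝒱 H W₀
  subset : K ⊆ W₀
  regular_sdiff : IsRegular 𝒱 H (W₀ \ K)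
  pos : ∀ x ∈ W₀ \ K, 0 < gFun 𝒱 H K W₀ x

/-- The sublevel set `O_t = K ∪ A_t`, which is the preimage in `X` of the neighborhood `U_t` of the
point `x₀`. -/
def OSet (𝒱 : Set (Set X)) (H : Set X → Kernel X X) (K W₀ : Set X) (t : ℝ) : Set X :=
  {x ∈ W₀ | gFun 𝒱 H K W₀ x < t}

variable {𝒱 : Set (Set X)} {H : Set X → Kernel X X} {K W₀ : Set X} {x : X} {s t : ℝ}

local notation "g" => gFun 𝒱 H K W₀
local notation "A" => ASet 𝒱 H K W₀
local notation "S" => SSet 𝒱 H K W₀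
local notation "O" => OSet 𝒱 H K W₀

lemma gFun_eq_integral [BorelSpace X] (x : X) : g x =
    ∫ y, (frontier W₀).indicator (fun _ => (1 : ℝ)) y ∂(harmonicKernel 𝒱 H (W₀ \ K) x) := by
  rw [integral_indicator isClosed_frontier.measurableSet, setIntegral_const, smul_eq_mul, mul_one,
    gFun]

lemma gFun_nonneg : 0 ≤ g x := ENNReal.toReal_nonneg

lemma ASet_eq_sdiff : A t = O t \ K := by
  ext x
  exact ⟨fun h => ⟨⟨h.1.1, h.2⟩, h.1.2⟩, fun h => ⟨⟨h.1.1, h.2⟩, h.1.2⟩⟩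

lemma ASet_subset : A t ⊆ W₀ \ K := fun _ hx => hx.1

lemma ASet_subset_OSet : A t ⊆ O t := fun _ hx => ⟨hx.1.1, hx.2⟩

lemma disjoint_SSet : Disjoint K (S t) := Set.disjoint_left.2 fun _ hx h => h.1.2 hx

lemma SSet_subset_ASet (hst : s < t) : S s ⊆ A t := fun _ hx => ⟨hx.1, hx.2.trans_lt hst⟩

namespace DarningData

lemma isOpen_W (d : DarningData 𝒱 H K W₀) : IsOpen W₀ := d.regular.1

lemma disjoint_frontier (d : DarningData 𝒱 H K W₀) : Disjoint K (frontier W₀) :=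
  disjoint_frontier_iff_isOpen.2 d.isOpen_W |>.symm.mono_left d.subset

lemma isCompact_closure_OSet (d : DarningData 𝒱 H K W₀) (t : ℝ) : IsCompact (closure (O t)) :=
  d.regular.2.1.of_isClosed_subset isClosed_closure (closure_mono fun _ hx => hx.1)

variable [T2Space X]

lemma isClosed_K (d : DarningData 𝒱 H K W₀) : IsClosed K := d.isCompact.isClosed

variable [BorelSpace X] [LocallyCompactSpace X] [SecondCountableTopology X]

lemma isDirichletKernel_sdiff (d : DarningData 𝒱 H K W₀) :
    IsDirichletKernel 𝒱 H (W₀ \ K) (harmonicKernel 𝒱 H (W₀ \ K)) :=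
  d.regular_sdiff.isDirichletKernel d.family

lemma solvesDirichlet_gFun (d : DarningData 𝒱 H K W₀) :
    SolvesDirichlet 𝒱 H (W₀ \ K) ((frontier W₀).indicator fun _ => (1 : ℝ)) g := by
  have h := d.isDirichletKernel_sdiff.2 ((frontier W₀).indicator fun _ => (1 : ℝ))
    ((continuousOn_indicator_of_isClosed isClosed_frontier d.isClosed_K subset_rfl
      d.disjoint_frontier continuousOn_const).mono
      (frontier_sdiff_subset_union d.isOpen_W d.isClosed_K))
  simpa only [← gFun_eq_integral] using h

lemma isHarmonic_gFun (d : DarningData 𝒱 H K W₀) : IsHarmonic 𝒱 H (W₀ \ K) g :=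
  d.solvesDirichlet_gFun.2.2

lemma gFun_eq_zero (d : DarningData 𝒱 H K W₀) (hx : x ∈ K) : g x = 0 := by
  rw [gFun_eq_integral, d.isDirichletKernel_sdiff.1.2 x (fun h => h.2 hx), integral_dirac,
    indicator_of_notMem (fun h => d.disjoint_frontier.ne_of_mem hx h rfl)]

lemma gFun_eq_one (d : DarningData 𝒱 H K W₀) (hx : x ∈ frontier W₀) : g x = 1 := by
  have hx' : x ∉ W₀ := (d.isOpen_W.frontier_eq.subset hx).2
  rw [gFun_eq_integral, d.isDirichletKernel_sdiff.1.2 x (fun h => hx' h.1), integral_dirac,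
    indicator_of_mem hx]

lemma isBddMeasurable_gFun (d : DarningData 𝒱 H K W₀) : IsBddMeasurable g := by
  have := d.isDirichletKernel_sdiff.isMarkovKernel d.family d.regular_sdiff
  have h := ((IsBddMeasurable.const (X := X) 1).indicator
    (isClosed_frontier (s := W₀)).measurableSet).integral_kernel (harmonicKernel 𝒱 H (W₀ \ K))
  simpa only [← gFun_eq_integral] using h

lemma gFun_le_one (d : DarningData 𝒱 H K W₀) : g x ≤ 1 := by
  have := d.isDirichletKernel_sdiff.isMarkovKernel d.family d.regular_sdiff
  exact measureReal_le_one

lemma continuousOn_gFun (d : DarningData 𝒱 H K W₀) : ContinuousOn g (closure W₀) := by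
  have h : closure W₀ ⊆ closure (W₀ \ K) ∪ K := calc
    closure W₀ ⊆ closure ((W₀ \ K) ∪ K) := closure_mono (subset_sdiff_union W₀ K)
    _ = closure (W₀ \ K) ∪ K := by rw [closure_union, d.isClosed_K.closure_eq]
  exact (d.solvesDirichlet_gFun.1.union_of_isClosed
    ((continuousOn_const (c := (0 : ℝ))).congr fun x hx => d.gFun_eq_zero hx) isClosed_closure
    d.isClosed_K).mono h

lemma isOpen_OSet (d : DarningData 𝒱 H K W₀) (t : ℝ) : IsOpen (O t) :=
  (d.continuousOn_gFun.mono subset_closure).isOpen_inter_preimage d.isOpen_W isOpen_Iio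

lemma subset_OSet (d : DarningData 𝒱 H K W₀) (ht : 0 < t) : K ⊆ O t := fun _ hx =>
  ⟨d.subset hx, (d.gFun_eq_zero hx).trans_lt ht⟩

lemma isOpen_ASet (d : DarningData 𝒱 H K W₀) (t : ℝ) : IsOpen (A t) := by
  rw [ASet_eq_sdiff]
  exact (d.isOpen_OSet t).sdiff d.isClosed_K

lemma OSet_eq_union (d : DarningData 𝒱 H K W₀) (ht : 0 < t) : O t = A t ∪ K := by
  rw [ASet_eq_sdiff, sdiff_union_self, union_eq_left.2 (d.subset_OSet ht)]

lemma measurableSet_SSet (d : DarningData 𝒱 H K W₀) (t : ℝ) : MeasurableSet (S t) :=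
  (d.isOpen_W.sdiff d.isClosed_K).measurableSet.inter
    (d.isBddMeasurable_gFun.measurable (measurableSet_singleton t))

lemma closure_OSet_subset (d : DarningData 𝒱 H K W₀) (ht : t < 1) :
    closure (O t) ⊆ {x ∈ W₀ | g x ≤ t} := by
  have hclosed : IsClosed {x ∈ closure W₀ | g x ≤ t} :=
    d.continuousOn_gFun.preimage_isClosed_of_isClosed isClosed_closure isClosed_Iic
  have hsub : closure (O t) ⊆ {x ∈ closure W₀ | g x ≤ t} :=
    closure_minimal (fun x hx => ⟨subset_closure hx.1, hx.2.le⟩) hclosed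
  intro x hx
  refine ⟨?_, (hsub hx).2⟩
  by_contra hxW
  have hone := d.gFun_eq_one (x := x) (d.isOpen_W.frontier_eq.superset ⟨(hsub hx).1, hxW⟩)
  exact ((hsub hx).2.trans_lt ht).ne hone

lemma frontier_OSet_subset (d : DarningData 𝒱 H K W₀) (ht0 : 0 < t) (ht : t < 1) :
    frontier (O t) ⊆ S t := by
  rw [(d.isOpen_OSet t).frontier_eq]
  rintro x ⟨hx, hxO⟩
  obtain ⟨hxW, hxt⟩ := d.closure_OSet_subset ht hx
  have hxg : g x = t := le_antisymm hxt (not_lt.1 fun h => hxO ⟨hxW, h⟩)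
  exact ⟨⟨hxW, fun hxK => ht0.ne ((d.gFun_eq_zero hxK).symm.trans hxg)⟩, hxg⟩

lemma closure_OSet_eq (d : DarningData 𝒱 H K W₀) (ht : 0 < t) :
    closure (O t) = closure (A t) ∪ K := by
  rw [d.OSet_eq_union ht, closure_union, d.isClosed_K.closure_eq]

lemma closure_OSet_subset_OSet (d : DarningData 𝒱 H K W₀) (hst : s < t) (ht : t < 1) :
    closure (O s) ⊆ O t := fun _ hx =>
  have hx' := d.closure_OSet_subset (hst.trans ht) hx
  ⟨hx'.1, hx'.2.trans_lt hst⟩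

lemma frontier_ASet_subset (d : DarningData 𝒱 H K W₀) : frontier (A t) ⊆ frontier (O t) ∪ K := by
  rw [ASet_eq_sdiff]
  exact frontier_sdiff_subset_union (d.isOpen_OSet t) d.isClosed_K

lemma regular_ASet (d : DarningData 𝒱 H K W₀) (ht0 : 0 < t) (ht : t < 1) :
    IsRegular 𝒱 H (A t) := by
  have hsub : A t ⊆ W₀ := ASet_subset.trans sdiff_subset
  have hcl : closure (A t) ⊆ closure W₀ := closure_mono hsub
  have hharm : IsHarmonic 𝒱 H (A t) g := d.isHarmonic_gFun.mono ASet_subset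
  refine isRegular_of_isBarrier d.family d.isPSet (d.isOpen_ASet t)
    (d.regular.2.1.of_isClosed_subset isClosed_closure hcl) hsub fun z hz => ?_
  have hlim : Tendsto g (𝓝[A t] z) (𝓝 (g z)) := ((d.continuousOn_gFun z
    (hcl (frontier_subset_closure hz))).mono (hsub.trans subset_closure)).tendsto
  rcases d.frontier_ASet_subset hz with hzO | hzK
  · rw [(d.frontier_OSet_subset ht0 ht hzO).2] at hlim
    refine ⟨fun x => t + (-1) * g x, ?_, fun x hx => ?_, ?_, ?_⟩
    · exact (IsBddMeasurable.const t).add ((IsBddMeasurable.const (-1)).mul d.isBddMeasurable_gFun)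
    · linarith [hx.2]
    · exact (IsHarmonic.const d.family _ t).add d.family (hharm.const_mul (-1))
    · simpa using (tendsto_const_nhds (x := t)).add (hlim.const_mul (-1))
  · rw [d.gFun_eq_zero hzK] at hlim
    exact ⟨g, d.isBddMeasurable_gFun, fun x hx => d.pos x (ASet_subset hx), hharm, hlim⟩

end DarningData

end Geometry

section Darned

open scoped BoundedContinuousFunction

lemma IsBddMeasurable.of_boundedContinuousFunction {X : Type*} [TopologicalSpace X]
    [MeasurableSpace X] [OpensMeasurableSpace X] (f : X →ᵇ ℝ) : IsBddMeasurable f :=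
  ⟨f.continuous.measurable, ‖f‖, f.norm_coe_le_norm⟩

variable {X : Type*} [TopologicalSpace X] [MeasurableSpace X]

/-- The harmonic kernel of `A_t`. -/
noncomputable abbrev AKernel (𝒱 : Set (Set X)) (H : Set X → Kernel X X) (K W₀ : Set X) (t : ℝ) :
    Kernel X X :=
  harmonicKernel 𝒱 H (ASet 𝒱 H K W₀ t)

open Classical in
/-- The measures `H_{A_t}(x, ·)|_{S_t} + (1 - g(x)/t) σ_t`, `x ∈ O_t`, from which the kernel of
`U_t` is built, extended by Dirac measures. They are measures on `X`, and all points `x ∈ K` give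
`σ_t`. -/
noncomputable def darnMeasure (𝒱 : Set (Set X)) (H : Set X → Kernel X X) (K W₀ : Set X)
    (σ : ℝ → Measure X) (t : ℝ) (x : X) : Measure X :=
  if x ∈ OSet 𝒱 H K W₀ t then
    (harmonicKernel 𝒱 H (ASet 𝒱 H K W₀ t) x).restrict (SSet 𝒱 H K W₀ t) +
      ENNReal.ofReal (1 - gFun 𝒱 H K W₀ x / t) • σ t
  else Measure.dirac x

/-- `σ r` is a probability measure on `S_r` for `0 < r < 1`. -/
def IsSphereFamily (𝒱 : Set (Set X)) (H : Set X → Kernel X X) (K W₀ : Set X)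
    (σ : ℝ → Measure X) : Prop :=
  ∀ r ∈ Ioo (0 : ℝ) 1, IsProbabilityMeasure (σ r) ∧ σ r (SSet 𝒱 H K W₀ r)ᶜ = 0

variable {𝒱 : Set (Set X)} {H : Set X → Kernel X X} {K W₀ : Set X} {σ : ℝ → Measure X}
  {r s t : ℝ} {x : X} {f k : X → ℝ} {c : ℝ}

local notation "g" => gFun 𝒱 H K W₀
local notation "A" => ASet 𝒱 H K W₀
local notation "S" => SSet 𝒱 H K W₀
local notation "O" => OSet 𝒱 H K W₀
local notation "T" => AKernel 𝒱 H K W₀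
local notation "Q" => darnMeasure 𝒱 H K W₀ σ

lemma IsSphereFamily.ae_mem (hσ : IsSphereFamily 𝒱 H K W₀ σ) (ht : t ∈ Ioo (0 : ℝ) 1) :
    ∀ᵐ y ∂(σ t), y ∈ S t := mem_ae_iff.2 (hσ t ht).2

lemma darnMeasure_of_mem (hx : x ∈ O t) :
    Q t x = (T t x).restrict (S t) + ENNReal.ofReal (1 - g x / t) • σ t := if_pos hx

lemma darnMeasure_of_notMem (hx : x ∉ O t) : Q t x = Measure.dirac x := if_neg hx

lemma one_sub_div_nonneg_of_mem_OSet (ht : 0 < t) (hx : x ∈ O t) : 0 ≤ 1 - g x / t :=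
  sub_nonneg.2 ((div_le_one ht).2 hx.2.le)

variable [T2Space X] [LocallyCompactSpace X] [SecondCountableTopology X] [BorelSpace X]

namespace DarningData

lemma isDirichletKernel (d : DarningData 𝒱 H K W₀) (ht : t ∈ Ioo (0 : ℝ) 1) :
    IsDirichletKernel 𝒱 H (A t) (T t) :=
  (d.regular_ASet ht.1 ht.2).isDirichletKernel d.family

lemma isMarkovKernel (d : DarningData 𝒱 H K W₀) (ht : t ∈ Ioo (0 : ℝ) 1) :
    IsMarkovKernel (T t) :=
  (d.isDirichletKernel ht).isMarkovKernel d.family (d.regular_ASet ht.1 ht.2)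

lemma ae_mem_frontier_ASet (d : DarningData 𝒱 H K W₀) (ht : t ∈ Ioo (0 : ℝ) 1) (hx : x ∈ A t) :
    ∀ᵐ y ∂(T t x), y ∈ frontier (A t) :=
  (d.isDirichletKernel ht).1.ae_mem_frontier hx

lemma integral_add_measureReal_mul (d : DarningData 𝒱 H K W₀) (ht : t ∈ Ioo (0 : ℝ) 1)
    (hc : ContinuousOn k (closure (A t))) (hk : IsHarmonic 𝒱 H (A t) k)
    (hkK : ∀ x ∈ closure (A t) ∩ K, k x = c) (hx : x ∈ A t) :
    k x = ∫ y in S t, k y ∂(T t x) + (T t x).real K * c := by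
  have hA := d.regular_ASet ht.1 ht.2
  have := d.isMarkovKernel ht
  have hki : Integrable k (T t x) := by
    refine ((IsBddMeasurable.of_continuousOn hA.2.1 hc).integrable _).congr ?_
    filter_upwards [d.ae_mem_frontier_ASet ht hx] with y hy
    exact indicator_of_mem (frontier_subset_closure hy) k
  have hsplit : ∀ᵐ y ∂(T t x), k y = (S t).indicator k y + K.indicator (fun _ => c) y := by
    filter_upwards [d.ae_mem_frontier_ASet ht hx] with y hy
    rcases d.frontier_ASet_subset hy with hyO | hyK
    · have hyS := d.frontier_OSet_subset ht.1 ht.2 hyO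
      rw [indicator_of_mem hyS, indicator_of_notMem hyS.1.2, add_zero]
    · rw [indicator_of_notMem (fun h : y ∈ S t => h.1.2 hyK), indicator_of_mem hyK, zero_add]
      exact hkK y ⟨frontier_subset_closure hy, hyK⟩
  calc k x = ∫ y, k y ∂(T t x) :=
        ((d.isDirichletKernel ht).integral_self hA hc hk (subset_closure hx)).symm
    _ = ∫ y, ((S t).indicator k y + K.indicator (fun _ => c) y) ∂(T t x) :=
        integral_congr_ae hsplit
    _ = ∫ y in S t, k y ∂(T t x) + (T t x).real K * c := by
        rw [integral_add (hki.indicator (d.measurableSet_SSet t))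
          ((integrable_const c).indicator d.isClosed_K.measurableSet),
          integral_indicator (d.measurableSet_SSet t),
          integral_indicator d.isClosed_K.measurableSet, setIntegral_const, smul_eq_mul]

lemma one_eq_measureReal_add (d : DarningData 𝒱 H K W₀) (ht : t ∈ Ioo (0 : ℝ) 1) (hx : x ∈ A t) :
    1 = (T t x).real (S t) + (T t x).real K := by
  simpa using d.integral_add_measureReal_mul ht (k := fun _ => 1) continuousOn_const
    (IsHarmonic.const d.family _ 1) (fun _ _ => rfl) hx

lemma measureReal_SSet (d : DarningData 𝒱 H K W₀) (ht : t ∈ Ioo (0 : ℝ) 1) (hx : x ∈ A t) :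
    (T t x).real (S t) = g x / t := by
  have hg : g x = ∫ y in S t, g y ∂(T t x) := by
    simpa using d.integral_add_measureReal_mul ht (c := 0)
      (d.continuousOn_gFun.mono (closure_mono (ASet_subset.trans sdiff_subset)))
      (d.isHarmonic_gFun.mono ASet_subset) (fun x hx => d.gFun_eq_zero hx.2) hx
  rw [setIntegral_congr_fun (d.measurableSet_SSet t) (fun y hy => hy.2 : EqOn g (fun _ => t) (S t)),
    setIntegral_const, smul_eq_mul] at hg
  exact eq_div_of_mul_eq ht.1.ne' hg.symm

lemma eq_setIntegral_add (d : DarningData 𝒱 H K W₀) (ht : t ∈ Ioo (0 : ℝ) 1)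
    (hc : ContinuousOn k (closure (A t))) (hk : IsHarmonic 𝒱 H (A t) k)
    (hkK : ∀ x ∈ closure (A t) ∩ K, k x = c) (hx : x ∈ A t) :
    k x = ∫ y in S t, k y ∂(T t x) + (1 - g x / t) * c := by
  rw [← d.measureReal_SSet ht hx, d.one_eq_measureReal_add ht hx, add_sub_cancel_left]
  exact d.integral_add_measureReal_mul ht hc hk hkK hx

lemma AKernel_SSet (d : DarningData 𝒱 H K W₀) (ht : t ∈ Ioo (0 : ℝ) 1) (hx : x ∈ O t) :
    T t x (S t) = ENNReal.ofReal (g x / t) := by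
  have := d.isMarkovKernel ht
  by_cases hxK : x ∈ K
  · rw [(d.isDirichletKernel ht).1.2 x (fun h => h.1.2 hxK), d.gFun_eq_zero hxK,
      Measure.dirac_apply' _ (d.measurableSet_SSet t), indicator_of_notMem (fun h => h.1.2 hxK),
      zero_div, ENNReal.ofReal_zero]
  · rw [← d.measureReal_SSet ht ⟨⟨hx.1, hxK⟩, hx.2⟩, ofReal_measureReal]

lemma isProbabilityMeasure_darnMeasure (d : DarningData 𝒱 H K W₀)
    (hσ : IsSphereFamily 𝒱 H K W₀ σ) (ht : t ∈ Ioo (0 : ℝ) 1) (x : X) :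
    IsProbabilityMeasure (Q t x) := by
  by_cases hx : x ∈ O t
  · have := (hσ t ht).1
    refine ⟨?_⟩
    rw [darnMeasure_of_mem hx, Measure.add_apply, Measure.restrict_apply_univ, d.AKernel_SSet ht hx,
      Measure.smul_apply, measure_univ, smul_eq_mul, mul_one,
      ← ENNReal.ofReal_add (div_nonneg gFun_nonneg ht.1.le)
        (one_sub_div_nonneg_of_mem_OSet ht.1 hx),
      add_sub_cancel, ENNReal.ofReal_one]
  · rw [darnMeasure_of_notMem hx]
    infer_instance

lemma measurable_darnMeasure (d : DarningData 𝒱 H K W₀) (t : ℝ) : Measurable (Q t) := by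
  classical
  refine Measurable.ite (d.isOpen_OSet t).measurableSet ?_ Measure.measurable_dirac
  refine Measure.measurable_of_measurable_coe _ fun s hs => ?_
  simp only [Measure.add_apply, Measure.smul_apply, smul_eq_mul, Measure.restrict_apply hs]
  refine ((T t).measurable_coe (hs.inter (d.measurableSet_SSet t))).add (Measurable.mul_const ?_ _)
  exact (measurable_const.sub (d.isBddMeasurable_gFun.measurable.div_const t)).ennreal_ofReal

/-- The kernel on `X` with the measures `darnMeasure`. -/
noncomputable def darnKernel (d : DarningData 𝒱 H K W₀) (σ : ℝ → Measure X) (t : ℝ) : Kernel X X :=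
  ⟨darnMeasure 𝒱 H K W₀ σ t, d.measurable_darnMeasure t⟩

lemma darnKernel_apply (d : DarningData 𝒱 H K W₀) (t : ℝ) (x : X) :
    d.darnKernel σ t x = Q t x := rfl

lemma isMarkovKernel_darnKernel (d : DarningData 𝒱 H K W₀)
    (hσ : IsSphereFamily 𝒱 H K W₀ σ) (ht : t ∈ Ioo (0 : ℝ) 1) :
    IsMarkovKernel (d.darnKernel σ t) :=
  ⟨fun x => d.isProbabilityMeasure_darnMeasure hσ ht x⟩

lemma AKernel_restrict_SSet_eq_zero (d : DarningData 𝒱 H K W₀) (ht : t ∈ Ioo (0 : ℝ) 1)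
    (hx : x ∈ K) : (T t x).restrict (S t) = 0 := by
  rw [Measure.restrict_eq_zero, d.AKernel_SSet ht (d.subset_OSet ht.1 hx), d.gFun_eq_zero hx,
    zero_div, ENNReal.ofReal_zero]

lemma darnMeasure_of_mem_K (d : DarningData 𝒱 H K W₀) (ht : t ∈ Ioo (0 : ℝ) 1) (hx : x ∈ K) :
    Q t x = σ t := by
  rw [darnMeasure_of_mem (d.subset_OSet ht.1 hx), d.AKernel_restrict_SSet_eq_zero ht hx,
    d.gFun_eq_zero hx, zero_div, sub_zero, ENNReal.ofReal_one, one_smul, zero_add]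

lemma integral_darnMeasure (d : DarningData 𝒱 H K W₀) (hσ : IsSphereFamily 𝒱 H K W₀ σ)
    (ht : t ∈ Ioo (0 : ℝ) 1) (hf : IsBddMeasurable f) (hx : x ∈ O t) :
    ∫ y, f y ∂(Q t x) = ∫ y in S t, f y ∂(T t x) + (1 - g x / t) * ∫ y, f y ∂(σ t) := by
  have := (hσ t ht).1
  have := d.isMarkovKernel ht
  rw [darnMeasure_of_mem hx, integral_add_measure (hf.integrable _)
    ((hf.integrable _).smul_measure ENNReal.ofReal_ne_top), integral_smul_measure,
    ENNReal.toReal_ofReal (one_sub_div_nonneg_of_mem_OSet ht.1 hx), smul_eq_mul]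

lemma integral_darnMeasure_of_mem_closure (d : DarningData 𝒱 H K W₀)
    (hσ : IsSphereFamily 𝒱 H K W₀ σ) (ht : t ∈ Ioo (0 : ℝ) 1) (hf : IsBddMeasurable f)
    (hx : x ∈ closure (O t)) :
    ∫ y, f y ∂(Q t x) =
      ∫ y, (S t).indicator f y ∂(T t x) + (1 - g x / t) * ∫ y, f y ∂(σ t) := by
  by_cases hxO : x ∈ O t
  · rw [d.integral_darnMeasure hσ ht hf hxO, integral_indicator (d.measurableSet_SSet t)]
  · have hxS : x ∈ S t :=
      d.frontier_OSet_subset ht.1 ht.2 ((d.isOpen_OSet t).frontier_eq.superset ⟨hx, hxO⟩)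
    have hxA : x ∉ A t := fun h => hxO (ASet_subset_OSet h)
    rw [darnMeasure_of_notMem hxO, (d.isDirichletKernel ht).1.2 x hxA, integral_dirac,
      integral_dirac, indicator_of_mem hxS, hxS.2, div_self ht.1.ne', sub_self, zero_mul, add_zero]

lemma continuousOn_integral_darnMeasure (d : DarningData 𝒱 H K W₀)
    (hσ : IsSphereFamily 𝒱 H K W₀ σ) (ht : t ∈ Ioo (0 : ℝ) 1) (hf : IsBddMeasurable f)
    (hfc : ContinuousOn f (frontier (O t))) :
    ContinuousOn (fun x => ∫ y, f y ∂(Q t x)) (closure (O t)) := by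
  refine ContinuousOn.congr (ContinuousOn.add ?_ ?_)
    (fun x hx => d.integral_darnMeasure_of_mem_closure hσ ht hf hx)
  · rw [d.closure_OSet_eq ht.1]
    refine ContinuousOn.union_of_isClosed ?_ ?_ isClosed_closure d.isClosed_K
    · exact ((d.isDirichletKernel ht).2 _ ((continuousOn_indicator_of_isClosed isClosed_frontier
        d.isClosed_K (d.frontier_OSet_subset ht.1 ht.2) disjoint_SSet hfc).mono
        d.frontier_ASet_subset)).1
    · refine (continuousOn_const (c := (0 : ℝ))).congr fun x hx => ?_
      rw [integral_indicator (d.measurableSet_SSet t), d.AKernel_restrict_SSet_eq_zero ht hx,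
        integral_zero_measure]
  · have hg := d.continuousOn_gFun.mono (closure_mono fun x (hx : x ∈ O t) => hx.1)
    exact (continuousOn_const.sub (hg.div_const t)).mul continuousOn_const

lemma isHarmonic_integral_darnMeasure (d : DarningData 𝒱 H K W₀)
    (hσ : IsSphereFamily 𝒱 H K W₀ σ) (ht : t ∈ Ioo (0 : ℝ) 1) (hf : IsBddMeasurable f) :
    IsHarmonic 𝒱 H (A t) (fun x => ∫ y, f y ∂(Q t x)) := by
  have hS := (d.isDirichletKernel ht).isHarmonic_integral d.family (d.regular_ASet ht.1 ht.2)
    (hf.indicator (d.measurableSet_SSet t))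
  have hg := ((IsHarmonic.const d.family (A t) 1).add d.family
    ((d.isHarmonic_gFun.mono ASet_subset).const_mul (-t⁻¹))).const_mul (∫ y, f y ∂(σ t))
  refine (hS.add d.family hg).congr d.family fun x hx => ?_
  rw [d.integral_darnMeasure_of_mem_closure hσ ht hf (subset_closure (ASet_subset_OSet hx))]
  ring

lemma darnKernel_comp (d : DarningData 𝒱 H K W₀) (hσ : IsSphereFamily 𝒱 H K W₀ σ)
    (ht : t ∈ Ioo (0 : ℝ) 1) {V : Set X} (hV : V ∈ 𝒱) (hVA : V ⊆ A t) :
    d.darnKernel σ t ∘ₖ H V = d.darnKernel σ t := by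
  have := d.isMarkovKernel_darnKernel hσ ht
  have := d.family.isMarkovKernel hV
  ext1 x
  refine ext_of_forall_integral_eq_of_IsFiniteMeasure fun φ => ?_
  have hφ := IsBddMeasurable.of_boundedContinuousFunction φ
  rw [Kernel.integral_comp (φ.integrable _)]
  refine d.family.integral_eq_of_isHarmonicAt hV (h := fun x => ∫ y, φ y ∂(d.darnKernel σ t x))
    ((d.continuousOn_integral_darnMeasure hσ ht hφ φ.continuous.continuousOn).mono
      (closure_mono (hVA.trans ASet_subset_OSet))) (fun y hy => ?_) x
  exact (d.isHarmonic_integral_darnMeasure hσ ht hφ).isHarmonicAt (d.isOpen_ASet t) (hVA hy)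

lemma integral_setIntegral_of_isCompatible (d : DarningData 𝒱 H K W₀)
    (hσ : IsSphereFamily 𝒱 H K W₀ σ) (hc : IsCompatible 𝒱 H K W₀ σ) (hr : 0 < r) (hrt : r < t)
    (ht : t < 1) (hf : IsBddMeasurable f) :
    ∫ y, ∫ z in S t, f z ∂(T t y) ∂(σ r) = r / t * ∫ y, f y ∂(σ t) := by
  have htI : t ∈ Ioo (0 : ℝ) 1 := ⟨hr.trans hrt, ht⟩
  have := (hσ r ⟨hr, hrt.trans ht⟩).1
  have := (hσ t htI).1
  have := d.isMarkovKernel htI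
  have hbind : (σ r).bind (T t) = (T t ∘ₖ Kernel.const Unit (σ r)) () := by
    rw [Kernel.comp_apply, Kernel.const_apply]
  calc ∫ y, ∫ z in S t, f z ∂(T t y) ∂(σ r) = ∫ z in S t, f z ∂((σ r).bind (T t)) := by
        rw [hbind, ← integral_indicator (d.measurableSet_SSet t), Kernel.integral_comp
          ((hf.indicator (d.measurableSet_SSet t)).integrable _), Kernel.const_apply]
        simp_rw [integral_indicator (d.measurableSet_SSet t)]
    _ = r / t * ∫ y, f y ∂(σ t) := by
        rw [hc r t hr hrt ht, integral_smul_measure,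
          Measure.restrict_eq_self_of_ae_mem (hσ.ae_mem htI),
          ENNReal.toReal_ofReal (div_nonneg hr.le htI.1.le), smul_eq_mul]

lemma ae_restrict_SSet_mem_frontier_OSet (d : DarningData 𝒱 H K W₀) (ht : t ∈ Ioo (0 : ℝ) 1)
    (hx : x ∈ A t) : ∀ᵐ y ∂((T t x).restrict (S t)), y ∈ frontier (O t) := by
  filter_upwards [ae_restrict_of_ae (d.ae_mem_frontier_ASet ht hx),
    ae_restrict_mem (d.measurableSet_SSet t)] with z hz hzS
  exact (d.frontier_ASet_subset hz).resolve_right hzS.1.2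

/-- By compatibility `σ_t` is a multiple of `σ_r H_{A_t}` on `S_t`, hence it does not charge the
part of `S_t` which is not in the boundary of `A_t`. -/
lemma ae_mem_frontier_OSet (d : DarningData 𝒱 H K W₀) (hσ : IsSphereFamily 𝒱 H K W₀ σ)
    (hc : IsCompatible 𝒱 H K W₀ σ) (ht : t ∈ Ioo (0 : ℝ) 1) :
    ∀ᵐ y ∂(σ t), y ∈ frontier (O t) := by
  obtain ⟨r, hr, hrt⟩ := exists_between ht.1
  have hrI : r ∈ Ioo (0 : ℝ) 1 := ⟨hr, hrt.trans ht.2⟩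
  have := (hσ t ht).1
  have hfr : MeasurableSet (frontier (O t))ᶜ := isClosed_frontier.measurableSet.compl
  have hcomp := d.integral_setIntegral_of_isCompatible hσ hc hr hrt ht.2
    ((IsBddMeasurable.const (X := X) 1).indicator hfr)
  have hzero : ∫ y, ∫ z in S t, (frontier (O t))ᶜ.indicator (fun _ => (1 : ℝ)) z ∂(T t y) ∂(σ r)
      = 0 := by
    refine integral_eq_zero_of_ae ?_
    filter_upwards [hσ.ae_mem hrI] with y hy
    refine integral_eq_zero_of_ae ?_
    filter_upwards [d.ae_restrict_SSet_mem_frontier_OSet ht (SSet_subset_ASet hrt hy)] with z hz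
    exact indicator_of_notMem (not_not.2 hz) _
  rw [hzero, integral_indicator hfr, setIntegral_const, smul_eq_mul, mul_one] at hcomp
  exact mem_ae_iff.2 ((measureReal_eq_zero_iff).1
    ((mul_eq_zero.1 hcomp.symm).resolve_left (div_pos hr ht.1).ne'))

lemma isBoundaryKernel_darnKernel (d : DarningData 𝒱 H K W₀) (hσ : IsSphereFamily 𝒱 H K W₀ σ)
    (hc : IsCompatible 𝒱 H K W₀ σ) (ht : t ∈ Ioo (0 : ℝ) 1) :
    IsBoundaryKernel (O t) (d.darnKernel σ t) := by
  refine ⟨fun x hx => ?_, fun x hx => darnMeasure_of_notMem hx⟩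
  have hσt : σ t (frontier (O t))ᶜ = 0 := mem_ae_iff.1 (d.ae_mem_frontier_OSet hσ hc ht)
  have hTt : (T t x).restrict (S t) (frontier (O t))ᶜ = 0 := by
    by_cases hxK : x ∈ K
    · rw [d.AKernel_restrict_SSet_eq_zero ht hxK, Measure.coe_zero, Pi.zero_apply]
    · exact mem_ae_iff.1 (d.ae_restrict_SSet_mem_frontier_OSet ht ⟨⟨hx.1, hxK⟩, hx.2⟩)
  rw [d.darnKernel_apply, darnMeasure_of_mem hx, Measure.add_apply, Measure.smul_apply, hσt, hTt,
    smul_zero, add_zero]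

lemma integral_integral_darnMeasure (d : DarningData 𝒱 H K W₀) (hσ : IsSphereFamily 𝒱 H K W₀ σ)
    (hc : IsCompatible 𝒱 H K W₀ σ) (hr : 0 < r) (hrt : r < t) (ht : t < 1)
    (hf : IsBddMeasurable f) : ∫ y, ∫ z, f z ∂(Q t y) ∂(σ r) = ∫ y, f y ∂(σ t) := by
  have htI : t ∈ Ioo (0 : ℝ) 1 := ⟨hr.trans hrt, ht⟩
  have hrI : r ∈ Ioo (0 : ℝ) 1 := ⟨hr, hrt.trans ht⟩
  have := (hσ r hrI).1
  have := d.isMarkovKernel htI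
  have hfS := hf.indicator (d.measurableSet_SSet t)
  calc ∫ y, ∫ z, f z ∂(Q t y) ∂(σ r)
      = ∫ y, (∫ z, (S t).indicator f z ∂(T t y) + (1 - r / t) * ∫ z, f z ∂(σ t)) ∂(σ r) := by
        refine integral_congr_ae ?_
        filter_upwards [hσ.ae_mem hrI] with y hy
        rw [d.integral_darnMeasure_of_mem_closure hσ htI hf
          (subset_closure (ASet_subset_OSet (SSet_subset_ASet hrt hy))), hy.2]
    _ = r / t * ∫ y, f y ∂(σ t) + (1 - r / t) * ∫ y, f y ∂(σ t) := by
        rw [integral_add ((hfS.integral_kernel (T t)).integrable _) (integrable_const _)]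
        simp_rw [integral_indicator (d.measurableSet_SSet t)]
        rw [d.integral_setIntegral_of_isCompatible hσ hc hr hrt ht hf, integral_const,
          probReal_univ, one_smul]
    _ = ∫ y, f y ∂(σ t) := by ring

lemma darnKernel_comp_darnKernel (d : DarningData 𝒱 H K W₀) (hσ : IsSphereFamily 𝒱 H K W₀ σ)
    (hc : IsCompatible 𝒱 H K W₀ σ) (hs : 0 < s) (hst : s < t) (ht : t < 1) :
    d.darnKernel σ t ∘ₖ d.darnKernel σ s = d.darnKernel σ t := by
  have htI : t ∈ Ioo (0 : ℝ) 1 := ⟨hs.trans hst, ht⟩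
  have hsI : s ∈ Ioo (0 : ℝ) 1 := ⟨hs, hst.trans ht⟩
  have := d.isMarkovKernel_darnKernel hσ htI
  have := d.isMarkovKernel_darnKernel hσ hsI
  ext1 x
  refine ext_of_forall_integral_eq_of_IsFiniteMeasure fun φ => ?_
  have hφ := IsBddMeasurable.of_boundedContinuousFunction φ
  rw [Kernel.integral_comp (φ.integrable _)]
  have hk : IsBddMeasurable fun x => ∫ y, φ y ∂(d.darnKernel σ t x) := hφ.integral_kernel _
  simp only [d.darnKernel_apply] at hk ⊢
  have hKt : ∀ y ∈ K, ∫ z, φ z ∂(Q t y) = ∫ z, φ z ∂(σ t) := fun y hy => by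
    rw [d.darnMeasure_of_mem_K htI hy]
  by_cases hx : x ∈ O s
  · rw [d.integral_darnMeasure hσ hsI hk hx, d.integral_integral_darnMeasure hσ hc hs hst ht hφ]
    by_cases hxK : x ∈ K
    · rw [d.AKernel_restrict_SSet_eq_zero hsI hxK, d.gFun_eq_zero hxK, hKt x hxK,
        integral_zero_measure, zero_div, sub_zero, one_mul, zero_add]
    · have hsub : closure (A s) ⊆ closure (O t) := (closure_mono ASet_subset_OSet).trans
        ((d.closure_OSet_subset_OSet hst ht).trans subset_closure)
      exact (d.eq_setIntegral_add hsI
        ((d.continuousOn_integral_darnMeasure hσ htI hφ φ.continuous.continuousOn).mono hsub)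
        ((d.isHarmonic_integral_darnMeasure hσ htI hφ).mono fun y hy => ⟨hy.1, hy.2.trans hst⟩)
        (fun y hy => hKt y hy.2) ⟨⟨hx.1, hxK⟩, hx.2⟩).symm
  · rw [darnMeasure_of_notMem hx, integral_dirac]

/-- Near `K` the integral is reproduced by the kernel of a smaller `U_s`, whose boundary lies in
`A_t`, where the integral is continuous. -/
lemma continuousOn_integral_darnMeasure_OSet (d : DarningData 𝒱 H K W₀)
    (hσ : IsSphereFamily 𝒱 H K W₀ σ) (hc : IsCompatible 𝒱 H K W₀ σ) (ht : t ∈ Ioo (0 : ℝ) 1)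
    (hf : IsBddMeasurable f) : ContinuousOn (fun x => ∫ y, f y ∂(Q t x)) (O t) := by
  have hcA := (d.isHarmonic_integral_darnMeasure hσ ht hf).1
  intro x hx
  by_cases hxK : x ∈ K
  · obtain ⟨s, hs, hst⟩ := exists_between ht.1
    have hsI : s ∈ Ioo (0 : ℝ) 1 := ⟨hs, hst.trans ht.2⟩
    have := d.isMarkovKernel_darnKernel hσ ht
    have := d.isMarkovKernel_darnKernel hσ hsI
    have hk : IsBddMeasurable fun x => ∫ y, f y ∂(d.darnKernel σ t x) := hf.integral_kernel _
    have hcO := d.continuousOn_integral_darnMeasure hσ hsI hk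
      (hcA.mono ((d.frontier_OSet_subset hs hsI.2).trans (SSet_subset_ASet hst)))
    refine ((hcO.mono subset_closure).continuousAt ((d.isOpen_OSet s).mem_nhds
      (d.subset_OSet hs hxK))).congr (Eventually.of_forall fun y => ?_) |>.continuousWithinAt
    have hcomp := Kernel.integral_comp (κ := d.darnKernel σ s) (η := d.darnKernel σ t) (a := y)
      (hf.integrable _)
    rw [d.darnKernel_comp_darnKernel hσ hc hs hst ht.2] at hcomp
    exact hcomp.symm
  · exact (hcA.continuousAt ((d.isOpen_ASet t).mem_nhds ⟨⟨hx.1, hxK⟩, hx.2⟩)).continuousWithinAt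

lemma continuous_integral_darnMeasure (d : DarningData 𝒱 H K W₀)
    (hσ : IsSphereFamily 𝒱 H K W₀ σ) (hc : IsCompatible 𝒱 H K W₀ σ) (ht : t ∈ Ioo (0 : ℝ) 1)
    (hf : Continuous f) : Continuous fun x => ∫ y, f y ∂(Q t x) := by
  have heq : EqOn ((closure (O t)).indicator f) f (closure (O t)) :=
    fun y hy => indicator_of_mem hy f
  have hclosure : ContinuousOn (fun x => ∫ y, f y ∂(Q t x)) (closure (O t)) := by
    refine (d.continuousOn_integral_darnMeasure hσ ht
      (IsBddMeasurable.of_continuousOn (d.isCompact_closure_OSet t) hf.continuousOn)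
      (hf.continuousOn.congr (heq.mono frontier_subset_closure))).congr fun x hx => ?_
    by_cases hxO : x ∈ O t
    · refine integral_congr_ae ?_
      filter_upwards [(d.isBoundaryKernel_darnKernel hσ hc ht).ae_mem_closure hxO] with y hy
      exact (heq hy).symm
    · simp only [darnMeasure_of_notMem hxO, integral_dirac]
      exact (heq hx).symm
  have hcompl : ContinuousOn (fun x => ∫ y, f y ∂(Q t x)) (O t)ᶜ :=
    hf.continuousOn.congr fun x hx => by simp only [darnMeasure_of_notMem hx, integral_dirac]
  rw [← continuousOn_univ]
  refine (hclosure.union_of_isClosed hcompl isClosed_closure (d.isOpen_OSet t).isClosed_compl).mono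
    fun x _ => ?_
  exact (em (x ∈ O t)).imp (fun h => subset_closure h) id

end DarningData

end Darned

section CollapseSpace

variable {X : Type*} {K : Set X} {x y : X}

lemma proj_of_mem (hx : x ∈ K) : proj K x = point K := dif_pos hx

lemma proj_of_notMem (hx : x ∉ K) : proj K x = (some ⟨x, hx⟩ : Option ↥(Kᶜ)) := dif_neg hx

lemma proj_eq_point_iff : proj K x = point K ↔ x ∈ K := by
  refine ⟨fun h => ?_, proj_of_mem⟩
  by_contra hx
  rw [proj_of_notMem hx] at h
  exact Option.some_ne_none _ h

lemma eq_of_proj_eq (hx : x ∉ K) (h : proj K x = proj K y) : x = y := by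
  have hy : y ∉ K := fun hy => hx (proj_eq_point_iff.1 (h.trans (proj_of_mem hy)))
  rw [proj_of_notMem hx, proj_of_notMem hy] at h
  exact congrArg Subtype.val (Option.some_injective _ h)

lemma surjective_proj (hK : K.Nonempty) : Function.Surjective (proj K)
  | none => ⟨hK.some, proj_of_mem hK.some_mem⟩
  | some ⟨x, hx⟩ => ⟨x, proj_of_notMem hx⟩

lemma image_proj_self (hK : K.Nonempty) : proj K '' K = {point K} := by
  rw [image_congr fun _ hx => proj_of_mem hx, hK.image_const]

/-- Saturated sets of the canonical map, that is, sets which either contain `K` or do not meet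
it. -/
def IsSaturated (K s : Set X) : Prop := Disjoint s K ∨ K ⊆ s

lemma IsSaturated.preimage_image {s : Set X} (hs : IsSaturated K s) :
    proj K ⁻¹' (proj K '' s) = s := by
  refine Subset.antisymm ?_ (subset_preimage_image _ _)
  rintro x ⟨y, hy, hxy⟩
  by_cases hyK : y ∈ K
  · exact hs.resolve_left (fun h => h.ne_of_mem hy hyK rfl)
      (proj_eq_point_iff.1 (hxy.symm.trans (proj_of_mem hyK)))
  · exact eq_of_proj_eq hyK hxy ▸ hy

/-- A section of the canonical map; it sends `x₀` to an arbitrary point of `K`. -/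
noncomputable def sec (hK : K.Nonempty) : Collapse K → X :=
  fun p => Option.elim (show Option ↥(Kᶜ) from p) hK.some Subtype.val

lemma sec_point_mem (hK : K.Nonempty) : sec hK (point K) ∈ K := hK.some_mem

lemma sec_proj (hK : K.Nonempty) (hx : x ∉ K) : sec hK (proj K x) = x := by
  rw [proj_of_notMem hx]
  rfl

lemma proj_sec (hK : K.Nonempty) (p : Collapse K) : proj K (sec hK p) = p := by
  obtain ⟨x, rfl⟩ := surjective_proj hK p
  by_cases hx : x ∈ K
  · rw [proj_of_mem hx, proj_of_mem (sec_point_mem hK)]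
  · rw [sec_proj hK hx]

lemma comp_sec_proj {β : Type*} (hK : K.Nonempty) {v : X → β} {c : β} (hv : ∀ x ∈ K, v x = c)
    (x : X) : v (sec hK (proj K x)) = v x := by
  by_cases hx : x ∈ K
  · rw [proj_of_mem hx, hv _ (sec_point_mem hK), hv x hx]
  · rw [sec_proj hK hx]

section Topology

variable [TopologicalSpace X]

lemma disjoint_of_closure_inter_eq_empty {s : Set X} (h : closure s ∩ K = ∅) : Disjoint s K :=
  (disjoint_iff_inter_eq_empty.2 h).mono_left subset_closure

lemma isOpen_collapse_iff {s : Set (Collapse K)} : IsOpen s ↔ IsOpen (proj K ⁻¹' s) :=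
  isOpen_coinduced

lemma isClosed_collapse_iff {s : Set (Collapse K)} : IsClosed s ↔ IsClosed (proj K ⁻¹' s) := by
  rw [← isOpen_compl_iff, isOpen_collapse_iff, preimage_compl, isOpen_compl_iff]

lemma continuous_proj : Continuous (proj K) := continuous_coinduced_rng

lemma isQuotientMap_proj (hK : K.Nonempty) : IsQuotientMap (proj K) :=
  ⟨⟨rfl⟩, surjective_proj hK⟩

lemma IsSaturated.isOpen_image {s : Set X} (hs : IsSaturated K s) (ho : IsOpen s) :
    IsOpen (proj K '' s) := by
  rwa [isOpen_collapse_iff, hs.preimage_image]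

lemma isClosedMap_proj (hK : IsClosed K) : IsClosedMap (proj K) := by
  intro C hC
  rw [isClosed_collapse_iff]
  by_cases h : Disjoint C K
  · rwa [IsSaturated.preimage_image (Or.inl h)]
  · obtain ⟨x, hxC, hxK⟩ := Set.not_disjoint_iff.1 h
    have himage : proj K '' C = proj K '' (C ∪ K) := by
      refine Subset.antisymm (image_mono subset_union_left) ?_
      rintro _ ⟨y, hy | hy, rfl⟩
      · exact ⟨y, hy, rfl⟩
      · exact ⟨x, hxC, by rw [proj_of_mem hxK, proj_of_mem hy]⟩
    rw [himage, IsSaturated.preimage_image (Or.inr subset_union_right)]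
    exact hC.union hK

lemma isClosed_point (hK : IsClosed K) : IsClosed {point K} := by
  have hpre : proj K ⁻¹' {point K} = K := Set.ext fun _ => proj_eq_point_iff
  rwa [isClosed_collapse_iff, hpre]

lemma closure_image_proj (hK : IsClosed K) (s : Set X) :
    closure (proj K '' s) = proj K '' closure s :=
  (isClosedMap_proj hK).closure_image_eq_of_continuous continuous_proj s

lemma preimage_closure_image (hK : IsClosed K) {s : Set X} (hs : IsSaturated K (closure s)) :
    proj K ⁻¹' closure (proj K '' s) = closure s := by
  rw [closure_image_proj hK, hs.preimage_image]

lemma preimage_frontier_image (hK : IsClosed K) {s : Set X} (hso : IsOpen s)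
    (hs : IsSaturated K s) (hs' : IsSaturated K (closure s)) :
    proj K ⁻¹' frontier (proj K '' s) = frontier s := by
  rw [(hs.isOpen_image hso).frontier_eq, hso.frontier_eq, preimage_sdiff,
    preimage_closure_image hK hs', hs.preimage_image]

lemma isOpenEmbedding_proj (hK : IsClosed K) : IsOpenEmbedding (fun x : ↥(Kᶜ) => proj K x) := by
  refine IsOpenEmbedding.of_continuous_injective_isOpenMap
    (continuous_proj.comp continuous_subtype_val)
    (fun x y h => Subtype.ext (eq_of_proj_eq x.2 h)) fun s hs => ?_
  rw [← image_image (proj K) Subtype.val]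
  refine IsSaturated.isOpen_image (Or.inl (Set.disjoint_left.2 ?_))
    (hK.isOpen_compl.isOpenMap_subtype_val s hs)
  rintro _ ⟨x, -, rfl⟩
  exact x.2

lemma lowerSemicontinuousOn_collapse {β : Type*} [Preorder β] {u : Collapse K → β}
    {U : Set (Collapse K)} (hU : IsOpen U)
    (hu : LowerSemicontinuousOn (u ∘ proj K) (proj K ⁻¹' U)) : LowerSemicontinuousOn u U := by
  intro p hp a ha
  have hopen : IsOpen {q | q ∈ U ∧ a < u q} := by
    rw [isOpen_collapse_iff, isOpen_iff_mem_nhds]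
    rintro x ⟨hxU, hxa⟩
    have hU' : proj K ⁻¹' U ∈ 𝓝 x := (hU.preimage continuous_proj).mem_nhds hxU
    have hlt := hu x hxU a hxa
    rw [nhdsWithin_eq_nhds.2 hU'] at hlt
    filter_upwards [hlt, hU'] with y hy hyU using ⟨hyU, hy⟩
  refine mem_nhdsWithin_of_mem_nhds ?_
  filter_upwards [hopen.mem_nhds ⟨hp, ha⟩] with q hq using hq.2

lemma continuousOn_collapse_iff {β : Type*} [TopologicalSpace β] (hne : K.Nonempty)
    {f : Collapse K → β} {U : Set (Collapse K)} (hU : IsOpen U) :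
    ContinuousOn f U ↔ ContinuousOn (f ∘ proj K) (proj K ⁻¹' U) :=
  (isQuotientMap_proj hne).continuousOn_isOpen_iff hU

lemma measurableSingletonClass_collapse [T1Space X] (hK : IsClosed K) (hne : K.Nonempty) :
    MeasurableSingletonClass (Collapse K) := by
  refine ⟨fun p => IsClosed.measurableSet ?_⟩
  obtain ⟨x, rfl⟩ := surjective_proj hne p
  rw [← image_singleton]
  exact isClosedMap_proj hK {x} isClosed_singleton

end Topology

section Measurability

variable [TopologicalSpace X] [MeasurableSpace X] [BorelSpace X]

lemma measurable_proj : Measurable (proj K) := continuous_proj.measurable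

lemma measurableSet_collapse_iff (hK : IsClosed K) (hne : K.Nonempty) {s : Set (Collapse K)} :
    MeasurableSet s ↔ MeasurableSet (proj K ⁻¹' s) := by
  refine ⟨fun h => measurable_proj h, fun h => ?_⟩
  have hs : s = (fun x : ↥(Kᶜ) => proj K x) '' (Subtype.val ⁻¹' (proj K ⁻¹' s)) ∪
      (s ∩ {point K}) := by
    refine Subset.antisymm (fun p hp => ?_)
      (union_subset (image_subset_iff.2 fun _ hx => hx) inter_subset_left)
    obtain ⟨x, rfl⟩ := surjective_proj hne p
    by_cases hx : x ∈ K
    · exact Or.inr ⟨hp, proj_of_mem hx⟩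
    · exact Or.inl ⟨⟨x, hx⟩, hp, rfl⟩
  rw [hs]
  refine ((isOpenEmbedding_proj hK).measurableEmbedding.measurableSet_image.2
    (measurable_subtype_coe h)).union ?_
  rcases subset_singleton_iff_eq.1 (inter_subset_right : s ∩ {point K} ⊆ _) with h0 | h0 <;> rw [h0]
  exacts [MeasurableSet.empty, (isClosed_point hK).measurableSet]

lemma measurable_collapse_iff (hK : IsClosed K) (hne : K.Nonempty) {β : Type*} [MeasurableSpace β]
    {f : Collapse K → β} : Measurable f ↔ Measurable (f ∘ proj K) :=
  ⟨fun h => h.comp measurable_proj, fun h _ ht => (measurableSet_collapse_iff hK hne).2 (h ht)⟩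

lemma measurable_sec (hK : IsClosed K) (hne : K.Nonempty) : Measurable (sec hne) := by
  classical
  rw [measurable_collapse_iff hK hne]
  have hcomp : sec hne ∘ proj K = K.piecewise (fun _ => sec hne (point K)) id := by
    ext x
    by_cases hx : x ∈ K
    · rw [piecewise_eq_of_mem _ _ _ hx, Function.comp_apply, proj_of_mem hx]
    · rw [piecewise_eq_of_notMem _ _ _ hx, Function.comp_apply, sec_proj hne hx, id]
  rw [hcomp]
  exact Measurable.piecewise hK.measurableSet measurable_const measurable_id

lemma integral_map_proj (hK : IsClosed K) {μ : Measure X} (hμ : ∀ᵐ x ∂μ, x ∉ K)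
    (f : Collapse K → ℝ) : ∫ p, f p ∂(μ.map (proj K)) = ∫ x, f (proj K x) ∂μ := by
  have hval : MeasurableEmbedding (Subtype.val : ↥(Kᶜ) → X) :=
    MeasurableEmbedding.subtype_coe hK.measurableSet.compl
  have hμ' : (μ.comap (Subtype.val : ↥(Kᶜ) → X)).map Subtype.val = μ := by
    rw [hval.map_comap, Subtype.range_coe]
    exact Measure.restrict_eq_self_of_ae_mem hμ
  rw [← hμ', Measure.map_map measurable_proj measurable_subtype_coe, hval.integral_map]
  exact (isOpenEmbedding_proj hK).measurableEmbedding.integral_map f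

lemma integral_map_proj_dirac [T1Space X] (hK : IsClosed K) (hne : K.Nonempty) (x : X)
    (f : Collapse K → ℝ) : ∫ p, f p ∂((Measure.dirac x).map (proj K)) = f (proj K x) := by
  have := measurableSingletonClass_collapse hK hne
  rw [Measure.map_dirac' measurable_proj, integral_dirac]

end Measurability

end CollapseSpace

section Lifts

variable {X : Type*} [TopologicalSpace X] [MeasurableSpace X] {K : Set X}
  {T T' : Kernel (Collapse K) (Collapse K)} {P P' : Kernel X X}

/-- The kernel `T` on `X₀` is induced by the kernel `P` on `X`. -/
def Lifts (T : Kernel (Collapse K) (Collapse K)) (P : Kernel X X) : Prop :=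
  ∀ x, T (proj K x) = (P x).map (proj K)

namespace Lifts

lemma unique (hne : K.Nonempty) (h : Lifts T P) (h' : Lifts T' P) : T = T' := by
  ext1 p
  obtain ⟨x, rfl⟩ := surjective_proj hne p
  rw [h x, h' x]

variable [BorelSpace X]

lemma comp (h : Lifts T P) (h' : Lifts T' P') : Lifts (T ∘ₖ T') (P ∘ₖ P') := by
  intro x
  ext s hs
  rw [Measure.map_apply measurable_proj hs, Kernel.comp_apply' _ _ _ hs,
    Kernel.comp_apply' _ _ _ (measurable_proj hs), h' x,
    lintegral_map (T.measurable_coe hs) measurable_proj]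
  refine lintegral_congr fun y => ?_
  rw [h y, Measure.map_apply measurable_proj hs]

lemma isBoundaryKernel (hne : K.Nonempty) (h : Lifts T P) {U : Set (Collapse K)} {V : Set X}
    (hUV : proj K ⁻¹' U = V) (hf : proj K ⁻¹' frontier U = frontier V)
    (hP : IsBoundaryKernel V P) : IsBoundaryKernel U T := by
  subst hUV
  refine ⟨fun p hp => ?_, fun p hp => ?_⟩ <;> obtain ⟨x, rfl⟩ := surjective_proj hne p
  · rw [h x, Measure.map_apply measurable_proj isClosed_frontier.measurableSet.compl,
      preimage_compl, hf]
    exact hP.1 x hp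
  · rw [h x, hP.2 x hp, Measure.map_dirac' measurable_proj]

lemma integral_eq (h : Lifts T P) {f : Collapse K → ℝ} (hf : Measurable f) (x : X) :
    ∫ p, f p ∂(T (proj K x)) = ∫ y, f (proj K y) ∂(P x) := by
  rw [h x, integral_map measurable_proj.aemeasurable hf.aestronglyMeasurable]

end Lifts

variable [BorelSpace X]

/-- The kernel on `X₀` induced by the kernel `P` on `X`. This is meaningful only if the measures of
`P` at the points of `K` have the same image in `X₀`. -/
noncomputable def descend (hK : IsClosed K) (hne : K.Nonempty) (P : Kernel X X) :
    Kernel (Collapse K) (Collapse K) :=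
  (P.map (proj K)).comap (sec hne) (measurable_sec hK hne)

lemma lifts_descend (hK : IsClosed K) (hne : K.Nonempty) {μ : Measure (Collapse K)}
    (hP : ∀ x ∈ K, (P x).map (proj K) = μ) : Lifts (descend hK hne P) P := by
  intro x
  rw [descend, Kernel.comap_apply, Kernel.map_apply _ measurable_proj]
  exact comp_sec_proj hne hP x

end Lifts

section CollapsedSets

variable {X : Type*} [TopologicalSpace X] [MeasurableSpace X] {𝒱 : Set (Set X)}
  {H : Set X → Kernel X X} {K W₀ : Set X} {σ : ℝ → Measure X} {s t : ℝ} {x y : X} {f : X → ℝ}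
  {c : ℝ} {N W : Set (Collapse K)}

local notation "g" => gFun 𝒱 H K W₀
local notation "A" => ASet 𝒱 H K W₀
local notation "S" => SSet 𝒱 H K W₀
local notation "O" => OSet 𝒱 H K W₀
local notation "T" => AKernel 𝒱 H K W₀
local notation "U" => USet 𝒱 H K W₀

lemma point_mem_USet (t : ℝ) : point K ∈ U t := mem_insert _ _

lemma USet_mem_VZero (ht : t ∈ Ioo (0 : ℝ) 1) : U t ∈ VZero 𝒱 H K W₀ := Or.inl ⟨t, ht, rfl⟩

lemma IsSphereFamily.nonempty_SSet (hσ : IsSphereFamily 𝒱 H K W₀ σ) (ht : t ∈ Ioo (0 : ℝ) 1) :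
    (S t).Nonempty := by
  have := (hσ t ht).1
  exact (hσ.ae_mem ht).exists

namespace DarningData

lemma insert_point_image_sdiff (d : DarningData 𝒱 H K W₀) :
    insert (point K) (proj K '' (W₀ \ K)) = proj K '' W₀ := by
  rw [← singleton_union, ← image_proj_self d.nonempty, ← image_union, union_sdiff_cancel d.subset]

lemma preimage_image_W (d : DarningData 𝒱 H K W₀) : proj K ⁻¹' (proj K '' W₀) = W₀ :=
  IsSaturated.preimage_image (Or.inr d.subset)

lemma isOpen_image_W (d : DarningData 𝒱 H K W₀) : IsOpen (proj K '' W₀) :=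
  IsSaturated.isOpen_image (Or.inr d.subset) d.isOpen_W

variable [T2Space X]

lemma closure_subset_preimage (d : DarningData 𝒱 H K W₀) {V : Set X}
    (h : closure (proj K '' V) ⊆ N) : closure V ⊆ proj K ⁻¹' N := by
  rwa [closure_image_proj d.isClosed_K, image_subset_iff] at h

variable [LocallyCompactSpace X] [SecondCountableTopology X] [BorelSpace X]

lemma USet_eq_image (d : DarningData 𝒱 H K W₀) (ht : 0 < t) : U t = proj K '' O t := by
  rw [d.OSet_eq_union ht, image_union, image_proj_self d.nonempty, union_singleton, USet]

lemma isSaturated_OSet (d : DarningData 𝒱 H K W₀) (ht : 0 < t) : IsSaturated K (O t) :=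
  Or.inr (d.subset_OSet ht)

lemma isSaturated_closure_OSet (d : DarningData 𝒱 H K W₀) (ht : 0 < t) :
    IsSaturated K (closure (O t)) := Or.inr ((d.subset_OSet ht).trans subset_closure)

lemma preimage_USet (d : DarningData 𝒱 H K W₀) (ht : 0 < t) : proj K ⁻¹' U t = O t := by
  rw [d.USet_eq_image ht, (d.isSaturated_OSet ht).preimage_image]

lemma preimage_closure_USet (d : DarningData 𝒱 H K W₀) (ht : 0 < t) :
    proj K ⁻¹' closure (U t) = closure (O t) := by
  rw [d.USet_eq_image ht, preimage_closure_image d.isClosed_K (d.isSaturated_closure_OSet ht)]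

lemma preimage_frontier_USet (d : DarningData 𝒱 H K W₀) (ht : 0 < t) :
    proj K ⁻¹' frontier (U t) = frontier (O t) := by
  rw [d.USet_eq_image ht, preimage_frontier_image d.isClosed_K (d.isOpen_OSet t)
    (d.isSaturated_OSet ht) (d.isSaturated_closure_OSet ht)]

lemma isOpen_USet (d : DarningData 𝒱 H K W₀) (ht : 0 < t) : IsOpen (U t) := by
  rw [isOpen_collapse_iff, d.preimage_USet ht]
  exact d.isOpen_OSet t

lemma USet_subset_image_W (d : DarningData 𝒱 H K W₀) (ht : 0 < t) : U t ⊆ proj K '' W₀ := by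
  rw [d.USet_eq_image ht]
  exact image_mono fun _ hx => hx.1

lemma le_of_USet_subset (d : DarningData 𝒱 H K W₀) (hσ : IsSphereFamily 𝒱 H K W₀ σ)
    (hs : s ∈ Ioo (0 : ℝ) 1) (ht : t ∈ Ioo (0 : ℝ) 1) (h : U s ⊆ U t) : s ≤ t := by
  by_contra! hts
  obtain ⟨x, hx⟩ := hσ.nonempty_SSet ht
  have hO : O s ⊆ O t := by
    rw [← d.preimage_USet hs.1, ← d.preimage_USet ht.1]
    exact preimage_mono h
  exact (hO (ASet_subset_OSet (SSet_subset_ASet hts hx))).2.ne hx.2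

-- On the compact part of `closure W₀` outside a neighborhood of `K`, `g` has a positive minimum.
lemma exists_closure_USet_subset (d : DarningData 𝒱 H K W₀) (hN : IsOpen N) (hp : point K ∈ N) :
    ∃ t ∈ Ioo (0 : ℝ) 1, closure (U t) ⊆ N := by
  have hKN : K ⊆ proj K ⁻¹' N := fun x hx => by rwa [mem_preimage, proj_of_mem hx]
  have hcompact : IsCompact (closure W₀ \ proj K ⁻¹' N) :=
    d.regular.2.1.diff (hN.preimage continuous_proj)
  have hpos : ∀ x ∈ closure W₀ \ proj K ⁻¹' N, 0 < g x := fun x hx => by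
    by_cases hxW : x ∈ W₀
    · exact d.pos x ⟨hxW, fun h => hx.2 (hKN h)⟩
    · rw [d.gFun_eq_one (d.isOpen_W.frontier_eq.superset ⟨hx.1, hxW⟩)]
      exact one_pos
  obtain ⟨c, hc0, hc⟩ :=
    hcompact.exists_forall_le' (a := 0) (d.continuousOn_gFun.mono sdiff_subset) hpos
  obtain ⟨t, ht0, ht⟩ := exists_between (lt_min hc0 one_pos)
  obtain ⟨htc, ht1⟩ := lt_min_iff.1 ht
  refine ⟨t, ⟨ht0, ht1⟩, ?_⟩
  rw [d.USet_eq_image ht0, closure_image_proj d.isClosed_K, image_subset_iff]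
  intro x hx
  obtain ⟨hxW, hxg⟩ := d.closure_OSet_subset ht1 hx
  by_contra hxN
  exact (hxg.trans_lt htc).not_ge (hc x ⟨subset_closure hxW, hxN⟩)

lemma exists_mem_VZero (d : DarningData 𝒱 H K W₀) (hN : IsOpen N) {p : Collapse K} (hp : p ∈ N) :
    ∃ W ∈ VZero 𝒱 H K W₀, p ∈ W ∧ closure W ⊆ N := by
  obtain ⟨x, rfl⟩ := surjective_proj d.nonempty p
  by_cases hx : x ∈ K
  · rw [proj_of_mem hx] at hp ⊢
    obtain ⟨t, ht, hsub⟩ := d.exists_closure_USet_subset hN hp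
    exact ⟨U t, USet_mem_VZero ht, point_mem_USet t, hsub⟩
  · have hopen : IsOpen (proj K ⁻¹' N \ K) := (hN.preimage continuous_proj).sdiff d.isClosed_K
    obtain ⟨V, hV, hxV, hVN⟩ := exists_mem_basis d.family.isBasis
      (eventually_smallSets_closure_subset (hopen.mem_nhds ⟨hp, hx⟩))
    have hVK : closure V ∩ K = ∅ :=
      disjoint_iff_inter_eq_empty.1 (Set.disjoint_left.2 fun y hy => (hVN hy).2)
    refine ⟨proj K '' V, Or.inr ⟨V, hV, hVK, rfl⟩, ⟨x, hxV, rfl⟩, ?_⟩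
    rw [closure_image_proj d.isClosed_K, image_subset_iff]
    exact fun y hy => (hVN hy).1

lemma isOpen_of_mem_VZero (d : DarningData 𝒱 H K W₀) (hW : W ∈ VZero 𝒱 H K W₀) : IsOpen W := by
  rcases hW with ⟨t, ht, rfl⟩ | ⟨V, hV, hVK, rfl⟩
  · exact d.isOpen_USet ht.1
  · exact IsSaturated.isOpen_image (Or.inl (disjoint_of_closure_inter_eq_empty hVK))
      (d.family.isOpen hV)

lemma isCompact_closure_of_mem_VZero (d : DarningData 𝒱 H K W₀) (hW : W ∈ VZero 𝒱 H K W₀) :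
    IsCompact (closure W) := by
  rcases hW with ⟨t, ht, rfl⟩ | ⟨V, hV, -, rfl⟩
  · rw [d.USet_eq_image ht.1, closure_image_proj d.isClosed_K]
    exact (d.isCompact_closure_OSet t).image continuous_proj
  · rw [closure_image_proj d.isClosed_K]
    exact (d.family.isCompact_closure V hV).image continuous_proj

lemma isTopologicalBasis_VZero (d : DarningData 𝒱 H K W₀) :
    TopologicalSpace.IsTopologicalBasis (VZero 𝒱 H K W₀) := by
  refine TopologicalSpace.isTopologicalBasis_of_isOpen_of_nhds
    (fun W hW => d.isOpen_of_mem_VZero hW) fun p N hp hN => ?_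
  obtain ⟨W, hW, hpW, hWN⟩ := d.exists_mem_VZero hN hp
  exact ⟨W, hW, hpW, subset_closure.trans hWN⟩

lemma isLocalChoice_VZero (d : DarningData 𝒱 H K W₀) (hN : IsOpen N) :
    IsLocalChoice (VZero 𝒱 H K W₀) N (fullChoice (VZero 𝒱 H K W₀) N) := by
  refine fun p hp => ⟨subset_rfl, fun M hM => ?_⟩
  obtain ⟨M', hM', hM'o, hpM'⟩ := mem_nhds_iff.1 hM
  obtain ⟨W, hW, hpW, hWN⟩ := d.exists_mem_VZero (hN.inter hM'o) ⟨hp, hpM'⟩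
  exact ⟨W, ⟨hW, hWN.trans inter_subset_left, hpW⟩,
    subset_closure.trans (hWN.trans (inter_subset_right.trans hM'))⟩

lemma integral_AKernel (d : DarningData 𝒱 H K W₀) (ht : t ∈ Ioo (0 : ℝ) 1)
    (hf : IsBddMeasurable f) (hfK : ∀ x ∈ K, f x = c) (hx : x ∈ A t) :
    ∫ y, f y ∂(T t x) = ∫ y in S t, f y ∂(T t x) + (1 - g x / t) * c := by
  have := d.isMarkovKernel ht
  have hsub : ∫ y, (f y - c) ∂(T t x) = ∫ y in S t, (f y - c) ∂(T t x) := by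
    rw [← integral_indicator (d.measurableSet_SSet t)]
    refine integral_congr_ae ?_
    filter_upwards [d.ae_mem_frontier_ASet ht hx] with y hy
    by_cases hyS : y ∈ S t
    · rw [indicator_of_mem hyS]
    · have hyK : y ∈ K := (d.frontier_ASet_subset hy).resolve_left
        fun h => hyS (d.frontier_OSet_subset ht.1 ht.2 h)
      rw [indicator_of_notMem hyS, hfK y hyK, sub_self]
  rw [integral_sub (hf.integrable _) (integrable_const _),
    integral_sub (hf.integrable _) (integrable_const _), setIntegral_const, integral_const,
    probReal_univ, d.measureReal_SSet ht hx, smul_eq_mul, smul_eq_mul] at hsub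
  linear_combination hsub

end DarningData

end CollapsedSets

section DarnedFamily

lemma IsBoundaryKernel.comp_self {X : Type*} [TopologicalSpace X] [MeasurableSpace X]
    {P : Kernel X X} {V : Set X} (hV : IsOpen V) (hP : IsBoundaryKernel V P) : P ∘ₖ P = P := by
  ext x s hs
  rw [Kernel.comp_apply' _ _ _ hs]
  by_cases hx : x ∈ V
  · rw [← lintegral_indicator_one hs]
    refine lintegral_congr_ae ?_
    filter_upwards [hP.ae_mem_frontier hx] with y hy
    rw [hP.2 y (hV.frontier_eq.subset hy).2, Measure.dirac_apply' _ hs]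
  · rw [hP.2 x hx, lintegral_dirac' _ (P.measurable_coe hs), hP.2 x hx]

lemma lowerSemicontinuousOn_ofReal_sec {X : Type*} [TopologicalSpace X] {K : Set X}
    (hne : K.Nonempty) {v : X → ℝ} {U : Set (Collapse K)} (hU : IsOpen U)
    (hv : LowerSemicontinuousOn v (proj K ⁻¹' U))
    (hsec : ∀ x ∈ proj K ⁻¹' U, v (sec hne (proj K x)) = v x) :
    LowerSemicontinuousOn (fun p => ENNReal.ofReal (v (sec hne p))) U := by
  refine lowerSemicontinuousOn_collapse hU fun x hx a ha => ?_
  simp only [Function.comp_apply, hsec x hx] at ha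
  have hlsc : LowerSemicontinuousOn (fun x => ENNReal.ofReal (v x)) (proj K ⁻¹' U) :=
    ENNReal.continuous_ofReal.comp_lowerSemicontinuousOn hv fun _ _ => ENNReal.ofReal_le_ofReal
  filter_upwards [hlsc x hx a ha, self_mem_nhdsWithin] with y hya hy
  simpa only [Function.comp_apply, hsec y hy] using hya

lemma Lifts.lintegral_ofReal_sec_le {X : Type*} [TopologicalSpace X] [MeasurableSpace X]
    [BorelSpace X] {K : Set X} {T : Kernel (Collapse K) (Collapse K)} {P : Kernel X X}
    [IsMarkovKernel P] (hT : Lifts T P) (hK : IsClosed K) (hne : K.Nonempty) {v : X → ℝ}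
    (hv : IsBddMeasurable v) (hv0 : 0 ≤ v) {x : X} (hvx : v (sec hne (proj K x)) = v x)
    (hvP : ∀ᵐ y ∂(P x), v (sec hne (proj K y)) = v y) (hle : ∫ y, v y ∂(P x) ≤ v x) :
    ∫⁻ p, ENNReal.ofReal (v (sec hne p)) ∂(T (proj K x)) ≤
      ENNReal.ofReal (v (sec hne (proj K x))) := by
  have hmeas : Measurable fun p => ENNReal.ofReal (v (sec hne p)) :=
    (hv.measurable.comp (measurable_sec hK hne)).ennreal_ofReal
  calc ∫⁻ p, ENNReal.ofReal (v (sec hne p)) ∂(T (proj K x))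
    _ = ∫⁻ y, ENNReal.ofReal (v (sec hne (proj K y))) ∂(P x) := by
        rw [hT x, lintegral_map hmeas measurable_proj]
    _ = ∫⁻ y, ENNReal.ofReal (v y) ∂(P x) :=
        lintegral_congr_ae (hvP.mono fun y hy => congrArg ENNReal.ofReal hy)
    _ = ENNReal.ofReal (∫ y, v y ∂(P x)) :=
        (ofReal_integral_eq_lintegral_ofReal (hv.integrable _) (ae_of_all _ hv0)).symm
    _ ≤ ENNReal.ofReal (v (sec hne (proj K x))) := hvx ▸ ENNReal.ofReal_le_ofReal hle

variable {X : Type*} [TopologicalSpace X] [MeasurableSpace X] {𝒱 : Set (Set X)}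
  {H : Set X → Kernel X X} {K W₀ : Set X} {σ : ℝ → Measure X} {s t : ℝ} {x y : X} {u v : X → ℝ}
  {c : ℝ} {N W : Set (Collapse K)}
  {H₀ : Set (Collapse K) → Kernel (Collapse K) (Collapse K)}

local notation "g" => gFun 𝒱 H K W₀
local notation "A" => ASet 𝒱 H K W₀
local notation "S" => SSet 𝒱 H K W₀
local notation "O" => OSet 𝒱 H K W₀
local notation "T" => AKernel 𝒱 H K W₀
local notation "Q" => darnMeasure 𝒱 H K W₀ σ
local notation "U" => USet 𝒱 H K W₀

/-- Positive bounded functions on `X` which are superharmonic on `W₀ ∖ K` and are equal to their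
maximum `c` on all of `K`. They induce positive hyperharmonic functions on
`{x₀} ∪ (W₀ ∖ K)`. -/
structure IsCappedSuperharmonic (𝒱 : Set (Set X)) (H : Set X → Kernel X X) (K W₀ : Set X)
    (v : X → ℝ) (c : ℝ) : Prop where
  isBddMeasurable : IsBddMeasurable v
  nonneg : 0 ≤ v
  le (x : X) : v x ≤ c
  eq_of_mem : ∀ x ∈ K, v x = c
  lowerSemicontinuousOn : LowerSemicontinuousOn v W₀
  isSuperharmonicAt : ∀ x ∈ W₀ \ K, IsSuperharmonicAt 𝒱 H v x

lemma IsCappedSuperharmonic.integral_le (hv : IsCappedSuperharmonic 𝒱 H K W₀ v c)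
    (μ : Measure X) [IsProbabilityMeasure μ] : ∫ y, v y ∂μ ≤ c := by
  simpa using integral_mono (hv.isBddMeasurable.integrable μ) (integrable_const c) hv.le

variable [T2Space X] [LocallyCompactSpace X] [SecondCountableTopology X] [BorelSpace X]

namespace DarningData

lemma isCappedSuperharmonic_min (d : DarningData 𝒱 H K W₀)
    (hu : IsBddSuperharmonic H (fullChoice 𝒱 W₀) W₀ u) (hu0 : 0 ≤ u) (hc : 0 ≤ c) :
    IsCappedSuperharmonic 𝒱 H K W₀ (fun z => min (u z + c * (1 - g z)) c) c := by
  have hbdd : IsBddMeasurable fun z => c * (1 - g z) :=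
    (IsBddMeasurable.const c).mul ((IsBddMeasurable.const 1).sub d.isBddMeasurable_gFun)
  have hcont : ContinuousOn (fun z => c * (1 - g z)) W₀ :=
    continuousOn_const.mul (continuousOn_const.sub (d.continuousOn_gFun.mono subset_closure))
  have hharm : IsHarmonic 𝒱 H (W₀ \ K) fun z => c * (1 - g z) :=
    ((IsHarmonic.const d.family _ c).add d.family (d.isHarmonic_gFun.const_mul (-c))).congr
      d.family fun z _ => by ring
  have husup : ∀ z ∈ W₀, IsSuperharmonicAt 𝒱 H u z := fun z hz => by
    filter_upwards [eventually_smallSets_closure_subset (d.isOpen_W.mem_nhds hz)]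
      with W hW hW𝒱 hzW using hu.integral_le z hz W ⟨hW𝒱, hW, hzW⟩
  exact {
    isBddMeasurable := (hu.isBddMeasurable.add hbdd).min (IsBddMeasurable.const c)
    nonneg := fun z =>
      le_min (add_nonneg (hu0 z) (mul_nonneg hc (sub_nonneg.2 d.gFun_le_one))) hc
    le := fun z => min_le_right _ _
    eq_of_mem := fun z hz => by
      rw [d.gFun_eq_zero hz, sub_zero, mul_one]
      exact min_eq_right (le_add_of_nonneg_left (hu0 z))
    lowerSemicontinuousOn :=
      (hu.lowerSemicontinuousOn.add hcont.lowerSemicontinuousOn).inf lowerSemicontinuousOn_const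
    isSuperharmonicAt := fun z hz =>
      ((husup z hz.1).add d.family hu.isBddMeasurable hbdd
        (hharm.isHarmonicAt d.regular_sdiff.1 hz).isSuperharmonicAt).min d.family
        (hu.isBddMeasurable.add hbdd) (IsBddMeasurable.const c)
        (isSuperharmonicAt_const d.family c z) }

-- Points with different values of `g` are separated by `1 - g`. If `g x = g y > 0`, then adding a
-- large multiple of `1 - g` to a function that separates `x` and `y` makes it large on `K`, so that
-- it can be cut off there without changing it at `x` and `y`.
lemma exists_isCappedSuperharmonic_ne (d : DarningData 𝒱 H K W₀) (hx : x ∈ W₀) (hy : y ∈ W₀)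
    (hxy : proj K x ≠ proj K y) :
    ∃ v c, IsCappedSuperharmonic 𝒱 H K W₀ v c ∧ v x ≠ v y := by
  by_cases hgxy : g x = g y
  · have hgx : 0 < g x := by
      by_cases hxK : x ∈ K
      · have hyK : y ∉ K := fun h => hxy (by rw [proj_of_mem hxK, proj_of_mem h])
        exact hgxy ▸ d.pos y ⟨hy, hyK⟩
      · exact d.pos x ⟨hx, hxK⟩
    obtain ⟨u, hu, hu0, hne⟩ := d.isPSet.isSeparatingChoice.exists_isBddSuperharmonic d.family hx hy
      (ne_of_apply_ne _ hxy)
    obtain ⟨C, hC⟩ := hu.isBddMeasurable.bdd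
    have hC0 : 0 ≤ C := (abs_nonneg _).trans (hC x)
    have hcut : ∀ z, g z = g x →
        min (u z + C / g x * (1 - g z)) (C / g x) = u z + C / g x * (1 - g x) := by
      intro z hz
      have hCg : C / g x * g x = C := div_mul_cancel₀ _ hgx.ne'
      rw [hz]
      exact min_eq_left (by linarith [le_of_abs_le (hC z)])
    refine ⟨_, _, d.isCappedSuperharmonic_min hu hu0 (div_nonneg hC0 hgx.le), ?_⟩
    rw [hcut x rfl, hcut y hgxy.symm]
    exact fun h => hne (add_right_cancel h)
  · have hzero : IsBddSuperharmonic H (fullChoice 𝒱 W₀) W₀ (fun _ => 0) :=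
      ⟨IsBddMeasurable.const 0, lowerSemicontinuousOn_const, by simp⟩
    have hmin : ∀ z, min (0 + 1 * (1 - g z)) 1 = 1 - g z := fun z => by
      rw [zero_add, one_mul, min_eq_left (sub_le_self _ gFun_nonneg)]
    refine ⟨_, _, d.isCappedSuperharmonic_min hzero le_rfl zero_le_one, ?_⟩
    rw [hmin, hmin]
    exact fun h => hgxy (sub_right_injective h)

lemma integral_darnMeasure_le (d : DarningData 𝒱 H K W₀) (hσ : IsSphereFamily 𝒱 H K W₀ σ)
    (ht : t ∈ Ioo (0 : ℝ) 1) (hv : IsCappedSuperharmonic 𝒱 H K W₀ v c) (hx : x ∈ O t) :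
    ∫ y, v y ∂(Q t x) ≤ v x := by
  have := (hσ t ht).1
  by_cases hxK : x ∈ K
  · rw [darnMeasure_of_mem_K d ht hxK, hv.eq_of_mem x hxK]
    exact hv.integral_le _
  · have hxA : x ∈ A t := ⟨⟨hx.1, hxK⟩, hx.2⟩
    have hclosure : closure (A t) ⊆ W₀ := (closure_mono ASet_subset_OSet).trans
      fun y hy => (d.closure_OSet_subset ht.2 hy).1
    calc ∫ y, v y ∂(Q t x)
      _ = ∫ y in S t, v y ∂(T t x) + (1 - g x / t) * ∫ y, v y ∂(σ t) :=
          d.integral_darnMeasure hσ ht hv.isBddMeasurable hx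
      _ ≤ ∫ y in S t, v y ∂(T t x) + (1 - g x / t) * c := by
          gcongr
          exacts [one_sub_div_nonneg_of_mem_OSet ht.1 hx, hv.integral_le _]
      _ = ∫ y, v y ∂(T t x) := (d.integral_AKernel ht hv.isBddMeasurable hv.eq_of_mem hxA).symm
      _ ≤ v x := (d.isDirichletKernel ht).integral_le d.family d.isPSet
          (ASet_subset.trans sdiff_subset) (d.regular_ASet ht.1 ht.2) hv.isBddMeasurable
          (hv.lowerSemicontinuousOn.mono hclosure)
          (fun y hy => hv.isSuperharmonicAt y (ASet_subset hy)) hxA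

end DarningData

/-- The kernels `H₀ V`, `V ∈ 𝒱₀`, are induced by the kernels `H V` and the darned kernels. -/
structure IsDarned (d : DarningData 𝒱 H K W₀) (σ : ℝ → Measure X)
    (H₀ : Set (Collapse K) → Kernel (Collapse K) (Collapse K)) : Prop where
  agree : ∀ V ∈ 𝒱, closure V ∩ K = ∅ → Lifts (H₀ (proj K '' V)) (H V)
  darned : ∀ t ∈ Ioo (0 : ℝ) 1, Lifts (H₀ (U t)) (d.darnKernel σ t)

namespace IsDarned

variable {d : DarningData 𝒱 H K W₀}

lemma isPosHyperharmonic (hd : IsDarned d σ H₀) (hσ : IsSphereFamily 𝒱 H K W₀ σ)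
    (hv : IsCappedSuperharmonic 𝒱 H K W₀ v c) :
    IsPosHyperharmonic H₀ (fullChoice (VZero 𝒱 H K W₀) (proj K '' W₀)) (proj K '' W₀)
      (fun p => ENNReal.ofReal (v (sec d.nonempty p))) := by
  have hsec : ∀ x, v (sec d.nonempty (proj K x)) = v x := comp_sec_proj d.nonempty hv.eq_of_mem
  refine ⟨lowerSemicontinuousOn_ofReal_sec d.nonempty d.isOpen_image_W
    (d.preimage_image_W.symm ▸ hv.lowerSemicontinuousOn) fun x _ => hsec x, ?_⟩
  rintro p - W ⟨hW, hWc, hpW⟩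
  obtain ⟨x, rfl⟩ := surjective_proj d.nonempty p
  rcases hW with ⟨t, ht, rfl⟩ | ⟨V, hV, hVK, rfl⟩
  · have := d.isMarkovKernel_darnKernel hσ ht
    exact (hd.darned t ht).lintegral_ofReal_sec_le d.isClosed_K d.nonempty hv.isBddMeasurable
      hv.nonneg (hsec x) (ae_of_all _ hsec)
      (d.integral_darnMeasure_le hσ ht hv ((d.preimage_USet ht.1).subset hpW))
  · have := d.family.isMarkovKernel hV
    have hVW : closure V ⊆ W₀ := (d.closure_subset_preimage hWc).trans d.preimage_image_W.subset
    have hVK' := disjoint_of_closure_inter_eq_empty hVK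
    exact (hd.agree V hV hVK).lintegral_ofReal_sec_le d.isClosed_K d.nonempty hv.isBddMeasurable
      hv.nonneg (hsec x) (ae_of_all _ hsec)
      (d.family.integral_le hV hv.isBddMeasurable (hv.lowerSemicontinuousOn.mono hVW)
        (fun y hy => hv.isSuperharmonicAt y
          ⟨hVW (subset_closure hy), fun hyK => hVK'.ne_of_mem hy hyK rfl⟩) x)

lemma isPSet_image_W (hd : IsDarned d σ H₀) (hσ : IsSphereFamily 𝒱 H K W₀ σ) :
    IsPSet (VZero 𝒱 H K W₀) H₀ (proj K '' W₀) := by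
  refine ⟨d.isOpen_image_W, ?_⟩
  rintro _ ⟨x, hx, rfl⟩ _ ⟨y, hy, rfl⟩ hxy
  obtain ⟨v, c, hv, hne⟩ := d.exists_isCappedSuperharmonic_ne hx hy hxy
  refine ⟨_, hd.isPosHyperharmonic hσ hv, ?_⟩
  rwa [comp_sec_proj d.nonempty hv.eq_of_mem, comp_sec_proj d.nonempty hv.eq_of_mem, ne_eq,
    ENNReal.ofReal_eq_ofReal_iff (hv.nonneg x) (hv.nonneg y)]

lemma isPosHyperharmonic_of_disjoint (hd : IsDarned d σ H₀) {V : Set X} (hV : IsOpen V)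
    (hVK : Disjoint V K) (hv : IsBddSuperharmonic H (fullChoice 𝒱 V) V v) (hv0 : 0 ≤ v) :
    IsPosHyperharmonic H₀ (fullChoice (VZero 𝒱 H K W₀) (proj K '' V)) (proj K '' V)
      (fun p => ENNReal.ofReal (v (sec d.nonempty p))) := by
  have hpre : proj K ⁻¹' (proj K '' V) = V := IsSaturated.preimage_image (Or.inl hVK)
  have hsec : ∀ x ∈ V, v (sec d.nonempty (proj K x)) = v x := fun x hx =>
    congrArg v (sec_proj d.nonempty (Set.disjoint_left.1 hVK hx))
  refine ⟨lowerSemicontinuousOn_ofReal_sec d.nonempty (IsSaturated.isOpen_image (Or.inl hVK) hV)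
    (hpre.symm ▸ hv.lowerSemicontinuousOn) fun x hx => hsec x (hpre.subset hx), ?_⟩
  rintro _ ⟨x, hx, rfl⟩ W ⟨hW, hWc, hxW⟩
  rcases hW with ⟨t, -, rfl⟩ | ⟨V', hV', hVK', rfl⟩
  · obtain ⟨y, hy, hyp⟩ := hWc (subset_closure (point_mem_USet t))
    exact (hVK.ne_of_mem hy (proj_eq_point_iff.1 hyp) rfl).elim
  · have := d.family.isMarkovKernel hV'
    have hsub : closure V' ⊆ V := (d.closure_subset_preimage hWc).trans hpre.subset
    have hxV' : x ∈ V' :=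
      (IsSaturated.preimage_image (Or.inl (disjoint_of_closure_inter_eq_empty hVK'))).subset hxW
    refine (hd.agree V' hV' hVK').lintegral_ofReal_sec_le d.isClosed_K d.nonempty
      hv.isBddMeasurable hv0 (hsec x hx) ?_ (hv.integral_le x hx V' ⟨hV', hsub, hxV'⟩)
    filter_upwards [(d.family.isBoundaryKernel V' hV').ae_mem_frontier hxV'] with y hy
    exact hsec y (hsub (frontier_subset_closure hy))

lemma isPSet_image_of_disjoint (hd : IsDarned d σ H₀) {V : Set X} (hV : IsPSet 𝒱 H V)
    (hVK : Disjoint V K) : IsPSet (VZero 𝒱 H K W₀) H₀ (proj K '' V) := by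
  refine ⟨IsSaturated.isOpen_image (Or.inl hVK) hV.1, ?_⟩
  rintro _ ⟨x, hx, rfl⟩ _ ⟨y, hy, rfl⟩ hxy
  obtain ⟨v, hv, hv0, hne⟩ := hV.isSeparatingChoice.exists_isBddSuperharmonic d.family hx hy
    (ne_of_apply_ne _ hxy)
  refine ⟨_, hd.isPosHyperharmonic_of_disjoint hV.1 hVK hv hv0, ?_⟩
  rwa [sec_proj d.nonempty (Set.disjoint_left.1 hVK hx),
    sec_proj d.nonempty (Set.disjoint_left.1 hVK hy), ne_eq,
    ENNReal.ofReal_eq_ofReal_iff (hv0 x) (hv0 y)]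

lemma isPSet_of_mem_VZero (hd : IsDarned d σ H₀) (hσ : IsSphereFamily 𝒱 H K W₀ σ)
    (hW : W ∈ VZero 𝒱 H K W₀) : IsPSet (VZero 𝒱 H K W₀) H₀ W := by
  rcases hW with ⟨t, ht, rfl⟩ | ⟨V, hV, hVK, rfl⟩
  · have hsub : U t ⊆ proj K '' W₀ := d.USet_subset_image_W ht.1
    refine ⟨d.isOpen_USet ht.1, fun p hp q hq hpq => ?_⟩
    obtain ⟨u, hu, hne⟩ := (hd.isPSet_image_W hσ).2 p (hsub hp) q (hsub hq) hpq
    exact ⟨u, ⟨hu.1.mono hsub, fun z hz W hW =>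
      hu.2 z (hsub hz) W ⟨hW.1, hW.2.1.trans hsub, hW.2.2⟩⟩, hne⟩
  · exact hd.isPSet_image_of_disjoint (d.family.isPSet hV) (disjoint_of_closure_inter_eq_empty hVK)

lemma comp_eq (hd : IsDarned d σ H₀) (hσ : IsSphereFamily 𝒱 H K W₀ σ)
    (hc : IsCompatible 𝒱 H K W₀ σ) {V : Set (Collapse K)} (hV : V ∈ VZero 𝒱 H K W₀)
    (hW : W ∈ VZero 𝒱 H K W₀) (hWV : W ⊆ V) : H₀ V ∘ₖ H₀ W = H₀ V := by
  rcases hV with ⟨t, ht, rfl⟩ | ⟨V, hV, hVK, rfl⟩ <;>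
    rcases hW with ⟨s, hs, rfl⟩ | ⟨V', hV', hVK', rfl⟩
  · refine Lifts.unique d.nonempty ((hd.darned t ht).comp (hd.darned s hs)) ?_
    rcases (d.le_of_USet_subset hσ hs ht hWV).eq_or_lt with rfl | hst
    · rw [(d.isBoundaryKernel_darnKernel hσ hc hs).comp_self (d.isOpen_OSet s)]
      exact hd.darned s hs
    · rw [d.darnKernel_comp_darnKernel hσ hc hs.1 hst ht.2]
      exact hd.darned t ht
  · have hV'A : V' ⊆ A t := by
      rw [ASet_eq_sdiff, ← d.preimage_USet ht.1]
      exact subset_sdiff.2 ⟨image_subset_iff.1 hWV, disjoint_of_closure_inter_eq_empty hVK'⟩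
    refine Lifts.unique d.nonempty ((hd.darned t ht).comp (hd.agree V' hV' hVK')) ?_
    rw [d.darnKernel_comp hσ ht hV' hV'A]
    exact hd.darned t ht
  · obtain ⟨y, hy, hyp⟩ := hWV (point_mem_USet s)
    exact ((disjoint_of_closure_inter_eq_empty hVK).ne_of_mem hy
      (proj_eq_point_iff.1 hyp) rfl).elim
  · have hsub : V' ⊆ V := (image_subset_iff.1 hWV).trans
      (IsSaturated.preimage_image (Or.inl (disjoint_of_closure_inter_eq_empty hVK))).subset
    refine Lifts.unique d.nonempty ((hd.agree V hV hVK).comp (hd.agree V' hV' hVK')) ?_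
    rw [d.family.comp_eq V hV V' hV' hsub]
    exact hd.agree V hV hVK

lemma isBoundaryKernel (hd : IsDarned d σ H₀) (hσ : IsSphereFamily 𝒱 H K W₀ σ)
    (hc : IsCompatible 𝒱 H K W₀ σ) (hW : W ∈ VZero 𝒱 H K W₀) : IsBoundaryKernel W (H₀ W) := by
  rcases hW with ⟨t, ht, rfl⟩ | ⟨V, hV, hVK, rfl⟩
  · exact (hd.darned t ht).isBoundaryKernel d.nonempty (d.preimage_USet ht.1)
      (d.preimage_frontier_USet ht.1) (d.isBoundaryKernel_darnKernel hσ hc ht)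
  · have hsat : IsSaturated K V := Or.inl (disjoint_of_closure_inter_eq_empty hVK)
    exact (hd.agree V hV hVK).isBoundaryKernel d.nonempty hsat.preimage_image
      (preimage_frontier_image d.isClosed_K (d.family.isOpen hV) hsat
        (Or.inl (disjoint_iff_inter_eq_empty.2 hVK))) (d.family.isBoundaryKernel V hV)

lemma isNormalBauerFamily (hd : IsDarned d σ H₀) (hσ : IsSphereFamily 𝒱 H K W₀ σ)
    (hc : IsCompatible 𝒱 H K W₀ σ) : IsNormalBauerFamily (VZero 𝒱 H K W₀) H₀ where
  isBasis := d.isTopologicalBasis_VZero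
  isCompact_closure _ hV := d.isCompact_closure_of_mem_VZero hV
  isBoundaryKernel _ hV := hd.isBoundaryKernel hσ hc hV
  comp_eq _ hV _ hW hWV := hd.comp_eq hσ hc hV hW hWV
  continuous_integral := by
    rintro _ (⟨t, ht, rfl⟩ | ⟨V, hV, hVK, rfl⟩) f hf <;>
      rw [(isQuotientMap_proj d.nonempty).continuous_iff]
    · exact (d.continuous_integral_darnMeasure hσ hc ht (hf.comp continuous_proj)).congr
        fun x => ((hd.darned t ht).integral_eq hf.measurable x).symm
    · exact (d.family.continuous_integral V hV _ (hf.comp continuous_proj)).congr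
        fun x => ((hd.agree V hV hVK).integral_eq hf.measurable x).symm
  normal := by
    rintro _ (⟨t, ht, rfl⟩ | ⟨V, hV, hVK, rfl⟩) p <;>
      obtain ⟨x, rfl⟩ := surjective_proj d.nonempty p
    · rw [hd.darned t ht x, Measure.map_apply measurable_proj MeasurableSet.univ, preimage_univ]
      exact (d.isProbabilityMeasure_darnMeasure hσ ht x).measure_univ
    · rw [hd.agree V hV hVK x, Measure.map_apply measurable_proj MeasurableSet.univ, preimage_univ]
      exact d.family.normal V hV x
  separates V hV := ⟨_, d.isLocalChoice_VZero (d.isOpen_of_mem_VZero hV),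
    (hd.isPSet_of_mem_VZero hσ hV).2⟩
  continuousOn_integral := by
    rintro W hW f hf ⟨C, hC⟩
    have hf' : IsBddMeasurable (f ∘ proj K) := ⟨hf.comp measurable_proj, C, fun x => hC _⟩
    rw [continuousOn_collapse_iff d.nonempty (d.isOpen_of_mem_VZero hW)]
    rcases hW with ⟨t, ht, rfl⟩ | ⟨V, hV, hVK, rfl⟩
    · rw [d.preimage_USet ht.1]
      exact (d.continuousOn_integral_darnMeasure_OSet hσ hc ht hf').congr
        fun x _ => (hd.darned t ht).integral_eq hf x
    · rw [IsSaturated.preimage_image (Or.inl (disjoint_of_closure_inter_eq_empty hVK))]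
      exact (d.family.continuousOn_integral V hV _ hf'.measurable hf'.bdd).congr
        fun x _ => (hd.agree V hV hVK).integral_eq hf x

end IsDarned

end DarnedFamily

section Darning

lemma exists_boundedContinuousFunction_proj_eq {X : Type*} [TopologicalSpace X] [NormalSpace X]
    {K C : Set X} (hK : IsClosed K) (hne : K.Nonempty) (hC : IsClosed C) (hKC : Disjoint K C)
    (φ : BoundedContinuousFunction X ℝ) :
    ∃ F : BoundedContinuousFunction (Collapse K) ℝ, ∀ x ∈ C, F (proj K x) = φ x := by
  obtain ⟨χ, hχ0, hχ1, hχI⟩ := exists_continuous_zero_one_of_isClosed hK hC hKC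
  have hsec : ∀ x, φ (sec hne (proj K x)) * χ (sec hne (proj K x)) = φ x * χ x :=
    comp_sec_proj (v := fun x => φ x * χ x) hne fun x hx => by
      rw [hχ0 hx, Pi.zero_apply, mul_zero]
  have hcont : Continuous fun p : Collapse K => φ (sec hne p) * χ (sec hne p) :=
    (isQuotientMap_proj hne).continuous_iff.2
      ((φ.continuous.mul χ.continuous).congr fun x => (hsec x).symm)
  refine ⟨BoundedContinuousFunction.ofNormedAddCommGroup _ hcont ‖φ‖ fun p => ?_, fun x hx => ?_⟩
  · rw [norm_mul, Real.norm_of_nonneg (hχI _).1]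
    exact (mul_le_of_le_one_right (norm_nonneg _) (hχI _).2).trans (φ.norm_coe_le_norm _)
  · rw [BoundedContinuousFunction.coe_ofNormedAddCommGroup, hsec, hχ1 hx, Pi.one_apply, mul_one]

variable {X : Type*} [TopologicalSpace X] [MeasurableSpace X] [BorelSpace X]
  {𝒱 : Set (Set X)} {H : Set X → Kernel X X} {K W₀ : Set X} {σ : ℝ → Measure X} {r t : ℝ} {x : X}
  {H₀ : Set (Collapse K) → Kernel (Collapse K) (Collapse K)} {W : Set (Collapse K)}
  {h : Collapse K → ℝ}

local notation "g" => gFun 𝒱 H K W₀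
local notation "A" => ASet 𝒱 H K W₀
local notation "S" => SSet 𝒱 H K W₀
local notation "O" => OSet 𝒱 H K W₀
local notation "T" => AKernel 𝒱 H K W₀
local notation "Q" => darnMeasure 𝒱 H K W₀ σ
local notation "U" => USet 𝒱 H K W₀

lemma IsDarning.isHarmonic_integral (hD : IsDarning 𝒱 H K W₀ σ H₀) (ht : t ∈ Ioo (0 : ℝ) 1)
    (F : BoundedContinuousFunction (Collapse K) ℝ) :
    IsHarmonic 𝒱 H (A t) fun x => ∫ p, F p ∂(H₀ (U t) (proj K x)) := by
  have hB := hD.isNormalBauerFamily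
  have hUt : U t ∈ VZero 𝒱 H K W₀ := USet_mem_VZero ht
  have hcont := hB.continuous_integral _ hUt F F.continuous
  refine ⟨(hcont.comp continuous_proj).continuousOn, fun V hV hVA x _ => ?_⟩
  have hVK : closure V ∩ K = ∅ := disjoint_iff_inter_eq_empty.1
    (Set.disjoint_left.2 fun y hy => (hVA hy).1.2)
  have hV₀ : proj K '' V ∈ VZero 𝒱 H K W₀ := Or.inr ⟨V, hV, hVK, rfl⟩
  have hsub : proj K '' V ⊆ U t :=
    (image_mono (subset_closure.trans hVA)).trans (subset_insert _ _)
  have := hB.isMarkovKernel hUt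
  have := hB.isMarkovKernel hV₀
  have hcomp := Kernel.integral_comp (κ := H₀ (proj K '' V)) (η := H₀ (U t)) (a := proj K x)
    ((IsBddMeasurable.of_boundedContinuousFunction F).integrable _)
  rw [hB.comp_eq _ hUt _ hV₀ hsub, hD.agree V hV hVK,
    integral_map measurable_proj.aemeasurable hcont.measurable.aestronglyMeasurable] at hcomp
  exact hcomp.symm

variable [T2Space X] [LocallyCompactSpace X] [SecondCountableTopology X]

namespace DarningData

open Classical in
/-- The family of kernels on `X₀` which consists of the darned kernels for the sets `U_t` and of
the kernels induced by `H V` for the other sets in `𝒱₀`. -/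
noncomputable def darnedFamily (d : DarningData 𝒱 H K W₀) (σ : ℝ → Measure X)
    (W : Set (Collapse K)) : Kernel (Collapse K) (Collapse K) :=
  descend d.isClosed_K d.nonempty
    (if h : ∃ r ∈ Ioo (0 : ℝ) 1, W = U r then d.darnKernel σ h.choose else H (proj K ⁻¹' W))

lemma isDarned_darnedFamily (d : DarningData 𝒱 H K W₀) (hσ : IsSphereFamily 𝒱 H K W₀ σ) :
    IsDarned d σ (d.darnedFamily σ) where
  agree V hV hVK := by
    have hdisj := disjoint_of_closure_inter_eq_empty hVK
    have hVU : ¬ ∃ r ∈ Ioo (0 : ℝ) 1, proj K '' V = U r := by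
      rintro ⟨r, -, hr⟩
      obtain ⟨w, hw, hwp⟩ := hr.superset (point_mem_USet r)
      exact hdisj.ne_of_mem hw (proj_eq_point_iff.1 hwp) rfl
    rw [darnedFamily, dif_neg hVU, IsSaturated.preimage_image (Or.inl hdisj)]
    refine lifts_descend _ _ (μ := Measure.dirac (point K)) fun x hx => ?_
    rw [(d.family.isBoundaryKernel V hV).2 x (Set.disjoint_right.1 hdisj hx),
      Measure.map_dirac' measurable_proj, proj_of_mem hx]
  darned t ht := by
    have hex : ∃ r ∈ Ioo (0 : ℝ) 1, U t = U r := ⟨t, ht, rfl⟩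
    have hchoose : hex.choose = t := le_antisymm
      (d.le_of_USet_subset hσ hex.choose_spec.1 ht hex.choose_spec.2.ge)
      (d.le_of_USet_subset hσ ht hex.choose_spec.1 hex.choose_spec.2.le)
    rw [darnedFamily, dif_pos hex, hchoose]
    refine lifts_descend _ _ (μ := (σ t).map (proj K)) fun x hx => ?_
    rw [d.darnKernel_apply, d.darnMeasure_of_mem_K ht hx]

lemma isDarning_darnedFamily (d : DarningData 𝒱 H K W₀) (hσ : IsSphereFamily 𝒱 H K W₀ σ)
    (hc : IsCompatible 𝒱 H K W₀ σ) : IsDarning 𝒱 H K W₀ σ (d.darnedFamily σ) where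
  agree V hV hVK x := (d.isDarned_darnedFamily hσ).agree V hV hVK x
  isNormalBauerFamily := (d.isDarned_darnedFamily hσ).isNormalBauerFamily hσ hc
  apply_point t ht := by
    obtain ⟨z, hz⟩ := d.nonempty
    rw [← proj_of_mem hz, (d.isDarned_darnedFamily hσ).darned t ht z, d.darnKernel_apply,
      d.darnMeasure_of_mem_K ht hz]

end DarningData

namespace IsDarning

lemma ae_mem_frontier_OSet (hD : IsDarning 𝒱 H K W₀ σ H₀) (d : DarningData 𝒱 H K W₀)
    (ht : t ∈ Ioo (0 : ℝ) 1) : ∀ᵐ y ∂(σ t), y ∈ frontier (O t) := by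
  have hbd := (hD.isNormalBauerFamily.isBoundaryKernel _ (USet_mem_VZero ht)).1 _
    (point_mem_USet t)
  rw [hD.apply_point t ht,
    Measure.map_apply measurable_proj isClosed_frontier.measurableSet.compl, preimage_compl,
    d.preimage_frontier_USet ht.1] at hbd
  exact mem_ae_iff.2 hbd

-- `x ↦ H_{U_t} F (x)` is continuous, harmonic on `A_t`, constant on `K` and equal to `F` on
-- `∂U_t`, so its values on `A_t` are determined.
lemma integral_eq (hD : IsDarning 𝒱 H K W₀ σ H₀) (d : DarningData 𝒱 H K W₀)
    (ht : t ∈ Ioo (0 : ℝ) 1) (F : BoundedContinuousFunction (Collapse K) ℝ) (hx : x ∈ A t) :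
    ∫ p, F p ∂(H₀ (U t) (proj K x)) =
      ∫ y in S t, F (proj K y) ∂(T t x) + (1 - g x / t) * ∫ y, F (proj K y) ∂(σ t) := by
  have hB := hD.isNormalBauerFamily
  have hcont : Continuous fun y => ∫ p, F p ∂(H₀ (U t) (proj K y)) :=
    (hB.continuous_integral _ (USet_mem_VZero ht) F F.continuous).comp continuous_proj
  have hK : ∀ y ∈ closure (A t) ∩ K,
      ∫ p, F p ∂(H₀ (U t) (proj K y)) = ∫ z, F (proj K z) ∂(σ t) := fun y hy => by
    rw [proj_of_mem hy.2, hD.apply_point t ht, integral_map measurable_proj.aemeasurable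
      F.continuous.measurable.aestronglyMeasurable]
  have hfrontier : ∀ y ∈ frontier (O t), ∫ p, F p ∂(H₀ (U t) (proj K y)) = F (proj K y) :=
    fun y hy => by
      have hyU : proj K y ∉ U t := fun h =>
        ((d.isOpen_OSet t).frontier_eq.subset hy).2 ((d.preimage_USet ht.1).subset h)
      rw [(hB.isBoundaryKernel _ (USet_mem_VZero ht)).2 _ hyU,
        integral_dirac' _ _ F.continuous.measurable.stronglyMeasurable]
  rw [d.eq_setIntegral_add ht hcont.continuousOn (hD.isHarmonic_integral ht F) hK hx]
  congr 1
  refine integral_congr_ae ?_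
  filter_upwards [d.ae_restrict_SSet_mem_frontier_OSet ht hx] with z hz using hfrontier z hz

lemma map_sec_eq (hD : IsDarning 𝒱 H K W₀ σ H₀) (d : DarningData 𝒱 H K W₀)
    (hσ : IsSphereFamily 𝒱 H K W₀ σ) (ht : t ∈ Ioo (0 : ℝ) 1) (hx : x ∈ A t) :
    (H₀ (U t) (proj K x)).map (sec d.nonempty) = Q t x := by
  have hB := hD.isNormalBauerFamily
  have := hB.isMarkovKernel (USet_mem_VZero ht)
  have := d.isProbabilityMeasure_darnMeasure hσ ht x
  have hsec := measurable_sec d.isClosed_K d.nonempty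
  refine ext_of_forall_integral_eq_of_IsFiniteMeasure fun φ => ?_
  obtain ⟨F, hF⟩ := exists_boundedContinuousFunction_proj_eq d.isClosed_K d.nonempty
    isClosed_frontier (disjoint_SSet.mono_right (d.frontier_OSet_subset ht.1 ht.2)) φ
  have hφ := IsBddMeasurable.of_boundedContinuousFunction φ
  calc ∫ y, φ y ∂((H₀ (U t) (proj K x)).map (sec d.nonempty))
    _ = ∫ p, φ (sec d.nonempty p) ∂(H₀ (U t) (proj K x)) :=
        integral_map hsec.aemeasurable hφ.measurable.aestronglyMeasurable
    _ = ∫ p, F p ∂(H₀ (U t) (proj K x)) := by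
        refine integral_congr_ae ?_
        filter_upwards [(hB.isBoundaryKernel _ (USet_mem_VZero ht)).ae_mem_frontier
          (mem_insert_of_mem _ ⟨x, hx, rfl⟩)] with p hp
        rw [← hF, proj_sec]
        rwa [← d.preimage_frontier_USet ht.1, mem_preimage, proj_sec]
    _ = ∫ y in S t, F (proj K y) ∂(T t x) + (1 - g x / t) * ∫ y, F (proj K y) ∂(σ t) :=
        hD.integral_eq d ht F hx
    _ = ∫ y in S t, φ y ∂(T t x) + (1 - g x / t) * ∫ y, φ y ∂(σ t) := by
        rw [integral_congr_ae ((d.ae_restrict_SSet_mem_frontier_OSet ht hx).mono hF),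
          integral_congr_ae ((hD.ae_mem_frontier_OSet d ht).mono hF)]
    _ = ∫ y, φ y ∂(Q t x) := (d.integral_darnMeasure hσ ht hφ (ASet_subset_OSet hx)).symm

lemma isDarned (hD : IsDarning 𝒱 H K W₀ σ H₀) (d : DarningData 𝒱 H K W₀)
    (hσ : IsSphereFamily 𝒱 H K W₀ σ) : IsDarned d σ H₀ where
  agree V hV hVK x := hD.agree V hV hVK x
  darned t ht x := by
    rw [d.darnKernel_apply]
    by_cases hxK : x ∈ K
    · rw [proj_of_mem hxK, hD.apply_point t ht, d.darnMeasure_of_mem_K ht hxK]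
    by_cases hxO : x ∈ O t
    · have hsec : proj K ∘ sec d.nonempty = id := funext (proj_sec d.nonempty)
      rw [← hD.map_sec_eq d hσ ht ⟨⟨hxO.1, hxK⟩, hxO.2⟩,
        Measure.map_map measurable_proj (measurable_sec d.isClosed_K d.nonempty), hsec,
        Measure.map_id]
    · have hxU : proj K x ∉ U t := fun h => hxO ((d.preimage_USet ht.1).subset h)
      rw [(hD.isNormalBauerFamily.isBoundaryKernel _ (USet_mem_VZero ht)).2 _ hxU,
        darnMeasure_of_notMem hxO, Measure.map_dirac' measurable_proj]

lemma apply_eq (hD : IsDarning 𝒱 H K W₀ σ H₀) (d : DarningData 𝒱 H K W₀)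
    (hσ : IsSphereFamily 𝒱 H K W₀ σ) (ht : t ∈ Ioo (0 : ℝ) 1) {B : Set (Collapse K)}
    (hB : MeasurableSet B) (hx : x ∈ A t) :
    H₀ (U t) (proj K x) B = T t x (proj K ⁻¹' B ∩ S t) +
      ENNReal.ofReal (1 - g x / t) * σ t (proj K ⁻¹' B) := by
  rw [(hD.isDarned d hσ).darned t ht x, Measure.map_apply measurable_proj hB, d.darnKernel_apply,
    darnMeasure_of_mem (ASet_subset_OSet hx), Measure.add_apply,
    Measure.restrict_apply (measurable_proj hB), Measure.smul_apply, smul_eq_mul]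

-- `(H₁)` for `U_r ⊆ U_t`, evaluated at `x₀`.
lemma lintegral_AKernel_add (hD : IsDarning 𝒱 H K W₀ σ H₀) (d : DarningData 𝒱 H K W₀)
    (hσ : IsSphereFamily 𝒱 H K W₀ σ) (hr : 0 < r) (hrt : r < t) (ht : t < 1) {E : Set X}
    (hE : MeasurableSet E) (hES : E ⊆ S t) :
    ∫⁻ y, T t y E ∂(σ r) + ENNReal.ofReal (1 - r / t) * σ t E = σ t E := by
  have hrI : r ∈ Ioo (0 : ℝ) 1 := ⟨hr, hrt.trans ht⟩
  have htI : t ∈ Ioo (0 : ℝ) 1 := ⟨hr.trans hrt, ht⟩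
  have := (hσ r hrI).1
  have hpre : proj K ⁻¹' (proj K '' E) = E :=
    IsSaturated.preimage_image (Or.inl (disjoint_SSet.symm.mono_left hES))
  have hEm : MeasurableSet (proj K '' E) := by
    rwa [measurableSet_collapse_iff d.isClosed_K d.nonempty, hpre]
  have hUU : U r ⊆ U t :=
    insert_subset_insert (image_mono fun x hx => ⟨hx.1, hx.2.trans hrt⟩)
  calc ∫⁻ y, T t y E ∂(σ r) + ENNReal.ofReal (1 - r / t) * σ t E
    _ = ∫⁻ y, (T t y E + ENNReal.ofReal (1 - r / t) * σ t E) ∂(σ r) := by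
        rw [lintegral_add_right _ measurable_const, lintegral_const, measure_univ, mul_one]
    _ = ∫⁻ y, H₀ (U t) (proj K y) (proj K '' E) ∂(σ r) := by
        refine lintegral_congr_ae ?_
        filter_upwards [hσ.ae_mem hrI] with y hy
        rw [hD.apply_eq d hσ htI hEm (SSet_subset_ASet hrt hy), hpre, hy.2, inter_eq_left.2 hES]
    _ = (H₀ (U t) ∘ₖ H₀ (U r)) (point K) (proj K '' E) := by
        rw [Kernel.comp_apply' _ _ _ hEm, hD.apply_point r hrI,
          lintegral_map (Kernel.measurable_coe _ hEm) measurable_proj]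
    _ = σ t E := by
        rw [hD.isNormalBauerFamily.comp_eq _ (USet_mem_VZero htI) _ (USet_mem_VZero hrI) hUU,
          hD.apply_point t htI, Measure.map_apply measurable_proj hEm, hpre]

lemma isCompatible (hD : IsDarning 𝒱 H K W₀ σ H₀) (d : DarningData 𝒱 H K W₀)
    (hσ : IsSphereFamily 𝒱 H K W₀ σ) : IsCompatible 𝒱 H K W₀ σ := by
  intro r t hr hrt ht
  have ht0 : 0 < t := hr.trans hrt
  have := (hσ t ⟨ht0, ht⟩).1
  ext B hB
  have hE : MeasurableSet (B ∩ S t) := hB.inter (d.measurableSet_SSet t)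
  have hsplit : ENNReal.ofReal (r / t) * σ t (B ∩ S t) +
      ENNReal.ofReal (1 - r / t) * σ t (B ∩ S t) = σ t (B ∩ S t) := by
    rw [← add_mul, ← ENNReal.ofReal_add (div_nonneg hr.le ht0.le)
      (sub_nonneg.2 ((div_le_one ht0).2 hrt.le)), add_sub_cancel, ENNReal.ofReal_one, one_mul]
  rw [Measure.restrict_apply hB, Measure.bind_apply hE (Kernel.aemeasurable _),
    Measure.smul_apply, Measure.restrict_apply hB, smul_eq_mul]
  exact (ENNReal.add_left_inj (ENNReal.mul_ne_top ENNReal.ofReal_ne_top (measure_ne_top _ _))).1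
    ((hD.lintegral_AKernel_add d hσ hr hrt ht hE inter_subset_right).trans hsplit.symm)

end IsDarning

namespace IsDarned

variable {d : DarningData 𝒱 H K W₀}

lemma integral_image (hd : IsDarned d σ H₀) {V : Set X} (hV : V ∈ 𝒱) (hVK : closure V ∩ K = ∅)
    (h : Collapse K → ℝ) (x : X) :
    ∫ p, h p ∂(H₀ (proj K '' V) (proj K x)) = ∫ y, h (proj K y) ∂(H V x) := by
  have hbd := d.family.isBoundaryKernel V hV
  rw [hd.agree V hV hVK x]
  by_cases hx : x ∈ V
  · refine integral_map_proj d.isClosed_K ?_ h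
    filter_upwards [hbd.ae_mem_frontier hx] with y hy
    exact Set.disjoint_left.1 (disjoint_iff_inter_eq_empty.2 hVK) (frontier_subset_closure hy)
  · rw [hbd.2 x hx, integral_map_proj_dirac d.isClosed_K d.nonempty, integral_dirac]

lemma isHarmonic_of_notMem (hd : IsDarned d σ H₀) (hW : IsOpen W) (hp : point K ∉ W)
    (hh : IsHarmonic 𝒱 H (proj K ⁻¹' W) (h ∘ proj K)) : IsHarmonic (VZero 𝒱 H K W₀) H₀ W h := by
  refine ⟨(continuousOn_collapse_iff d.nonempty hW).2 hh.1, ?_⟩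
  rintro _ (⟨t, -, rfl⟩ | ⟨V, hV, hVK, rfl⟩) hVW p hpW
  · exact absurd (hVW (subset_closure (point_mem_USet t))) hp
  · obtain ⟨x, rfl⟩ := surjective_proj d.nonempty p
    rw [hd.integral_image hV hVK]
    exact hh.2 V hV (d.closure_subset_preimage hVW) x hpW

lemma isStronglyStable_point (hd : IsDarned d σ H₀) (hσ : IsSphereFamily 𝒱 H K W₀ σ) :
    IsStronglyStable (VZero 𝒱 H K W₀) H₀ {point K} := by
  have hsec : ∀ x, g (sec d.nonempty (proj K x)) = g x :=
    comp_sec_proj d.nonempty fun x hx => d.gFun_eq_zero hx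
  have hcomp : (fun p => g (sec d.nonempty p)) ∘ proj K = g := funext hsec
  have hpre : proj K ⁻¹' (proj K '' W₀ \ {point K}) = W₀ \ K := by
    rw [preimage_sdiff, d.preimage_image_W]
    congr 1
    exact Set.ext fun x => proj_eq_point_iff
  have hpW : point K ∈ proj K '' W₀ := d.insert_point_image_sdiff.subset (mem_insert _ _)
  refine ⟨isCompact_singleton, singleton_nonempty _, proj K '' W₀, hd.isPSet_image_W hσ,
    singleton_subset_iff.2 hpW, fun p => g (sec d.nonempty p), ?_, ?_, ?_⟩
  · refine hd.isHarmonic_of_notMem (d.isOpen_image_W.sdiff (isClosed_point d.isClosed_K))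
      (fun h => h.2 rfl) ?_
    rw [hcomp, hpre]
    exact d.isHarmonic_gFun
  · intro p hp
    obtain ⟨x, rfl⟩ := surjective_proj d.nonempty p
    exact (d.pos x (hpre.subset hp)).trans_eq (hsec x).symm
  · intro z hz
    obtain rfl : z = point K := (isClosed_point d.isClosed_K).frontier_subset hz
    have hc : ContinuousOn (fun p => g (sec d.nonempty p)) (proj K '' W₀) := by
      rw [continuousOn_collapse_iff d.nonempty d.isOpen_image_W, hcomp, d.preimage_image_W]
      exact d.continuousOn_gFun.mono subset_closure
    rw [← d.gFun_eq_zero (sec_point_mem d.nonempty)]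
    exact (hc _ hpW).mono sdiff_subset

end IsDarned

namespace DarningData

lemma closure_OSet_subset_preimage (d : DarningData 𝒱 H K W₀) (ht : 0 < t)
    (htW : closure (U t) ⊆ W) : closure (O t) ⊆ proj K ⁻¹' W := by
  rw [← d.preimage_closure_USet ht]
  exact preimage_mono htW

lemma isBddMeasurable_indicator_comp_proj (d : DarningData 𝒱 H K W₀) (hW : IsOpen W)
    (hc : ContinuousOn h W) (ht : 0 < t) (htW : closure (U t) ⊆ W) :
    IsBddMeasurable ((closure (O t)).indicator (h ∘ proj K)) :=
  IsBddMeasurable.of_continuousOn (d.isCompact_closure_OSet t)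
    (((continuousOn_collapse_iff d.nonempty hW).1 hc).mono (d.closure_OSet_subset_preimage ht htW))

lemma eq_setIntegral_indicator_add (d : DarningData 𝒱 H K W₀) (hW : IsOpen W)
    (hc : ContinuousOn h W) (hh : IsHarmonic 𝒱 H (proj K ⁻¹' (W \ {point K})) (h ∘ proj K))
    (ht : t ∈ Ioo (0 : ℝ) 1) (htW : closure (U t) ⊆ W) (hx : x ∈ A t) :
    h (proj K x) = ∫ y in S t, (closure (O t)).indicator (h ∘ proj K) y ∂(T t x) +
      (1 - g x / t) * h (point K) := by
  have hOW := d.closure_OSet_subset_preimage ht.1 htW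
  have hAW : A t ⊆ proj K ⁻¹' (W \ {point K}) := fun y hy =>
    ⟨hOW (subset_closure (ASet_subset_OSet hy)), fun hp => hy.1.2 (proj_eq_point_iff.1 hp)⟩
  have hvalue : (h ∘ proj K) x =
      ∫ y in S t, (h ∘ proj K) y ∂(T t x) + (1 - g x / t) * h (point K) :=
    d.eq_setIntegral_add ht (((continuousOn_collapse_iff d.nonempty hW).1 hc).mono
      ((closure_mono ASet_subset_OSet).trans hOW)) (hh.mono hAW)
      (fun y hy => congrArg h (proj_of_mem hy.2)) hx
  rw [Function.comp_apply] at hvalue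
  rw [hvalue]
  congr 1
  refine integral_congr_ae ?_
  filter_upwards [d.ae_restrict_SSet_mem_frontier_OSet ht hx] with z hz
  rw [indicator_of_mem (frontier_subset_closure hz)]

lemma integral_indicator_comp_proj (d : DarningData 𝒱 H K W₀)
    (hσ : IsSphereFamily 𝒱 H K W₀ σ) (hcp : IsCompatible 𝒱 H K W₀ σ) (ht : t ∈ Ioo (0 : ℝ) 1)
    (h : Collapse K → ℝ) :
    ∫ y, (closure (O t)).indicator (h ∘ proj K) y ∂(σ t) = ∫ y, h (proj K y) ∂(σ t) := by
  refine integral_congr_ae ?_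
  filter_upwards [d.ae_mem_frontier_OSet hσ hcp ht] with z hz
  rw [indicator_of_mem (frontier_subset_closure hz), Function.comp_apply]

lemma integral_sub_point (d : DarningData 𝒱 H K W₀) (hσ : IsSphereFamily 𝒱 H K W₀ σ)
    (hcp : IsCompatible 𝒱 H K W₀ σ) (hW : IsOpen W) (hc : ContinuousOn h W)
    (hh : IsHarmonic 𝒱 H (proj K ⁻¹' (W \ {point K})) (h ∘ proj K))
    (hr : 0 < r) (hrt : r < t) (ht : t < 1) (htW : closure (U t) ⊆ W) :
    ∫ y, h (proj K y) ∂(σ r) - h (point K) =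
      r / t * (∫ y, h (proj K y) ∂(σ t) - h (point K)) := by
  have hrI : r ∈ Ioo (0 : ℝ) 1 := ⟨hr, hrt.trans ht⟩
  have htI : t ∈ Ioo (0 : ℝ) 1 := ⟨hr.trans hrt, ht⟩
  have := (hσ r hrI).1
  have := d.isMarkovKernel htI
  let k : X → ℝ := (closure (O t)).indicator (h ∘ proj K)
  have hk : IsBddMeasurable k := d.isBddMeasurable_indicator_comp_proj hW hc htI.1 htW
  have h_int : Integrable (fun y => ∫ z in S t, k z ∂(T t y)) (σ r) := by
    simpa only [integral_indicator (d.measurableSet_SSet t)] using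
      ((hk.indicator (d.measurableSet_SSet t)).integral_kernel (T t)).integrable (σ r)
  have hmean : ∫ y, h (proj K y) ∂(σ r) =
      r / t * ∫ y, h (proj K y) ∂(σ t) + (1 - r / t) * h (point K) := by
    calc ∫ y, h (proj K y) ∂(σ r)
      _ = ∫ y, (∫ z in S t, k z ∂(T t y) + (1 - r / t) * h (point K)) ∂(σ r) := by
          refine integral_congr_ae ?_
          filter_upwards [hσ.ae_mem hrI] with y hy
          rw [d.eq_setIntegral_indicator_add hW hc hh htI htW (SSet_subset_ASet hrt hy), hy.2]
      _ = ∫ y, ∫ z in S t, k z ∂(T t y) ∂(σ r) + (1 - r / t) * h (point K) := by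
          rw [integral_add h_int (integrable_const _), integral_const, probReal_univ, one_smul]
      _ = r / t * ∫ y, h (proj K y) ∂(σ t) + (1 - r / t) * h (point K) := by
          rw [d.integral_setIntegral_of_isCompatible hσ hcp hr hrt ht hk,
            d.integral_indicator_comp_proj hσ hcp htI]
  rw [hmean]
  ring

lemma integral_eq_point_iff (d : DarningData 𝒱 H K W₀)
    (hσ : IsSphereFamily 𝒱 H K W₀ σ) (hcp : IsCompatible 𝒱 H K W₀ σ) (hW : IsOpen W)
    (hc : ContinuousOn h W) (hh : IsHarmonic 𝒱 H (proj K ⁻¹' (W \ {point K})) (h ∘ proj K))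
    (hr : 0 < r) (hrt : r < t) (ht : t < 1) (htW : closure (U t) ⊆ W) :
    ∫ y, h (proj K y) ∂(σ r) = h (point K) ↔ ∫ y, h (proj K y) ∂(σ t) = h (point K) := by
  rw [← sub_eq_zero, d.integral_sub_point hσ hcp hW hc hh hr hrt ht htW, mul_eq_zero,
    or_iff_right (div_pos hr (hr.trans hrt)).ne', sub_eq_zero]

end DarningData

namespace IsDarned

variable {d : DarningData 𝒱 H K W₀}

lemma integral_USet_point (hd : IsDarned d σ H₀) (hσ : IsSphereFamily 𝒱 H K W₀ σ)
    (ht : t ∈ Ioo (0 : ℝ) 1) (h : Collapse K → ℝ) :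
    ∫ p, h p ∂(H₀ (U t) (point K)) = ∫ y, h (proj K y) ∂(σ t) := by
  obtain ⟨x, hx⟩ := d.nonempty
  rw [← proj_of_mem hx, hd.darned t ht x, d.darnKernel_apply, d.darnMeasure_of_mem_K ht hx]
  refine integral_map_proj d.isClosed_K ?_ h
  filter_upwards [hσ.ae_mem ht] with y hy using hy.1.2

lemma integral_USet_of_mem_ASet (hd : IsDarned d σ H₀) (hσ : IsSphereFamily 𝒱 H K W₀ σ)
    (hcp : IsCompatible 𝒱 H K W₀ σ) (hW : IsOpen W) (hc : ContinuousOn h W)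
    (hh : IsHarmonic 𝒱 H (proj K ⁻¹' (W \ {point K})) (h ∘ proj K)) (ht : t ∈ Ioo (0 : ℝ) 1)
    (htW : closure (U t) ⊆ W) (hm : ∫ y, h (proj K y) ∂(σ t) = h (point K)) (hx : x ∈ A t) :
    ∫ p, h p ∂(H₀ (U t) (proj K x)) = h (proj K x) := by
  have hae : ∀ᵐ y ∂(Q t x), y ∈ frontier (O t) :=
    (d.isBoundaryKernel_darnKernel hσ hcp ht).ae_mem_frontier (ASet_subset_OSet hx)
  calc ∫ p, h p ∂(H₀ (U t) (proj K x))
    _ = ∫ y, h (proj K y) ∂(Q t x) := by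
        rw [hd.darned t ht x, d.darnKernel_apply]
        refine integral_map_proj d.isClosed_K ?_ h
        filter_upwards [hae] with y hy using (d.frontier_OSet_subset ht.1 ht.2 hy).1.2
    _ = ∫ y, (closure (O t)).indicator (h ∘ proj K) y ∂(Q t x) := by
        refine integral_congr_ae ?_
        filter_upwards [hae] with y hy
        rw [indicator_of_mem (frontier_subset_closure hy), Function.comp_apply]
    _ = h (proj K x) := by
        rw [d.integral_darnMeasure hσ ht (d.isBddMeasurable_indicator_comp_proj hW hc ht.1 htW)
          (ASet_subset_OSet hx), d.integral_indicator_comp_proj hσ hcp ht, hm,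
          ← d.eq_setIntegral_indicator_add hW hc hh ht htW hx]

lemma integral_USet (hd : IsDarned d σ H₀) (hσ : IsSphereFamily 𝒱 H K W₀ σ)
    (hcp : IsCompatible 𝒱 H K W₀ σ) (hW : IsOpen W) (hc : ContinuousOn h W)
    (hh : IsHarmonic 𝒱 H (proj K ⁻¹' (W \ {point K})) (h ∘ proj K)) (ht : t ∈ Ioo (0 : ℝ) 1)
    (htW : closure (U t) ⊆ W) (hm : ∫ y, h (proj K y) ∂(σ t) = h (point K)) (x : X) :
    ∫ p, h p ∂(H₀ (U t) (proj K x)) = h (proj K x) := by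
  by_cases hxK : x ∈ K
  · rw [proj_of_mem hxK, hd.integral_USet_point hσ ht, hm]
  by_cases hxO : x ∈ O t
  · exact hd.integral_USet_of_mem_ASet hσ hcp hW hc hh ht htW hm ⟨⟨hxO.1, hxK⟩, hxO.2⟩
  · rw [hd.darned t ht x, d.darnKernel_apply, darnMeasure_of_notMem hxO,
      integral_map_proj_dirac d.isClosed_K d.nonempty]

lemma isHarmonic_of_integral_eq_point (hd : IsDarned d σ H₀) (hσ : IsSphereFamily 𝒱 H K W₀ σ)
    (hcp : IsCompatible 𝒱 H K W₀ σ) (hW : IsOpen W) (hc : ContinuousOn h W)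
    (hh : IsHarmonic 𝒱 H (proj K ⁻¹' (W \ {point K})) (h ∘ proj K))
    (hm : ∀ t ∈ Ioo (0 : ℝ) 1, closure (U t) ⊆ W → ∫ y, h (proj K y) ∂(σ t) = h (point K)) :
    IsHarmonic (VZero 𝒱 H K W₀) H₀ W h := by
  refine ⟨hc, ?_⟩
  rintro _ (⟨t, ht, rfl⟩ | ⟨V, hV, hVK, rfl⟩) hVW p - <;>
    obtain ⟨x, rfl⟩ := surjective_proj d.nonempty p
  · exact hd.integral_USet hσ hcp hW hc hh ht hVW (hm t ht hVW) x
  · rw [hd.integral_image hV hVK]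
    by_cases hxV : x ∈ V
    · have hVW' : closure V ⊆ proj K ⁻¹' (W \ {point K}) := fun y hy =>
        ⟨d.closure_subset_preimage hVW hy, fun hyp =>
          Set.disjoint_left.1 (disjoint_iff_inter_eq_empty.2 hVK) hy (proj_eq_point_iff.1 hyp)⟩
      exact hh.2 V hV hVW' x (hVW' (subset_closure hxV))
    · rw [(d.family.isBoundaryKernel V hV).2 x hxV, integral_dirac]

lemma tfae_isHarmonic (hd : IsDarned d σ H₀) (hσ : IsSphereFamily 𝒱 H K W₀ σ)
    (hcp : IsCompatible 𝒱 H K W₀ σ) (hW : IsOpen W) (hp : point K ∈ W)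
    (hc : ContinuousOn h W) (hh : IsHarmonic 𝒱 H (proj K ⁻¹' (W \ {point K})) (h ∘ proj K)) :
    List.TFAE [
      IsHarmonic (VZero 𝒱 H K W₀) H₀ W h,
      ∀ r ∈ Ioo (0 : ℝ) 1, closure (U r) ⊆ W → ∫ x, h (proj K x) ∂(σ r) = h (point K),
      ∃ r ∈ Ioo (0 : ℝ) 1, closure (U r) ⊆ W ∧ ∫ x, h (proj K x) ∂(σ r) = h (point K)] := by
  tfae_have 1 → 2 := fun hharm r hr hrW =>
    (hd.integral_USet_point hσ hr h).symm.trans (hharm.2 _ (USet_mem_VZero hr) hrW _ hp)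
  tfae_have 2 → 1 := hd.isHarmonic_of_integral_eq_point hσ hcp hW hc hh
  tfae_have 2 → 3 := fun hall =>
    let ⟨t, ht, htW⟩ := d.exists_closure_USet_subset hW hp
    ⟨t, ht, htW, hall t ht htW⟩
  tfae_have 3 → 2 := by
    rintro ⟨s, hs, hsW, hm⟩ r hr hrW
    rcases lt_trichotomy r s with hrs | rfl | hsr
    · exact (d.integral_eq_point_iff hσ hcp hW hc hh hr.1 hrs hs.2 hsW).2 hm
    · exact hm
    · exact (d.integral_eq_point_iff hσ hcp hW hc hh hs.1 hsr hr.2 hrW).1 hm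
  tfae_finish

end IsDarned

end Darning

end Bauer

theorem theorem2p2 {X : Type*} [TopologicalSpace X] [T2Space X] [LocallyCompactSpace X]
    [SecondCountableTopology X] [MeasurableSpace X] [BorelSpace X]
    (𝒱 : Set (Set X)) (H : Set X → Kernel X X) (hH : Bauer.IsNormalBauerFamily 𝒱 H)
    (K : Set X) (hK : Bauer.IsStronglyStable 𝒱 H K)
    (W₀ : Set X) (hW₀ : Bauer.IsRegular 𝒱 H W₀) (hW₀P : Bauer.IsPSet 𝒱 H W₀) (hKW₀ : K ⊆ W₀)
    (hW₀K : Bauer.IsRegular 𝒱 H (W₀ \ K)) (hg : ∀ x ∈ W₀ \ K, 0 < Bauer.gFun 𝒱 H K W₀ x)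
    (σ : ℝ → Measure X)
    (hσ : ∀ r ∈ Ioo (0 : ℝ) 1,
      IsProbabilityMeasure (σ r) ∧ σ r (Bauer.SSet 𝒱 H K W₀ r)ᶜ = 0) :
    ((∃ H₀, Bauer.IsDarning 𝒱 H K W₀ σ H₀) ↔ Bauer.IsCompatible 𝒱 H K W₀ σ) ∧
    ∀ H₀, Bauer.IsDarning 𝒱 H K W₀ σ H₀ →
      (∀ t ∈ Ioo (0 : ℝ) 1, ∀ B : Set (Bauer.Collapse K), MeasurableSet B →
        ∀ y ∈ Bauer.ASet 𝒱 H K W₀ t,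
          H₀ (Bauer.USet 𝒱 H K W₀ t) (Bauer.proj K y) B =
            Bauer.harmonicKernel 𝒱 H (Bauer.ASet 𝒱 H K W₀ t) y
                (Bauer.proj K ⁻¹' B ∩ Bauer.SSet 𝒱 H K W₀ t) +
              ENNReal.ofReal (1 - Bauer.gFun 𝒱 H K W₀ y / t) * σ t (Bauer.proj K ⁻¹' B)) ∧
      Bauer.IsStronglyStable (Bauer.VZero 𝒱 H K W₀) H₀ {Bauer.point K} ∧
      Bauer.IsPSet (Bauer.VZero 𝒱 H K W₀) H₀
        (insert (Bauer.point K) (Bauer.proj K '' (W₀ \ K))) ∧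
      ∀ W : Set (Bauer.Collapse K), IsOpen W → Bauer.point K ∈ W →
        ∀ h : Bauer.Collapse K → ℝ, ContinuousOn h W →
          Bauer.IsHarmonic 𝒱 H (Bauer.proj K ⁻¹' (W \ {Bauer.point K})) (h ∘ Bauer.proj K) →
          List.TFAE [
            Bauer.IsHarmonic (Bauer.VZero 𝒱 H K W₀) H₀ W h,
            ∀ r ∈ Ioo (0 : ℝ) 1, closure (Bauer.USet 𝒱 H K W₀ r) ⊆ W →
              ∫ x, h (Bauer.proj K x) ∂(σ r) = h (Bauer.point K),
            ∃ r ∈ Ioo (0 : ℝ) 1, closure (Bauer.USet 𝒱 H K W₀ r) ⊆ W ∧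
              ∫ x, h (Bauer.proj K x) ∂(σ r) = h (Bauer.point K)] := by
  have d : Bauer.DarningData 𝒱 H K W₀ := ⟨hH, hK.1, hK.2.1, hW₀, hW₀P, hKW₀, hW₀K, hg⟩
  refine ⟨⟨fun ⟨H₀, hD⟩ => hD.isCompatible d hσ,
    fun hc => ⟨_, d.isDarning_darnedFamily hσ hc⟩⟩, fun H₀ hD => ?_⟩
  have hd := hD.isDarned d hσ
  refine ⟨fun t ht B hB y hy => hD.apply_eq d hσ ht hB hy, hd.isStronglyStable_point hσ, ?_,
    fun W hW hp h hc hh => hd.tfae_isHarmonic hσ (hD.isCompatible d hσ) hW hp hc hh⟩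
  rw [d.insert_point_image_sdiff]
  exact hd.isPSet_image_W hσ
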